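/- **Setting.** Let $\Gamma$ be a finite simple graph with vertex set $V$ and edge set $E$, let $d\ge 0$, and write configurations as $x=(x_v)_{v\in V}\in\mathbb R^{d|V|}$. A *graph weight* consists of vertex weights $u[v]\in C^\infty(\mathbb R^d)$ and edge weights $u[e]\in C^\infty(\mathbb R^{2d}\setminus\{x=y\})$ (complex valued), one for each $v\in V$ and $e\in E$; $u[\Gamma](x)=\prod_{e=vw\in E}u[e](x_v,x_w)\prod_{v\in V}u[v](x_v)$. *Scaling degree.* For $u\in C^\infty(\mathbb R^{2d}\setminus\{x=y\})$ let $\underline{\mathrm{sd}}(u)\in[-\infty,\infty]$ be the infimum of all $\alpha\in\mathbb R$ such that $\lambda^\alpha u(a+\lambda x,a+\lambda y)\to0$ as $\lambda\to0^+$ in $C^\infty(\mathbb R^{2d}\setminus\{x=y\})$ (i.e. locally uniformly in $(x,y)$, with all derivatives in $(x,y)$), locally uniformly in $a\in\mathbb R^d$. For $\gamma\subseteq V$ let $E(\gamma)$ be the set of all edges with both ends in $\gamma$, let $\underline{\mathrm{sd}}(u[\gamma])=\sum_{e\in E(\gamma)}\underline{\mathrm{sd}}(u[e])$, $\underline{\deg}(u[\gamma])=\underline{\mathrm{sd}}(u[\gamma])-d(|\gamma|-1)$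 and $d(\gamma)=\lfloor\underline{\deg}(u[\gamma])\rfloor$. *Forests.* A forest is a set $F$ of vertex sets $\gamma\subseteq V$ with $E(\gamma)\neq\emptyset$, any two of which are nested or disjoint. For such $\gamma$ let $\bar x_\gamma=\frac1{2|E(\gamma)|}\sum_{v\in\gamma}|E(\gamma|v)|\,x_v$, where $E(\gamma|v)$ is the set of edges in $E(\gamma)$ incident to $v$; let $c_\gamma(x)$ be the configuration obtained from $x$ by replacing $x_v$ by $\bar x_\gamma$ for all $v\in\gamma$, and let $$t(\gamma)f(x)=\sum_{|\alpha|\le d(\gamma)}\frac{(x-c_\gamma(x))^\alpha}{\alpha!}\,(\partial^\alpha f)(c_\gamma(x)),$$ where $\alpha$ runs over multi-indices in the variables $x_v$, $v\in\gamma$ ($t(\gamma)=0$ if $d(\gamma)<0$). *R-operation.* $Ru[\Gamma]=\sum_F\prod_{\gamma\in F}(-t(\gamma)\mathbb P(\gamma))\,u[\Gamma]$, the sum being over all forests, including $F=\emptyset$. Here the operator of $\gamma$ leaves the factor $\prod_{e\in E(\gamma)}u[e]$ untouched and applies $-t(\gamma)$ to all remaining factors (those of the edges not in $E(\gamma)$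 and all vertex weights). When $\gamma\subset\gamma'$ are both in $F$, $t(\gamma)$ acts on the expression that already contains the result of $t(\gamma')$, a function of $x$ also through $\bar x_{\gamma'}$. *Non-exceptional configurations.* For a forest $F$ let $c_F(x)$ be the configuration obtained from $x$ by applying $c_\gamma$ for all $\gamma\in F$, smaller sets first. For $\varepsilon>0$ let $N_\varepsilon$ be the set of all $x$ such that, for every forest $F$ all of whose members have $d(\gamma)\ge0$, every edge $vw\in E$ that is contained in no member of $F$, and every $\gamma\in F$ containing one of $v,w$, $$|c_F(x)_v-c_F(x)_w|\ \ge\ \varepsilon\,\max_{i,j\in\gamma}|x_i-x_j| .$$ So coincidences of the vertices themselves are permitted, but a contracted subgraph of positive extension must stay away, relative to its extension, from the points to which it is joined. The sets $N_\varepsilon$ increase, as $\varepsilon\downarrow0$, to the set of all configurations in which no contracted subgraph of positive extension meets a point to which it is joined. **Theorem.** Assume that $0<\underline{\mathrm{sd}}(u[e])<\infty$ for every edge $e\in E$. Then $Ru[\Gamma]$ is locally integrable for non-exceptional configurations: for every $\varepsilon>0$, $$\mathbf 1_{N_\varepsilon}\,Ru[\Gamma]\in L^1_{\mathrm{loc}}(\mathbb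 R^{d|V|}),$$ that is, $\int_{K\cap N_\varepsilon}|Ru[\Gamma](x)|\,dx<\infty$ for every compact $K\subset\mathbb R^{d|V|}$, including compact sets that meet the large graph diagonal. -/

import Mathlib

open scoped ContDiff Topology
open Filter MeasureTheory

namespace BPHZ

noncomputable section

/-- Points of `ℝ^d` with the Euclidean norm. -/
abbrev Pt (d : ℕ) := EuclideanSpace ℝ (Fin d)

/-- Configurations `(x_v)_{v ∈ V}`, i.e. points of `ℝ^{d|V|}`. -/
abbrev Config (V : Type*) (d : ℕ) := V → Pt d

/-- `u` is a function on `ℝ^{2d}` minus the diagonal. This says that `l^α u(a + l ·) → 0` as `l → 0+`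
in the topology of `C^∞(ℝ^{2d} minus diagonal)` (locally uniformly with all derivatives), and
locally uniformly in the point `(a, a)` of the diagonal towards which one scales. -/
def ScalesAt {d : ℕ} (u : Pt d × Pt d → ℂ) (α : ℝ) : Prop :=
  ∀ k : ℕ, TendstoLocallyUniformlyOn
    (fun (l : ℝ) (q : Pt d × (Pt d × Pt d)) =>
      iteratedFDeriv ℝ k
        (fun p : Pt d × Pt d => ((l ^ α : ℝ) : ℂ) * u (q.1 + l • p.1, q.1 + l • p.2)) q.2)
    (fun _ => 0) (𝓝[>] (0 : ℝ)) {q | q.2.1 ≠ q.2.2}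

/-- The UV scaling degree at the diagonal: the infimum of all admissible exponents. -/
def scalingDegree {d : ℕ} (u : Pt d × Pt d → ℂ) : EReal :=
  sInf ((fun α : ℝ => (α : EReal)) '' {α : ℝ | ScalesAt u α})

/-- Weights on a simple graph. Every edge `e` carries the orientation `Quot.out e = (s(e), t(e))`;
the edge weight is a function of `(x_{s(e)}, x_{t(e)})`, smooth off the diagonal. The vertex weights
are smooth everywhere. -/
structure GraphWeight {V : Type*} (G : SimpleGraph V) (d : ℕ) where
  edge : Sym2 V → Pt d × Pt d → ℂ
  vertex : V → Pt d → ℂ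
  edge_smooth : ∀ e ∈ G.edgeSet, ContDiffOn ℝ ∞ (edge e) {p | p.1 ≠ p.2}
  vertex_smooth : ∀ v, ContDiff ℝ ∞ (vertex v)

section Graph

variable {V : Type*} [Fintype V] (G : SimpleGraph V)

open Classical in
/-- All edges of the graph. -/
def allEdges : Finset (Sym2 V) := Finset.univ.filter (fun e => e ∈ G.edgeSet)

open Classical in
/-- `E(γ)` for the full vertex part on the vertex set `γ`: all edges with both ends in `γ`. -/
def edgesIn (γ : Finset V) : Finset (Sym2 V) :=
  (allEdges G).filter (fun e => ∀ v ∈ e, v ∈ γ)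

open Classical in
/-- `|E(γ|v)|`: the number of edges of `γ` incident to `v`. -/
def incidence (γ : Finset V) (v : V) : ℕ := ((edgesIn G γ).filter (fun e => v ∈ e)).card

/-- The weighted mean point of `γ`. -/
def meanPoint {d : ℕ} (γ : Finset V) (x : Config V d) : Pt d :=
  (2 * ((edgesIn G γ).card : ℝ))⁻¹ • ∑ v ∈ γ, (incidence G γ v : ℝ) • x v

open Classical in
/-- The configuration in which all vertices of `γ` are moved to the mean point of `γ`. -/
def contract {d : ℕ} (γ : Finset V) (x : Config V d) : Config V d :=
  fun v => if v ∈ γ then meanPoint G γ x else x v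

/-- The Taylor polynomial of order `k` in the variables `x_v`, `v ∈ γ`, about the mean point of `γ`;
it is `0` for negative `k`. With `h = x - contract γ x`, which is supported on `γ`, the sum over the
multi-indices of length `j` of `h^α / α! f^{(α)}` is `D^j f [h, …, h] / j!`. -/
def taylor {d : ℕ} (k : ℤ) (γ : Finset V) (f : Config V d → ℂ) (x : Config V d) : ℂ :=
  ∑ j ∈ Finset.range (k + 1).toNat,
    ((j.factorial : ℂ))⁻¹ *
      iteratedFDeriv ℝ j f (contract G γ x) (fun _ => x - contract G γ x)

/-- Two vertex sets overlap: they are neither nested nor disjoint. -/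
def Overlapping (γ γ' : Finset V) : Prop :=
  ¬ γ ⊆ γ' ∧ ¬ γ' ⊆ γ ∧ ¬ Disjoint γ γ'

/-- A forest: a set of mutually non-overlapping full vertex parts. Each of them has an edge, since
otherwise its mean point is not defined. -/
def IsForest (F : Finset (Finset V)) : Prop :=
  (∀ γ ∈ F, (edgesIn G γ).Nonempty) ∧ ∀ γ ∈ F, ∀ γ' ∈ F, ¬ Overlapping γ γ'

open Classical in
/-- The set of all forests. -/
def forests : Finset (Finset (Finset V)) := Finset.univ.filter (fun F => IsForest G F)

/-- The members of `F` in an order in which smaller sets come first. Members of a forest that have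
the same cardinality are disjoint, so that their relative order is immaterial. -/
def innerFirst (F : Finset (Finset V)) : List (Finset V) :=
  F.toList.mergeSort (fun a b => decide (a.card ≤ b.card))

/-- The configuration obtained from `x` by contracting all members of `F`, inner ones first. -/
def contractAll {d : ℕ} (F : Finset (Finset V)) (x : Config V d) : Config V d :=
  (innerFirst F).foldl (fun z γ => contract G γ z) x

end Graph

namespace GraphWeight

variable {V : Type*} [Fintype V] {G : SimpleGraph V} {d : ℕ} (u : GraphWeight G d)

/-- The value of the weight of the edge `e` at the configuration `x`. -/
def edgeVal (x : Config V d) (e : Sym2 V) : ℂ :=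
  u.edge e (x (Quot.out e).1, x (Quot.out e).2)

/-- The UV degree of divergence of `u[γ]`: its scaling degree, i.e. the sum of the scaling degrees
of its edge weights (the vertex weights are smooth), minus `d (|V(γ)| - 1)`. -/
def uvDegree (γ : Finset V) : ℝ :=
  (∑ e ∈ edgesIn G γ, (scalingDegree (u.edge e)).toReal) - (d : ℝ) * ((γ.card : ℝ) - 1)

/-- The subtraction degree `d(γ)`. -/
def subDegree (γ : Finset V) : ℤ := ⌊u.uvDegree γ⌋

open Classical in
/-- The graph weight with the edges in `S` removed (all vertex weights are kept); for `S = ∅` it is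
`u[Γ]`, and for `S = E(γ)` it is the weight onto which the operator `P(γ)` maps. -/
def weightWithout (S : Finset (Sym2 V)) (x : Config V d) : ℂ :=
  (∏ e ∈ allEdges G \ S, u.edgeVal x e) * ∏ v, u.vertex v (x v)

open Classical in
/-- The product of the operators `-t(γ) P(γ)` over the members `γ` of a list with inner members
first, applied to the weight with the edges in `S` removed. The operator of `γ` leaves the edge
weights of `γ` untouched and applies `-t(γ)` to all that is left, on which the operators of the
members that contain `γ` have acted already. -/
def forestTerm : List (Finset V) → Finset (Sym2 V) → Config V d → ℂ
  | [], S => u.weightWithout S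
  | γ :: l, S => fun x =>
      (∏ e ∈ edgesIn G γ \ S, u.edgeVal x e) *
        (- taylor G (u.subDegree γ) γ (forestTerm l (S ∪ edgesIn G γ)) x)

/-- The `R`-operation, by the forest formula. -/
def bphzR (x : Config V d) : ℂ :=
  ∑ F ∈ forests G, u.forestTerm (innerFirst F) ∅ x

/-- The `ε`-non-exceptional configurations. For every forest `F` of subgraphs on which the
`R`-operation acts nontrivially, and every edge `vw` that survives the contraction of the members of
`F`, the contracted ends of this edge do not meet: their distance is at least `ε` times the extension
of each contracted member that contains one of the two ends. Coincidences of vertices as such are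
not excluded. -/
def nonExceptional (ε : ℝ) : Set (Config V d) :=
  {x | ∀ F ∈ forests G, (∀ γ ∈ F, 0 ≤ u.subDegree γ) →
    ∀ v w, G.Adj v w → (∀ γ ∈ F, ¬ (v ∈ γ ∧ w ∈ γ)) →
      ∀ γ ∈ F, v ∈ γ → ∀ i ∈ γ, ∀ j ∈ γ,
        ε * ‖x i - x j‖ ≤ ‖contractAll G F x v - contractAll G F x w‖}

end GraphWeight

end

end BPHZ

/-!
The proof bounds `u.bphzR` pointwise, on bounded sets of non-exceptional configurations of
pairwise distinct points, by the locally integrable function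
`majorant β x = ∏ i, (1 + ∑ j > i, ‖x i - x j‖ ^ (-β))`, with some `β < d`.

*Scales.* A constant in this bound exists unless there is a sequence of configurations that
violates all of them. Along an ultrafilter the distances in this sequence are totally preordered
by their asymptotic size, and the position in this preorder is an ultrametric rank `r` on the
vertices (`exists_adapted`). So it suffices to prove the bound for configurations whose distances
are comparable to scales `sc (r i j)`, where the scales of different ranks are separated by as
large a factor as desired (`Adapted`).

*Grouping of forests.* For a forest `F` the `forestRank` of two vertices is the rank of their
distance or, if it is larger, of the largest member of `F` that separates them. A set on which the
`R`-operation acts is called tight for `F` if it is a ball of this ultrametric. Tight sets can be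
added to or removed from `F` without changing the forest rank, so that the forests are grouped by
their non-tight part `B`, and the members of a group are the sets `B ∪ X`, with `X` an arbitrary
set of tight sets (`sum_admForests`). The terms of a group add up to
`∏_{γ ∈ B} (-t γ) ∏_{γ tight} (1 - t γ)`, in which every tight `γ` contributes a Taylor remainder.

*Parameters.* The operators act one inside the other, and the inner ones also differentiate the
mean points of the outer ones. To disentangle them, each contraction is interpolated by a
parameter (`flow`), which turns the Taylor operators into commuting one-variable operators `jet`
on functions of the parameters (`termOf_eq_jets`, `sum_forestTerm_eq`). On the box of parameters,
the length of every edge stays above a fixed multiple of the scale of its forest rank. This is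
where the lower bound of non-exceptional configurations is needed, for the contraction of the
members of `B`; the expansions about tight sets change the length by a small fraction only,
because a tight set is much smaller than its distance from all other points
(`exists_le_norm_ends`). The scaling degree bounds all derivatives of the edge weights at this
scale, and the group is bounded by the product of the edge weights at their scales times a factor
`(inner scale / outer scale)^(subDegree + 1)` for every tight set (`exists_norm_group_le`).

*Power counting.* The logarithm of this bound telescopes into contributions of single levels, and
at each level the clusters are balls of the forest rank. The degree of divergence of a cluster of
several vertices, reduced by `subDegree + 1` if the cluster is tight, is negative, also for
exponents slightly larger than the scaling degrees (`exists_exponents`). Hence each level costs at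
most `β` for every vertex that has a successor within the scale of the level (`sum_level_le`),
which gives the majorant (`prod_le_majorant`).
-/


open scoped ContDiff Topology
open Filter MeasureTheory

namespace BPHZ

noncomputable section

open scoped Classical

/-! ### Ultrametric ranks and the grouping of forests -/

section Rank

variable {V : Type*}

/-- An ultrametric on `V` with values in `ℕ`: the value at `(v, w)` is the rank of the distance
`‖x v - x w‖` among the orders of magnitude of all mutual distances. -/
structure IsRank (r : V → V → ℕ) : Prop where
  self : ∀ v, r v v = 0
  symm : ∀ v w, r v w = r w v
  tri : ∀ u v w, r u w ≤ max (r u v) (r v w)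

/-- The rank of the diameter of `γ`. -/
def diamRank (r : V → V → ℕ) (γ : Finset V) : ℕ := (γ ×ˢ γ).sup (fun p => r p.1 p.2)

/-- Exactly one of the two vertices lies in `γ`. -/
def Sep (γ : Finset V) (v w : V) : Prop := ¬ (v ∈ γ ↔ w ∈ γ)

/-- The rank of the distance between `v` and `w` after the contraction of the members of `F`: for
non-exceptional configurations it is not below the rank of the diameter of a member that separates
`v` from `w`. -/
def forestRank (r : V → V → ℕ) (F : Finset (Finset V)) (v w : V) : ℕ :=
  max (r v w) ((F.filter (fun γ => Sep γ v w)).sup (diamRank r))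

/-- No two members overlap. -/
def Laminar (F : Finset (Finset V)) : Prop := ∀ γ ∈ F, ∀ γ' ∈ F, ¬ Overlapping γ γ'

variable {r : V → V → ℕ} {F : Finset (Finset V)} {γ γ' : Finset V} {u v w : V} {n : ℕ}

lemma Sep.symm (h : Sep γ v w) : Sep γ w v := fun h' => h h'.symm

lemma Sep.or (h : Sep γ u w) (v : V) : Sep γ u v ∨ Sep γ v w := by
  unfold Sep at *; tauto

lemma not_overlapping_iff : ¬ Overlapping γ γ' ↔ γ ⊆ γ' ∨ γ' ⊆ γ ∨ Disjoint γ γ' := by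
  unfold Overlapping; tauto

lemma Laminar.subset_of_sep (hF : Laminar F) (hγ : γ ∈ F) (hγ' : γ' ∈ F)
    (hv : v ∈ γ) (hw : w ∈ γ) (h : Sep γ' v w) : γ' ⊆ γ := by
  rcases not_overlapping_iff.1 (hF γ hγ γ' hγ') with h1 | h1 | h1
  · exact absurd ⟨fun _ => h1 hw, fun _ => h1 hv⟩ h
  · exact h1
  · exact absurd ⟨fun h' => absurd h' (Finset.disjoint_left.1 h1 hv),
      fun h' => absurd h' (Finset.disjoint_left.1 h1 hw)⟩ h

lemma le_diamRank (hv : v ∈ γ) (hw : w ∈ γ) : r v w ≤ diamRank r γ :=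
  Finset.le_sup (f := fun p : V × V => r p.1 p.2) (b := (v, w))
    (Finset.mem_product.2 ⟨hv, hw⟩)

lemma diamRank_le (h : ∀ v ∈ γ, ∀ w ∈ γ, r v w ≤ n) : diamRank r γ ≤ n :=
  Finset.sup_le fun _ hp => h _ (Finset.mem_product.1 hp).1 _ (Finset.mem_product.1 hp).2

lemma diamRank_mono (h : γ ⊆ γ') : diamRank r γ ≤ diamRank r γ' :=
  diamRank_le fun _ hv _ hw => le_diamRank (h hv) (h hw)

lemma exists_eq_diamRank (h : γ.Nonempty) : ∃ v ∈ γ, ∃ w ∈ γ, diamRank r γ = r v w := by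
  obtain ⟨p, hp, h⟩ := Finset.exists_mem_eq_sup (γ ×ˢ γ) (h.product h) (fun p => r p.1 p.2)
  exact ⟨p.1, (Finset.mem_product.1 hp).1, p.2, (Finset.mem_product.1 hp).2, h⟩

lemma forestRank_le_iff :
    forestRank r F v w ≤ n ↔ r v w ≤ n ∧ ∀ γ ∈ F, Sep γ v w → diamRank r γ ≤ n := by
  simp [forestRank, Finset.sup_le_iff]

lemma le_forestRank : r v w ≤ forestRank r F v w := le_max_left _ _

lemma diamRank_le_forestRank (hγ : γ ∈ F) (h : Sep γ v w) : diamRank r γ ≤ forestRank r F v w :=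
  (forestRank_le_iff.1 le_rfl).2 γ hγ h

lemma IsRank.forestRank (hr : IsRank r) (F : Finset (Finset V)) : IsRank (forestRank r F) where
  self v := by
    have : BPHZ.forestRank r F v v ≤ 0 := forestRank_le_iff.2 ⟨(hr.self v).le, fun γ _ h =>
      absurd Iff.rfl h⟩
    omega
  symm v w := by
    have key : ∀ v w, BPHZ.forestRank r F v w ≤ BPHZ.forestRank r F w v := fun v w =>
      forestRank_le_iff.2 ⟨hr.symm v w ▸ le_forestRank, fun γ hγ h =>
        diamRank_le_forestRank hγ h.symm⟩
    exact le_antisymm (key _ _) (key _ _)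
  tri u v w := by
    refine forestRank_le_iff.2 ⟨(hr.tri u v w).trans (max_le_max le_forestRank le_forestRank),
      fun γ hγ h => ?_⟩
    rcases h.or v with h | h
    · exact le_max_of_le_left (diamRank_le_forestRank hγ h)
    · exact le_max_of_le_right (diamRank_le_forestRank hγ h)

/-- Either the forest rank is the rank of an actual distance between different vertices, or the two
vertices agree. -/
lemma exists_eq_forestRank (h : v ≠ w) (hr : ∀ v w, v ≠ w → 0 < r v w) (hr0 : IsRank r) :
    ∃ i j, i ≠ j ∧ forestRank r F v w = r i j := by
  have hpos : 0 < forestRank r F v w := (hr v w h).trans_le le_forestRank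
  have : ∃ i j, forestRank r F v w = r i j := by
    rcases le_total ((F.filter (fun γ => Sep γ v w)).sup (diamRank r)) (r v w) with h1 | h1
    · exact ⟨v, w, max_eq_left h1⟩
    · by_cases hne : (F.filter (fun γ => Sep γ v w)).Nonempty
      · obtain ⟨γ, hγ, hs⟩ := Finset.exists_mem_eq_sup _ hne (diamRank r)
        have hsep := (Finset.mem_filter.1 hγ).2
        have hne' : γ.Nonempty := by
          by_contra hc
          rw [Finset.not_nonempty_iff_eq_empty] at hc
          subst hc
          exact hsep (by simp)
        obtain ⟨i, -, j, -, hij⟩ := exists_eq_diamRank (r := r) hne'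
        exact ⟨i, j, by rw [forestRank, max_eq_right h1, hs, hij]⟩
      · rw [Finset.not_nonempty_iff_eq_empty] at hne
        exact ⟨v, w, by simp [forestRank, hne]⟩
  obtain ⟨i, j, hij⟩ := this
  refine ⟨i, j, ?_, hij⟩
  rintro rfl
  rw [hij, hr0.self] at hpos
  exact lt_irrefl _ hpos

/-- For a laminar family `F` and vertices of a member `γ'`, the forest rank is bounded by any bound
of the rank of `γ'`. -/
lemma Laminar.forestRank_le (hF : Laminar F) (hγ' : γ' ∈ F) (hv : v ∈ γ') (hw : w ∈ γ') :
    forestRank r F v w ≤ diamRank r γ' :=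
  forestRank_le_iff.2 ⟨le_diamRank hv hw, fun _ h h' =>
    diamRank_mono (hF.subset_of_sep hγ' h hv hw h')⟩

variable [Fintype V]

/-- The ball of an `ℕ`-valued distance. -/
def rankBall (R : V → V → ℕ) (v : V) (n : ℕ) : Finset V := Finset.univ.filter (fun w => R v w ≤ n)

lemma mem_rankBall {R : V → V → ℕ} : w ∈ rankBall R v n ↔ R v w ≤ n := by simp [rankBall]

lemma IsRank.mem_rankBall_self {R : V → V → ℕ} (hR : IsRank R) : v ∈ rankBall R v n := by
  simp [mem_rankBall, hR.self]

lemma IsRank.rankBall_eq {R : V → V → ℕ} (hR : IsRank R) (h : R v w ≤ n) :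
    rankBall R v n = rankBall R w n := by
  ext z
  rw [mem_rankBall, mem_rankBall]
  constructor
  · intro h'
    have := hR.tri w v z
    rw [hR.symm w v] at this
    omega
  · intro h'
    have := hR.tri v w z
    omega

/-- The admissible sets that are balls of the forest rank: the clusters of the configuration in
which the members of `F` have been contracted. -/
def tight (adm : Finset V → Prop) (r : V → V → ℕ) (F : Finset (Finset V)) : Finset (Finset V) :=
  Finset.univ.filter (fun γ => adm γ ∧ ∃ v n, γ = rankBall (forestRank r F) v n)

variable {adm : Finset V → Prop}

lemma mem_tight : γ ∈ tight adm r F ↔ adm γ ∧ ∃ v n, γ = rankBall (forestRank r F) v n := by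
  simp [tight]

lemma diamRank_rankBall_le (hr : IsRank r) (v : V) (n : ℕ) :
    diamRank r (rankBall (forestRank r F) v n) ≤ n := by
  refine diamRank_le fun a ha b hb => le_forestRank (F := F) |>.trans ?_
  rw [mem_rankBall] at ha hb
  have := (hr.forestRank F).tri a v b
  rw [(hr.forestRank F).symm a v] at this
  omega

lemma lt_forestRank_of_sep (hr : IsRank r) {z : V}
    (h : Sep (rankBall (forestRank r F) z n) v w) : n < forestRank r F v w := by
  by_contra hc
  push Not at hc
  apply h
  rw [mem_rankBall, mem_rankBall]
  have h1 := (hr.forestRank F).tri z v w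
  have h2 := (hr.forestRank F).tri z w v
  rw [(hr.forestRank F).symm w v] at h2
  constructor <;> intro h <;> omega

/-- A tight set never determines the forest rank. Hence adding or removing tight sets does not
change the forest rank. -/
lemma diamRank_lt_forestRank_of_mem_tight (hr : IsRank r) (hγ : γ ∈ tight adm r F)
    (h : Sep γ v w) : diamRank r γ < forestRank r F v w := by
  obtain ⟨-, z, n, rfl⟩ := mem_tight.1 hγ
  exact (diamRank_rankBall_le hr z n).trans_lt (lt_forestRank_of_sep hr h)

lemma forestRank_union (hr : IsRank r) {T : Finset (Finset V)} (hT : T ⊆ tight adm r F) :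
    forestRank r (F ∪ T) = forestRank r F := by
  ext v w
  refine le_antisymm (forestRank_le_iff.2 ⟨le_forestRank, fun γ hγ h => ?_⟩)
    (forestRank_le_iff.2 ⟨le_forestRank, fun γ hγ h =>
      diamRank_le_forestRank (Finset.mem_union_left _ hγ) h⟩)
  rcases Finset.mem_union.1 hγ with hγ | hγ
  · exact diamRank_le_forestRank hγ h
  · exact (diamRank_lt_forestRank_of_mem_tight hr (hT hγ) h).le

lemma forestRank_sdiff (hr : IsRank r) :
    forestRank r (F \ tight adm r F) = forestRank r F := by
  ext v w
  refine le_antisymm (forestRank_le_iff.2 ⟨le_forestRank, fun γ hγ h =>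
      diamRank_le_forestRank (Finset.sdiff_subset hγ) h⟩) ?_
  by_contra hc
  push Not at hc
  -- the maximum that defines the forest rank of `F` is attained neither by `r v w` nor by a
  -- member of `F` that is not tight, hence by a tight one
  have h1 : forestRank r F v w ≤ forestRank r F v w - 1 := by
    refine forestRank_le_iff.2 ⟨?_, fun γ hγ h => ?_⟩
    · have : r v w ≤ forestRank r (F \ tight adm r F) v w := le_forestRank
      omega
    · by_cases ht : γ ∈ tight adm r F
      · have := diamRank_lt_forestRank_of_mem_tight hr ht h
        omega
      · have := diamRank_le_forestRank (r := r) (Finset.mem_sdiff.2 ⟨hγ, ht⟩) h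
        omega
  omega

lemma tight_congr {F' : Finset (Finset V)} (h : forestRank r F' = forestRank r F) :
    tight adm r F' = tight adm r F := by
  unfold tight; rw [h]

lemma Laminar.union_tight (hr : IsRank r) (hF : Laminar F) : Laminar (F ∪ tight adm r F) := by
  have hcomm : ∀ {a b : Finset V}, ¬ Overlapping a b → ¬ Overlapping b a := by
    intro a b h
    rw [not_overlapping_iff] at *
    rcases h with h | h | h
    exacts [Or.inr (Or.inl h), Or.inl h, Or.inr (Or.inr h.symm)]
  have hR := hr.forestRank F
  have hFT : ∀ γ ∈ F, ∀ γ' ∈ tight adm r F, ¬ Overlapping γ γ' := by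
    intro γ hγ γ' hγ'
    obtain ⟨-, z, n, rfl⟩ := mem_tight.1 hγ'
    rw [not_overlapping_iff]
    by_cases hd : Disjoint γ (rankBall (forestRank r F) z n)
    · exact Or.inr (Or.inr hd)
    obtain ⟨v, hv, hv'⟩ := Finset.not_disjoint_iff.1 hd
    rcases le_or_gt (diamRank r γ) n with hn | hn
    · left
      intro w hw
      rw [hR.rankBall_eq (mem_rankBall.1 hv'), mem_rankBall]
      exact (hF.forestRank_le hγ hv hw).trans hn
    · right; left
      intro w hw
      by_contra hc
      have h1 := diamRank_le_forestRank (r := r) hγ (v := v) (w := w) (by unfold Sep; tauto)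
      rw [hR.rankBall_eq (mem_rankBall.1 hv'), mem_rankBall] at hw
      omega
  intro γ hγ γ' hγ'
  rcases Finset.mem_union.1 hγ with h | h <;> rcases Finset.mem_union.1 hγ' with h' | h'
  · exact hF _ h _ h'
  · exact hFT _ h _ h'
  · exact hcomm (hFT _ h' _ h)
  · obtain ⟨-, z, n, rfl⟩ := mem_tight.1 h
    obtain ⟨-, z', n', rfl⟩ := mem_tight.1 h'
    rw [not_overlapping_iff]
    by_cases hd : Disjoint (rankBall (forestRank r F) z n) (rankBall (forestRank r F) z' n')
    · exact Or.inr (Or.inr hd)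
    obtain ⟨v, hv, hv'⟩ := Finset.not_disjoint_iff.1 hd
    rw [hR.rankBall_eq (mem_rankBall.1 hv), hR.rankBall_eq (mem_rankBall.1 hv')]
    rcases le_total n n' with hn | hn
    · left; intro w; rw [mem_rankBall, mem_rankBall]; omega
    · right; left; intro w; rw [mem_rankBall, mem_rankBall]; omega

/-- The forests whose members are admissible. -/
def admForests (adm : Finset V → Prop) : Finset (Finset (Finset V)) :=
  Finset.univ.filter (fun F => (∀ γ ∈ F, adm γ) ∧ Laminar F)

lemma mem_admForests : F ∈ admForests adm ↔ (∀ γ ∈ F, adm γ) ∧ Laminar F := by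
  simp [admForests]

/-- The admissible forests without tight members. -/
def bases (adm : Finset V → Prop) (r : V → V → ℕ) : Finset (Finset (Finset V)) :=
  (admForests adm).filter (fun B => Disjoint B (tight adm r B))

lemma mem_admForests_mono {F' : Finset (Finset V)} (h : F ∈ admForests adm) (h' : F' ⊆ F) :
    F' ∈ admForests adm := by
  rw [mem_admForests] at *
  exact ⟨fun γ hγ => h.1 γ (h' hγ), fun γ hγ γ' hγ' => h.2 γ (h' hγ) γ' (h' hγ')⟩

lemma union_tight_mem_admForests (hr : IsRank r) (h : F ∈ admForests adm) :
    F ∪ tight adm r F ∈ admForests adm := by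
  rw [mem_admForests] at *
  refine ⟨fun γ hγ => ?_, h.2.union_tight hr⟩
  rcases Finset.mem_union.1 hγ with h' | h'
  · exact h.1 γ h'
  · exact (mem_tight.1 h').1

/-- The admissible forests are the disjoint union of the intervals `[B, B ∪ tight B]`. -/
lemma sum_admForests {M : Type*} [AddCommMonoid M] (hr : IsRank r) (f : Finset (Finset V) → M) :
    ∑ F ∈ admForests adm, f F =
      ∑ B ∈ bases adm r, ∑ T ∈ (tight adm r B).powerset, f (B ∪ T) := by
  rw [Finset.sum_sigma']
  symm
  refine Finset.sum_bij' (fun p _ => p.1 ∪ p.2)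
    (fun F _ => ⟨F \ tight adm r F, F ∩ tight adm r F⟩) ?_ ?_ ?_ ?_ ?_
  · rintro ⟨B, T⟩ h
    simp only [Finset.mem_sigma, bases, Finset.mem_filter, Finset.mem_powerset] at h
    exact mem_admForests_mono (union_tight_mem_admForests hr h.1.1)
      (Finset.union_subset_union_right h.2)
  · intro F hF
    simp only [Finset.mem_sigma, bases, Finset.mem_filter, Finset.mem_powerset]
    rw [tight_congr (forestRank_sdiff hr)]
    exact ⟨⟨mem_admForests_mono hF Finset.sdiff_subset, Finset.sdiff_disjoint⟩,
      Finset.inter_subset_right⟩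
  · rintro ⟨B, T⟩ h
    simp only [Finset.mem_sigma, bases, Finset.mem_filter, Finset.mem_powerset] at h
    have h1 : tight adm r (B ∪ T) = tight adm r B := tight_congr (forestRank_union hr h.2)
    have h2 : ∀ x ∈ B, x ∉ tight adm r B := fun x hx => Finset.disjoint_left.1 h.1.2 hx
    have h3 := h.2
    simp only [h1]
    congr 1
    · ext x; simp only [Finset.mem_sdiff, Finset.mem_union]
      constructor
      · rintro ⟨hx | hx, hx'⟩
        · exact hx
        · exact absurd (h3 hx) hx'
      · exact fun hx => ⟨Or.inl hx, h2 x hx⟩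
    · ext x; simp only [Finset.mem_inter, Finset.mem_union]
      constructor
      · rintro ⟨hx | hx, hx'⟩
        · exact absurd hx' (h2 x hx)
        · exact hx
      · exact fun hx => ⟨Or.inr hx, h3 hx⟩
  · intro F _
    exact Finset.sdiff_union_inter _ _
  · intros; rfl

/-- The rank of the scale up to which the Taylor expansion about the mean point of `γ` is
controlled: the rank of `γ` itself in general, and for a tight `γ` the rank of the distance to the
nearest vertex outside (or `N` if there is none). -/
def outerRank (adm : Finset V → Prop) (r : V → V → ℕ) (N : ℕ) (B : Finset (Finset V))
    (γ : Finset V) : ℕ :=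
  if γ ∈ tight adm r B then
    (insert N ((γ ×ˢ γᶜ).image (fun p => forestRank r B p.1 p.2))).min' (Finset.insert_nonempty _ _)
  else diamRank r γ

variable {N : ℕ} {B : Finset (Finset V)}

lemma outerRank_le_forestRank (hr : IsRank r) (hγ : γ ∈ B ∪ tight adm r B) (h : Sep γ v w) :
    outerRank adm r N B γ ≤ forestRank r B v w := by
  unfold outerRank
  split_ifs with ht
  · have key : ∀ v w, v ∈ γ → w ∉ γ → (insert N ((γ ×ˢ γᶜ).image
        (fun p => forestRank r B p.1 p.2))).min' (Finset.insert_nonempty _ _) ≤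
          forestRank r B v w := fun v w hv hw => Finset.min'_le _ _ <|
      Finset.mem_insert_of_mem <| Finset.mem_image.2 ⟨(v, w), by simp [hv, hw], rfl⟩
    by_cases hv : v ∈ γ
    · exact key v w hv (by unfold Sep at h; tauto)
    · rw [(hr.forestRank B).symm]
      exact key w v (by unfold Sep at h; tauto) hv
  · exact diamRank_le_forestRank ((Finset.mem_union.1 hγ).resolve_right ht) h

lemma lt_outerRank_of_eq_rankBall (hr : IsRank r) (hγ : γ ∈ tight adm r B) {z : V} (hn : n < N)
    (h : γ = rankBall (forestRank r B) z n) : n < outerRank adm r N B γ := by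
  rw [outerRank, if_pos hγ, Finset.lt_min'_iff]
  intro y hy
  rcases Finset.mem_insert.1 hy with rfl | hy
  · exact hn
  · obtain ⟨⟨a, b⟩, hp, rfl⟩ := Finset.mem_image.1 hy
    rw [Finset.mem_product, Finset.mem_compl] at hp
    exact lt_forestRank_of_sep hr (z := z) (h ▸ (by unfold Sep; tauto))

lemma diamRank_lt_outerRank (hr : IsRank r) (hN : ∀ v w, r v w < N) (hN0 : 0 < N)
    (hγ : γ ∈ tight adm r B) : diamRank r γ < outerRank adm r N B γ := by
  rw [outerRank, if_pos hγ, Finset.lt_min'_iff]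
  intro y hy
  rcases Finset.mem_insert.1 hy with rfl | hy
  · exact (Finset.sup_lt_iff hN0).2 fun p _ => hN _ _
  · obtain ⟨⟨a, b⟩, hp, rfl⟩ := Finset.mem_image.1 hy
    rw [Finset.mem_product, Finset.mem_compl] at hp
    exact diamRank_lt_forestRank_of_mem_tight hr hγ (by unfold Sep; tauto)

lemma diamRank_le_outerRank (hr : IsRank r) (hN : ∀ v w, r v w < N) (hN0 : 0 < N) :
    diamRank r γ ≤ outerRank adm r N B γ := by
  by_cases h : γ ∈ tight adm r B
  · exact (diamRank_lt_outerRank hr hN hN0 h).le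
  · rw [outerRank, if_neg h]

lemma outerRank_le_diamRank (hr : IsRank r) (hB : Laminar B) (hγ : γ ∈ B ∪ tight adm r B)
    (hγ' : γ' ∈ B ∪ tight adm r B) (hne : γ.Nonempty) (h : γ ⊂ γ') :
    outerRank adm r N B γ ≤ diamRank r γ' := by
  obtain ⟨w, hw, hw'⟩ := Finset.exists_of_ssubset h
  obtain ⟨v, hv⟩ := hne
  refine (outerRank_le_forestRank hr hγ (v := v) (w := w) (by unfold Sep; tauto)).trans ?_
  rw [← forestRank_union hr (T := tight adm r B) subset_rfl]
  exact (hB.union_tight hr).forestRank_le hγ' (h.1 hv) hw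

lemma exists_eq_outerRank (hr : IsRank r) (hr0 : ∀ v w, v ≠ w → 0 < r v w)
    (hN : ∀ v w, r v w < N) (hγ : γ ∈ tight adm r B) (hne : γ.Nonempty) (hu : γ ≠ Finset.univ) :
    ∃ i j, i ≠ j ∧ outerRank adm r N B γ = r i j := by
  have hmem := Finset.min'_mem (insert N ((γ ×ˢ γᶜ).image (fun p => forestRank r B p.1 p.2)))
    (Finset.insert_nonempty _ _)
  have h1 : ∃ a b, a ≠ b ∧ outerRank adm r N B γ = forestRank r B a b := by
    rcases Finset.mem_insert.1 hmem with h | h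
    · exfalso
      obtain ⟨v, hv⟩ := hne
      obtain ⟨w, hw⟩ : ∃ w, w ∉ γ := by
        by_contra hc; push Not at hc; exact hu (Finset.eq_univ_iff_forall.2 hc)
      obtain ⟨i, j, -, hij⟩ := exists_eq_forestRank (F := B) (v := v) (w := w)
        (by rintro rfl; exact hw hv) hr0 hr
      have h2 := outerRank_le_forestRank (N := N) hr (Finset.mem_union_right B hγ) (v := v) (w := w)
        (by unfold Sep; tauto)
      rw [outerRank, if_pos hγ, h, hij] at h2
      exact absurd (hN i j) (not_lt.2 h2)
    · obtain ⟨⟨a, b⟩, hp, hab⟩ := Finset.mem_image.1 h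
      rw [Finset.mem_product, Finset.mem_compl] at hp
      refine ⟨a, b, ?_, by rw [outerRank, if_pos hγ, ← hab]⟩
      rintro rfl
      exact hp.2 hp.1
  obtain ⟨a, b, hab, h2⟩ := h1
  obtain ⟨i, j, hij, h3⟩ := exists_eq_forestRank (F := B) hab hr0 hr
  exact ⟨i, j, hij, h2.trans h3⟩

end Rank

/-! ### Counting edges and vertices level by level -/

section Level

variable {V : Type*}

lemma mk_out (e : Sym2 V) : s((Quot.out e).1, (Quot.out e).2) = e := Quot.out_eq e

variable {G : SimpleGraph V}

lemma adj_out {e : Sym2 V} (he : e ∈ G.edgeSet) : G.Adj (Quot.out e).1 (Quot.out e).2 := by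
  rw [← SimpleGraph.mem_edgeSet, mk_out]; exact he

variable [Fintype V]

lemma mem_allEdges {e : Sym2 V} : e ∈ allEdges G ↔ e ∈ G.edgeSet := by simp [allEdges]

lemma mem_edgesIn {γ : Finset V} {e : Sym2 V} :
    e ∈ edgesIn G γ ↔ e ∈ G.edgeSet ∧ ∀ v ∈ e, v ∈ γ := by
  simp [edgesIn, mem_allEdges]

lemma mem_edgesIn_iff_out {γ : Finset V} {e : Sym2 V} :
    e ∈ edgesIn G γ ↔ e ∈ G.edgeSet ∧ (Quot.out e).1 ∈ γ ∧ (Quot.out e).2 ∈ γ := by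
  rw [mem_edgesIn]
  have h : (∀ v ∈ s((Quot.out e).1, (Quot.out e).2), v ∈ γ) ↔ _ := Sym2.ball
  rw [mk_out] at h
  rw [h]

lemma edgesIn_subset (γ : Finset V) : edgesIn G γ ⊆ allEdges G := Finset.filter_subset _ _

/-- The value of a function of two vertices on the oriented edge `e`. -/
def edgeRank (R : V → V → ℕ) (e : Sym2 V) : ℕ := R (Quot.out e).1 (Quot.out e).2

/-- A vertex without a successor at distance at most `m` is the last one of its ball, so that there
are at most as many of these as there are balls. -/
lemma card_le_card_rankBall_add [LinearOrder V] {R r : V → V → ℕ} (hR : IsRank R)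
    (hrR : ∀ v w, r v w ≤ R v w) (m : ℕ) :
    Fintype.card V ≤ (Finset.univ.image (fun v => rankBall R v m)).card +
      (Finset.univ.filter (fun i : V => ∃ j, i < j ∧ r i j ≤ m)).card := by
  have h1 := Finset.card_filter_add_card_filter_not (s := (Finset.univ : Finset V))
    (fun i : V => ∃ j, i < j ∧ r i j ≤ m)
  have h2 : (Finset.univ.filter (fun i : V => ¬ ∃ j, i < j ∧ r i j ≤ m)).card ≤
      (Finset.univ.image (fun v => rankBall R v m)).card := by
    refine Finset.card_le_card_of_injOn (fun v => rankBall R v m)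
      (fun v _ => Finset.mem_coe.2 (Finset.mem_image_of_mem _ (Finset.mem_univ v))) ?_
    intro i hi j hj hij
    simp only [Finset.coe_filter, Finset.mem_univ, true_and, Set.mem_ofPred_eq] at hi hj
    have hij' : R i j ≤ m := by
      rw [← mem_rankBall]
      simp only at hij
      rw [hij]
      exact hR.mem_rankBall_self
    rcases lt_trichotomy i j with h | h | h
    · exact absurd ⟨j, h, (hrR _ _).trans hij'⟩ hi
    · exact h
    · exact absurd ⟨i, h, (hrR _ _).trans (hR.symm i j ▸ hij')⟩ hj
  rw [Finset.card_univ] at h1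
  omega

/-- Power counting at one level: the edges that are short at level `m` are those inside the balls
`D` of the forest rank, and each divergent ball is tight and contributes its gain `c D`. -/
lemma sum_level_le [LinearOrder V] {r : V → V → ℕ} (hr : IsRank r) {adm : Finset V → Prop}
    {B : Finset (Finset V)} {N m : ℕ} (hm : m < N) {α : Sym2 V → ℝ} {c : Finset V → ℝ} {β : ℝ}
    (hβ : 0 ≤ β) (hc : ∀ γ, adm γ → 0 ≤ c γ)
    (hpc : ∀ D : Finset V, D.Nonempty →
      ∑ e ∈ edgesIn G D, α e - (if adm D then c D else 0) ≤ β * ((D.card : ℝ) - 1)) :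
    ∑ e ∈ (allEdges G).filter (fun e => edgeRank (forestRank r B) e ≤ m), α e
      - ∑ γ ∈ (tight adm r B).filter (fun γ => diamRank r γ ≤ m ∧ m < outerRank adm r N B γ), c γ
      ≤ β * ((Finset.univ.filter (fun i : V => ∃ j, i < j ∧ r i j ≤ m)).card : ℝ) := by
  set R := forestRank r B with hRdef
  have hR : IsRank R := hr.forestRank B
  set 𝒟 : Finset (Finset V) := Finset.univ.image (fun v => rankBall R v m) with h𝒟
  -- the balls of radius `m` partition `V`, since `R` is an ultrametric
  have hdisj : ∀ D ∈ 𝒟, ∀ D' ∈ 𝒟, ∀ v, v ∈ D → v ∈ D' → D = D' := by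
    intro D hD D' hD' v hv hv'
    obtain ⟨a, -, rfl⟩ := Finset.mem_image.1 hD
    obtain ⟨b, -, rfl⟩ := Finset.mem_image.1 hD'
    rw [hR.rankBall_eq (mem_rankBall.1 hv), hR.rankBall_eq (mem_rankBall.1 hv')]
  have h1 : ∑ e ∈ (allEdges G).filter (fun e => edgeRank R e ≤ m), α e =
      ∑ D ∈ 𝒟, ∑ e ∈ edgesIn G D, α e := by
    rw [← Finset.sum_biUnion]
    · congr 1
      ext e
      simp only [Finset.mem_filter, Finset.mem_biUnion, mem_edgesIn_iff_out, mem_allEdges]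
      constructor
      · rintro ⟨he, hem⟩
        exact ⟨rankBall R (Quot.out e).1 m, Finset.mem_image_of_mem _ (Finset.mem_univ _), he,
          hR.mem_rankBall_self, mem_rankBall.2 hem⟩
      · rintro ⟨D, hD, he, h1, h2⟩
        obtain ⟨a, -, rfl⟩ := Finset.mem_image.1 hD
        rw [hR.rankBall_eq (mem_rankBall.1 h1), mem_rankBall] at h2
        exact ⟨he, h2⟩
    · intro D hD D' hD' hne
      rw [Function.onFun, Finset.disjoint_left]
      intro e h1 h2
      exact hne (hdisj D hD D' hD' _ (mem_edgesIn_iff_out.1 h1).2.1 (mem_edgesIn_iff_out.1 h2).2.1)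
  -- an admissible ball of radius `m` is tight, with a diameter of rank at most `m` and distance of
  -- rank above `m` from the rest
  have h2 : ∑ D ∈ 𝒟, (if adm D then c D else 0) ≤
      ∑ γ ∈ (tight adm r B).filter (fun γ => diamRank r γ ≤ m ∧ m < outerRank adm r N B γ), c γ := by
    rw [← Finset.sum_filter]
    refine Finset.sum_le_sum_of_subset_of_nonneg (fun D hD => ?_) (fun γ hγ _ => ?_)
    · obtain ⟨hD, hadm⟩ := Finset.mem_filter.1 hD
      obtain ⟨a, -, rfl⟩ := Finset.mem_image.1 hD
      have ht : rankBall R a m ∈ tight adm r B := mem_tight.2 ⟨hadm, a, m, rfl⟩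
      exact Finset.mem_filter.2 ⟨ht, diamRank_rankBall_le hr a m,
        lt_outerRank_of_eq_rankBall hr ht hm rfl⟩
    · exact hc γ (mem_tight.1 (Finset.mem_filter.1 hγ).1).1
  have hne : ∀ D ∈ 𝒟, D.Nonempty := by
    intro D hD
    obtain ⟨a, -, rfl⟩ := Finset.mem_image.1 hD
    exact ⟨a, hR.mem_rankBall_self⟩
  have h3 : ∑ D ∈ 𝒟, (∑ e ∈ edgesIn G D, α e - (if adm D then c D else 0)) ≤
      ∑ D ∈ 𝒟, β * ((D.card : ℝ) - 1) := Finset.sum_le_sum fun D hD => hpc D (hne D hD)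
  have h4 : ∑ D ∈ 𝒟, D.card = Fintype.card V := by
    rw [← Finset.card_biUnion, ← Finset.card_univ]
    · congr 1
      rw [Finset.eq_univ_iff_forall]
      intro v
      exact Finset.mem_biUnion.2 ⟨rankBall R v m,
        Finset.mem_image_of_mem _ (Finset.mem_univ _), hR.mem_rankBall_self⟩
    · intro D hD D' hD' hne
      exact Finset.disjoint_left.2 fun v h1 h2 => hne (hdisj D hD D' hD' v h1 h2)
  have h5 := card_le_card_rankBall_add (r := r) hR (fun _ _ => le_forestRank) m
  rw [← h𝒟] at h5
  rw [Finset.sum_sub_distrib, ← Finset.mul_sum, Finset.sum_sub_distrib, Finset.sum_const,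
    nsmul_eq_mul, mul_one, ← Nat.cast_sum, h4] at h3
  have h6 : ((Fintype.card V : ℕ) : ℝ) ≤ (𝒟.card : ℝ) +
      ((Finset.univ.filter (fun i : V => ∃ j, i < j ∧ r i j ≤ m)).card : ℝ) := by
    exact_mod_cast h5
  have h7 := mul_le_mul_of_nonneg_left h6 hβ
  rw [h1]
  linarith

end Level

end

end BPHZ

namespace BPHZ

noncomputable section

open scoped Classical

/-! ### Lists sorted by cardinality -/

section Lists

lemma foldl_eq_of_perm_of_sorted {α β : Type*} (f : β → α → β) (c : α → ℕ) :
    ∀ (l l' : List α), l.Perm l' → l.Pairwise (fun a b => c a ≤ c b) →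
      l'.Pairwise (fun a b => c a ≤ c b) →
      (∀ a ∈ l, ∀ b ∈ l, c a = c b → ∀ z, f (f z a) b = f (f z b) a) →
      ∀ z, l.foldl f z = l'.foldl f z := by
  intro l
  induction l with
  | nil => intro l' h _ _ _ z; rw [List.nil_perm.1 h]
  | cons a t ih =>
    intro l' h hl hl' hcomm z
    obtain ⟨p, q, rfl⟩ := List.append_of_mem (h.subset List.mem_cons_self)
    have hp : ∀ b ∈ p, b ∈ a :: t ∧ c a = c b := by
      intro b hb
      have hb' : b ∈ a :: t := h.symm.subset (List.mem_append_left _ hb)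
      refine ⟨hb', le_antisymm ?_ ?_⟩
      · rcases List.mem_cons.1 hb' with rfl | hb''
        · exact le_rfl
        · exact List.rel_of_pairwise_cons hl hb''
      · exact (List.pairwise_append.1 hl').2.2 b hb a List.mem_cons_self
    have key : ∀ p : List α, (∀ b ∈ p, b ∈ a :: t ∧ c a = c b) → ∀ z,
        f (p.foldl f z) a = p.foldl f (f z a) := by
      intro p
      induction p with
      | nil => intro _ z; rfl
      | cons b p ihp =>
        intro hp z
        rw [List.foldl_cons, List.foldl_cons, ihp (fun b' hb' => hp b' (List.mem_cons_of_mem _ hb')),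
          hcomm a List.mem_cons_self b (hp b List.mem_cons_self).1 (hp b List.mem_cons_self).2]
    rw [List.foldl_append, List.foldl_cons, List.foldl_cons, key p hp, ← List.foldl_append]
    refine ih (p ++ q) ?_ hl.of_cons ?_ (fun a ha b hb => hcomm a (List.mem_cons_of_mem _ ha) b
      (List.mem_cons_of_mem _ hb)) _
    · exact (List.perm_cons a).1 (h.trans List.perm_middle)
    · exact hl'.sublist ((List.sublist_cons_self a q).append_left p)

variable {V : Type*}

/-- Inner members first: each member is disjoint from or strictly contained in the later ones. -/
def Nested (l : List (Finset V)) : Prop :=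
  l.Pairwise (fun γ γ' => Disjoint γ γ' ∨ γ ⊂ γ')

lemma innerFirst_perm (F : Finset (Finset V)) : (innerFirst F).Perm F.toList :=
  List.mergeSort_perm _ _

lemma mem_innerFirst {F : Finset (Finset V)} {γ : Finset V} : γ ∈ innerFirst F ↔ γ ∈ F := by
  rw [(innerFirst_perm F).mem_iff, Finset.mem_toList]

lemma innerFirst_nodup (F : Finset (Finset V)) : (innerFirst F).Nodup :=
  (innerFirst_perm F).nodup_iff.2 F.nodup_toList

lemma innerFirst_sorted (F : Finset (Finset V)) :
    (innerFirst F).Pairwise (fun a b => a.card ≤ b.card) := by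
  have h := List.pairwise_mergeSort (le := fun a b : Finset V => decide (a.card ≤ b.card))
    (fun a b c hab hbc => by simp only [decide_eq_true_eq] at *; omega)
    (fun a b => by simp only [Bool.or_eq_true, decide_eq_true_eq]; omega) F.toList
  exact h.imp (fun h => by simpa using h)

lemma Laminar.nested_innerFirst {F : Finset (Finset V)} (hF : Laminar F) :
    Nested (innerFirst F) := by
  have h := (innerFirst_sorted F).and (innerFirst_nodup F)
  refine h.imp_of_mem (fun {γ γ'} hγ hγ' h => ?_)
  rw [mem_innerFirst] at hγ hγ'
  rcases not_overlapping_iff.1 (hF γ hγ γ' hγ') with h1 | h1 | h1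
  · exact Or.inr (h1.ssubset_of_ne h.2)
  · exact absurd (Finset.eq_of_subset_of_card_le h1 h.1).symm h.2
  · exact Or.inl h1

end Lists

/-! ### Contractions with parameters -/

section Flow

variable {V : Type*} [Fintype V] (G : SimpleGraph V) {d : ℕ}

lemma meanPoint_congr {γ : Finset V} {x y : Config V d} (h : ∀ v ∈ γ, x v = y v) :
    meanPoint G γ x = meanPoint G γ y := by
  unfold meanPoint
  rw [Finset.sum_congr rfl (fun v hv => by rw [h v hv])]

/-- The interpolation between the contraction of `γ` (for `s = 0`) and the identity
(for `s = 1`). -/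
def evolve (γ : Finset V) (s : ℝ) (x : Config V d) : Config V d :=
  contract G γ x + s • (x - contract G γ x)

lemma contract_of_mem {γ : Finset V} {x : Config V d} {v : V} (h : v ∈ γ) :
    contract G γ x v = meanPoint G γ x := by simp [contract, h]

lemma contract_of_notMem {γ : Finset V} {x : Config V d} {v : V} (h : v ∉ γ) :
    contract G γ x v = x v := by simp [contract, h]

lemma evolve_of_mem {γ : Finset V} {s : ℝ} {x : Config V d} {v : V} (h : v ∈ γ) :
    evolve G γ s x v = meanPoint G γ x + s • (x v - meanPoint G γ x) := by
  simp [evolve, contract_of_mem G h]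

lemma evolve_of_notMem {γ : Finset V} {s : ℝ} {x : Config V d} {v : V} (h : v ∉ γ) :
    evolve G γ s x v = x v := by
  simp [evolve, contract_of_notMem G h]

lemma evolve_one (γ : Finset V) (x : Config V d) : evolve G γ 1 x = x := by simp [evolve]

lemma evolve_zero (γ : Finset V) (x : Config V d) : evolve G γ 0 x = contract G γ x := by
  simp [evolve]

lemma evolve_comm {γ γ' : Finset V} (h : Disjoint γ γ') (s s' : ℝ) (x : Config V d) :
    evolve G γ s (evolve G γ' s' x) = evolve G γ' s' (evolve G γ s x) := by
  have key : ∀ {γ γ' : Finset V}, Disjoint γ γ' → ∀ s' : ℝ, meanPoint G γ (evolve G γ' s' x) =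
      meanPoint G γ x := fun h s' => meanPoint_congr G fun v hv =>
    evolve_of_notMem G (Finset.disjoint_left.1 h hv)
  ext1 v
  by_cases hv : v ∈ γ
  · have hv' := Finset.disjoint_left.1 h hv
    rw [evolve_of_mem G hv, evolve_of_notMem G hv', evolve_of_notMem G hv', evolve_of_mem G hv,
      key h]
  · by_cases hv' : v ∈ γ'
    · rw [evolve_of_mem G hv', evolve_of_notMem G hv, evolve_of_notMem G hv, evolve_of_mem G hv',
        key h.symm]
    · rw [evolve_of_notMem G hv, evolve_of_notMem G hv', evolve_of_notMem G hv',
        evolve_of_notMem G hv]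

/-- The successive interpolated contractions of the members `γ` of a list, with the interpolation
parameter `r γ` running from `0` to `ρ γ`. -/
def flow (ρ : Finset V → ℝ) (l : List (Finset V)) (r : Finset V → ℝ) (x : Config V d) :
    Config V d :=
  l.foldl (fun z γ => evolve G γ (r γ / ρ γ) z) x

variable {ρ : Finset V → ℝ} {l : List (Finset V)} {r r' : Finset V → ℝ} {x : Config V d}

lemma flow_cons (γ : Finset V) :
    flow G ρ (γ :: l) r x = flow G ρ l r (evolve G γ (r γ / ρ γ) x) := rfl

lemma flow_append_singleton (γ : Finset V) :
    flow G ρ (l ++ [γ]) r x = evolve G γ (r γ / ρ γ) (flow G ρ l r x) := by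
  simp [flow, List.foldl_append]

lemma flow_apply_of_notMem {v : V} (h : ∀ γ ∈ l, v ∉ γ) : flow G ρ l r x v = x v := by
  induction l generalizing x with
  | nil => rfl
  | cons γ l ih =>
    rw [flow_cons, ih (fun γ' h' => h γ' (List.mem_cons_of_mem _ h')),
      evolve_of_notMem G (h γ List.mem_cons_self)]

lemma flow_congr (h : ∀ γ ∈ l, r γ = r' γ) : flow G ρ l r x = flow G ρ l r' x := by
  induction l generalizing x with
  | nil => rfl
  | cons γ l ih =>
    rw [flow_cons, flow_cons, ih (fun γ' h' => h γ' (List.mem_cons_of_mem _ h')),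
      h γ List.mem_cons_self]

lemma flow_filter (hρ : ∀ γ ∈ l, ρ γ ≠ 0) (p : Finset V → Bool)
    (h : ∀ γ ∈ l, p γ = false → r γ = ρ γ) : flow G ρ l r x = flow G ρ (l.filter p) r x := by
  induction l generalizing x with
  | nil => rfl
  | cons γ l ih =>
    have ih' := fun x => ih (x := x) (fun γ' h' => hρ γ' (List.mem_cons_of_mem _ h'))
      (fun γ' h' => h γ' (List.mem_cons_of_mem _ h'))
    rw [flow_cons, ih', List.filter_cons]
    by_cases hp : p γ = true
    · rw [if_pos hp, flow_cons]
    · rw [if_neg hp, h γ List.mem_cons_self (by simpa using hp),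
        div_self (hρ γ List.mem_cons_self), evolve_one]

lemma flow_eq_foldl_contract (h : ∀ γ ∈ l, r γ = 0) :
    flow G ρ l r x = l.foldl (fun z γ => contract G γ z) x := by
  induction l generalizing x with
  | nil => rfl
  | cons γ l ih =>
    rw [flow_cons, ih (fun γ' h' => h γ' (List.mem_cons_of_mem _ h')), List.foldl_cons,
      h γ List.mem_cons_self, zero_div, evolve_zero]

/-- The order among members of equal cardinality is immaterial. -/
lemma flow_eq_of_perm {l' : List (Finset V)} (h : l.Perm l')
    (hl : l.Pairwise (fun a b => a.card ≤ b.card)) (hl' : l'.Pairwise (fun a b => a.card ≤ b.card))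
    (hlam : ∀ a ∈ l, ∀ b ∈ l, ¬ Overlapping a b) : flow G ρ l r x = flow G ρ l' r x := by
  refine foldl_eq_of_perm_of_sorted _ Finset.card l l' h hl hl' (fun a ha b hb hab z => ?_) x
  rcases not_overlapping_iff.1 (hlam a ha b hb) with h1 | h1 | h1
  · rw [Finset.eq_of_subset_of_card_le h1 hab.ge]
  · rw [Finset.eq_of_subset_of_card_le h1 hab.le]
  · exact evolve_comm G h1.symm _ _ _

/-- The pair of the positions of the two ends of an edge. -/
def ends (x : Config V d) (e : Sym2 V) : Pt d × Pt d := (x (Quot.out e).1, x (Quot.out e).2)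

/-- The edge `e` is evaluated by the forest operators before those `γ` act that contain it. The
members `γ` of `l` that move it are those in this list. -/
def movers (l : List (Finset V)) (e : Sym2 V) : List (Finset V) :=
  l.filter (fun γ => decide (e ∉ edgesIn G γ))

lemma ends_flow_cons_of_mem {γ : Finset V} (hl : Nested (γ :: l)) {e : Sym2 V}
    (he : e ∈ edgesIn G γ) : ends (flow G ρ (movers G (γ :: l) e) r x) e = ends x e := by
  have h1 : ∀ v ∈ γ, v ∈ e → ∀ γ' ∈ movers G (γ :: l) e, v ∉ γ' := by
    intro v hv hve γ' hγ' hv'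
    rw [movers, List.mem_filter, decide_eq_true_eq] at hγ'
    rcases List.mem_cons.1 hγ'.1 with rfl | hmem
    · exact hγ'.2 he
    rcases List.rel_of_pairwise_cons hl hmem with h | h
    · exact Finset.disjoint_left.1 h hv hv'
    · exact hγ'.2 (mem_edgesIn.2 ⟨(mem_edgesIn.1 he).1, fun w hw =>
        h.1 ((mem_edgesIn.1 he).2 w hw)⟩)
  have h2 := mem_edgesIn_iff_out.1 he
  have h3 := (mem_edgesIn.1 he).2
  have m1 : (Quot.out e).1 ∈ e := Sym2.out_fst_mem e
  have m2 : (Quot.out e).2 ∈ e := Sym2.out_snd_mem e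
  unfold ends
  rw [flow_apply_of_notMem G (h1 _ h2.2.1 m1), flow_apply_of_notMem G (h1 _ h2.2.2 m2)]

lemma movers_cons_of_notMem {γ : Finset V} {e : Sym2 V} (he : e ∉ edgesIn G γ) :
    movers G (γ :: l) e = γ :: movers G l e := by
  simp [movers, he]

/-- The integrand of the forest term of a list, with all contractions replaced by interpolated
ones. -/
def paramTerm (w : Sym2 V → Pt d × Pt d → ℂ) (ν : V → Pt d → ℂ) (ρ : Finset V → ℝ) :
    List (Finset V) → Finset (Sym2 V) → Config V d → (Finset V → ℝ) → ℂ
  | [], S, x, _ => (∏ e ∈ allEdges G \ S, w e (ends x e)) * ∏ v, ν v (x v)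
  | γ :: l, S, x, r => (∏ e ∈ edgesIn G γ \ S, w e (ends x e)) *
      paramTerm w ν ρ l (S ∪ edgesIn G γ) (evolve G γ (r γ / ρ γ) x) r

lemma allEdges_sdiff_eq (γ : Finset V) (S : Finset (Sym2 V)) :
    allEdges G \ S = (edgesIn G γ \ S) ∪ (allEdges G \ (S ∪ edgesIn G γ)) := by
  ext e
  have : e ∈ edgesIn G γ → e ∈ allEdges G := fun h => edgesIn_subset γ h
  simp only [Finset.mem_sdiff, Finset.mem_union]
  tauto

lemma paramTerm_eq (w : Sym2 V → Pt d × Pt d → ℂ) (ν : V → Pt d → ℂ) (hl : Nested l)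
    (S : Finset (Sym2 V)) : paramTerm G w ν ρ l S x r =
      (∏ e ∈ allEdges G \ S, w e (ends (flow G ρ (movers G l e) r x) e)) *
        ∏ v, ν v (flow G ρ l r x v) := by
  induction l generalizing S x with
  | nil => rfl
  | cons γ l ih =>
    rw [paramTerm, ih hl.of_cons, allEdges_sdiff_eq G γ S, Finset.prod_union, mul_assoc, flow_cons]
    · congr 1
      · refine Finset.prod_congr rfl fun e he => ?_
        rw [ends_flow_cons_of_mem G hl (Finset.mem_sdiff.1 he).1]
      · congr 1
        refine Finset.prod_congr rfl fun e he => ?_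
        rw [movers_cons_of_notMem G, flow_cons]
        simp only [Finset.mem_sdiff, Finset.mem_union] at he
        tauto
    · rw [Finset.disjoint_left]
      intro e
      simp only [Finset.mem_sdiff, Finset.mem_union]
      tauto

/-- The property `P e` holds at all points at which the forest term of the list evaluates the weight
of an edge `e`. -/
def EdgesGood (P : Sym2 V → Pt d × Pt d → Prop) :
    List (Finset V) → Finset (Sym2 V) → Config V d → Prop
  | [], S, x => ∀ e ∈ allEdges G \ S, P e (ends x e)
  | γ :: l, S, x => (∀ e ∈ edgesIn G γ \ S, P e (ends x e)) ∧
      EdgesGood P l (S ∪ edgesIn G γ) (contract G γ x)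

lemma edgesGood_of_forall {P : Sym2 V → Pt d × Pt d → Prop} (hl : Nested l)
    {S : Finset (Sym2 V)} (h : ∀ e ∈ allEdges G \ S,
      P e (ends ((movers G l e).foldl (fun z γ => contract G γ z) x) e)) :
    EdgesGood G P l S x := by
  induction l generalizing S x with
  | nil => exact h
  | cons γ l ih =>
    refine ⟨fun e he => ?_, ih hl.of_cons fun e he => ?_⟩
    · have h1 := h e (allEdges_sdiff_eq G γ S ▸ Finset.mem_union_left _ he)
      rw [← flow_eq_foldl_contract G (ρ := fun _ => 1) (r := fun _ => 0) (fun _ _ => rfl),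
        ends_flow_cons_of_mem G hl (Finset.mem_sdiff.1 he).1] at h1
      exact h1
    · have h1 := h e (allEdges_sdiff_eq G γ S ▸ Finset.mem_union_right _ he)
      rwa [movers_cons_of_notMem G, List.foldl_cons] at h1
      simp only [Finset.mem_sdiff, Finset.mem_union] at he
      tauto

end Flow

end

end BPHZ

namespace BPHZ

noncomputable section

open scoped Classical

/-! ### Taylor operators in several parameters -/

section Operators

variable {ι : Type*} [Fintype ι] [DecidableEq ι]

/-- The space of smooth functions of finitely many real parameters. -/
def SmoothFun (ι : Type*) [Fintype ι] : Submodule ℂ ((ι → ℝ) → ℂ) where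
  carrier := {f | ContDiff ℝ ∞ f}
  add_mem' {f g} (hf : ContDiff ℝ ∞ f) (hg : ContDiff ℝ ∞ g) := hf.add hg
  zero_mem' := (contDiff_const : ContDiff ℝ ∞ fun _ : ι → ℝ => (0 : ℂ))
  smul_mem' _ f hf := contDiff_const.smul (show ContDiff ℝ ∞ f from hf)

omit [DecidableEq ι] in
lemma contDiff_coe (f : SmoothFun ι) : ContDiff ℝ ∞ (f : (ι → ℝ) → ℂ) := f.2

omit [DecidableEq ι] in
lemma differentiable_coe (f : SmoothFun ι) : Differentiable ℝ (f : (ι → ℝ) → ℂ) :=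
  (contDiff_coe f).differentiable (by simp)

/-- The partial derivative in the parameter `i`. -/
def partialDeriv (i : ι) (f : (ι → ℝ) → ℂ) (r : ι → ℝ) : ℂ :=
  deriv (fun t => f (Function.update r i t)) (r i)

lemma hasDerivAt_comp_update {f : (ι → ℝ) → ℂ} (hf : Differentiable ℝ f) (i : ι) (r : ι → ℝ)
    (t : ℝ) : HasDerivAt (fun t => f (Function.update r i t))
      (fderiv ℝ f (Function.update r i t) (Pi.single i 1)) t :=
  ((hf _).hasFDerivAt).comp_hasDerivAt t (hasDerivAt_update r i t)

lemma partialDeriv_eq {f : (ι → ℝ) → ℂ} (hf : Differentiable ℝ f) (i : ι) :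
    partialDeriv i f = fun r => fderiv ℝ f r (Pi.single i 1) := by
  ext r
  rw [partialDeriv, (hasDerivAt_comp_update hf i r (r i)).deriv, Function.update_eq_self]

lemma contDiff_partialDeriv {f : (ι → ℝ) → ℂ} (hf : ContDiff ℝ ∞ f) (i : ι) :
    ContDiff ℝ ∞ (partialDeriv i f) := by
  rw [partialDeriv_eq (hf.differentiable (by simp))]
  exact (hf.fderiv_right (m := ∞) (by simp)).clm_apply contDiff_const

/-- The partial derivative as an endomorphism of the space of smooth functions. -/
def pd (i : ι) : Module.End ℂ (SmoothFun ι) where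
  toFun f := ⟨partialDeriv i f, contDiff_partialDeriv f.2 i⟩
  map_add' f g := by
    ext r
    simp only [Submodule.coe_add, partialDeriv_eq ((differentiable_coe f).add (differentiable_coe g)),
      partialDeriv_eq (differentiable_coe f), partialDeriv_eq (differentiable_coe g), Pi.add_apply]
    rw [fderiv_add ((differentiable_coe f) r) ((differentiable_coe g) r)]
    rfl
  map_smul' c f := by
    ext r
    simp only [Submodule.coe_smul, RingHom.id_apply, Pi.smul_apply, partialDeriv]
    exact deriv_const_smul_field c _

/-- The restriction to the value `a` of the parameter `i`. -/
def evalAt (i : ι) (a : ℝ) : Module.End ℂ (SmoothFun ι) where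
  toFun f := ⟨fun r => (f : (ι → ℝ) → ℂ) (Function.update r i a), (contDiff_coe f).comp (by
    refine contDiff_pi.2 fun j => ?_
    by_cases h : j = i
    · subst h; simp only [Function.update_self]; exact contDiff_const
    · simp only [Function.update_of_ne h]; exact contDiff_apply ℝ ℝ j)⟩
  map_add' _ _ := rfl
  map_smul' _ _ := rfl

/-- The Taylor polynomial with `k` terms in the parameter `i`, about the value `0` and evaluated at
the value `a`. -/
def jet (i : ι) (a : ℝ) (k : ℕ) : Module.End ℂ (SmoothFun ι) :=
  ∑ j ∈ Finset.range k, ((a : ℂ) ^ j / (j.factorial : ℂ)) • (evalAt i 0 * pd i ^ j)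

@[simp] lemma pd_apply (i : ι) (f : SmoothFun ι) (r : ι → ℝ) :
    (pd i f : (ι → ℝ) → ℂ) r = partialDeriv i f r := rfl

@[simp] lemma evalAt_apply (i : ι) (a : ℝ) (f : SmoothFun ι) (r : ι → ℝ) :
    (evalAt i a f : (ι → ℝ) → ℂ) r = (f : (ι → ℝ) → ℂ) (Function.update r i a) := rfl

lemma jet_apply (i : ι) (a : ℝ) (k : ℕ) (f : SmoothFun ι) (r : ι → ℝ) :
    (jet i a k f : (ι → ℝ) → ℂ) r = ∑ j ∈ Finset.range k, ((a : ℂ) ^ j / (j.factorial : ℂ)) *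
      ((pd i ^ j) f : (ι → ℝ) → ℂ) (Function.update r i 0) := by
  simp [jet, LinearMap.sum_apply, Finset.sum_apply]

lemma pd_commute (i j : ι) : Commute (pd i) (pd j) := by
  refine LinearMap.ext fun f => Subtype.ext (funext fun r => ?_)
  have key : ∀ i j : ι, partialDeriv i (partialDeriv j (f : (ι → ℝ) → ℂ)) r =
      fderiv ℝ (fderiv ℝ (f : (ι → ℝ) → ℂ)) r (Pi.single i 1) (Pi.single j 1) := by
    intro i j
    rw [partialDeriv_eq ((contDiff_partialDeriv f.2 j).differentiable (by simp)),
      partialDeriv_eq (differentiable_coe f)]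
    have h1 : DifferentiableAt ℝ (fderiv ℝ (f : (ι → ℝ) → ℂ)) r :=
      (((contDiff_coe f).fderiv_right (m := ∞) (by simp)).differentiable (by simp)) r
    have h2 := fderiv_clm_apply (u := fun _ : ι → ℝ => (Pi.single j (1 : ℝ) : ι → ℝ)) h1
      (differentiableAt_const _)
    dsimp only
    rw [h2]
    simp
  change partialDeriv i (partialDeriv j (f : (ι → ℝ) → ℂ)) r =
    partialDeriv j (partialDeriv i (f : (ι → ℝ) → ℂ)) r
  rw [key, key]
  have hs : IsSymmSndFDerivAt ℝ (f : (ι → ℝ) → ℂ) r :=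
    (contDiff_coe f).contDiffAt.isSymmSndFDerivAt (by
      simpa using (WithTop.coe_le_coe.2 le_top : ((2 : ℕ∞) : WithTop ℕ∞) ≤ ∞))
  exact hs _ _

lemma pd_commute_evalAt {i j : ι} (h : i ≠ j) (a : ℝ) : Commute (pd i) (evalAt j a) := by
  refine LinearMap.ext fun f => Subtype.ext (funext fun r => ?_)
  change deriv (fun t => (f : (ι → ℝ) → ℂ) (Function.update (Function.update r i t) j a)) (r i) =
    deriv (fun t => (f : (ι → ℝ) → ℂ) (Function.update (Function.update r j a) i t))
      (Function.update r j a i)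
  rw [Function.update_of_ne h]
  simp_rw [Function.update_comm h]

lemma evalAt_commute {i j : ι} (h : i ≠ j) (a b : ℝ) : Commute (evalAt i a) (evalAt j b) := by
  refine LinearMap.ext fun f => Subtype.ext (funext fun r => ?_)
  change (f : (ι → ℝ) → ℂ) (Function.update (Function.update r i a) j b) =
    (f : (ι → ℝ) → ℂ) (Function.update (Function.update r j b) i a)
  rw [Function.update_comm h]

lemma commute_jet {i : ι} {a : ℝ} {k : ℕ} {T : Module.End ℂ (SmoothFun ι)}
    (h1 : Commute T (evalAt i 0)) (h2 : Commute T (pd i)) : Commute T (jet i a k) :=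
  Commute.sum_right _ _ _ fun _ _ => (h1.mul_right (h2.pow_right _)).smul_right _

lemma pd_commute_jet {i j : ι} (h : i ≠ j) (a : ℝ) (k : ℕ) : Commute (pd i) (jet j a k) :=
  commute_jet (pd_commute_evalAt h 0) (pd_commute i j)

lemma evalAt_commute_jet {i j : ι} (h : i ≠ j) (a b : ℝ) (k : ℕ) :
    Commute (evalAt i b) (jet j a k) :=
  commute_jet (evalAt_commute h b 0) (pd_commute_evalAt h.symm b).symm

lemma jet_commute {i j : ι} (h : i ≠ j) (a b : ℝ) (k m : ℕ) :
    Commute (jet i a k) (jet j b m) :=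
  commute_jet (evalAt_commute_jet h.symm a 0 k).symm (pd_commute_jet h.symm a k).symm

lemma pd_pow_update (i : ι) (f : SmoothFun ι) (r : ι → ℝ) (j : ℕ) :
    (fun t => ((pd i ^ j) f : (ι → ℝ) → ℂ) (Function.update r i t)) =
      iteratedDeriv j (fun t => (f : (ι → ℝ) → ℂ) (Function.update r i t)) := by
  induction j with
  | zero => simp
  | succ j ih =>
    rw [iteratedDeriv_succ, ← ih, pow_succ']
    ext t
    simp [partialDeriv]

lemma norm_sub_jet_le {i : ι} {a : ℝ} (ha : 0 ≤ a) {k : ℕ} (hk : 0 < k) (f : SmoothFun ι)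
    (r : ι → ℝ) {K : ℝ} (hK : ∀ t ∈ Set.Icc 0 a,
      ‖((pd i ^ k) f : (ι → ℝ) → ℂ) (Function.update r i t)‖ ≤ K) :
    ‖((evalAt i a - jet i a k) f : (ι → ℝ) → ℂ) r‖ ≤ a ^ k * K := by
  obtain ⟨n, rfl⟩ : ∃ n, k = n + 1 := ⟨k - 1, by omega⟩
  set φ : ℝ → ℂ := fun t => (f : (ι → ℝ) → ℂ) (Function.update r i t) with hφ
  have hφs : ContDiff ℝ ∞ φ := (contDiff_coe f).comp (contDiff_update _ _ _)
  have hK0 : 0 ≤ K := (norm_nonneg _).trans (hK 0 ⟨le_rfl, ha⟩)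
  rcases ha.eq_or_lt with rfl | ha'
  · have : ((evalAt i (0 : ℝ) - jet i 0 (n + 1)) f : (ι → ℝ) → ℂ) r = 0 := by
      rw [LinearMap.sub_apply, Submodule.coe_sub, Pi.sub_apply, jet_apply, Finset.sum_range_succ',
        Finset.sum_eq_zero (fun j _ => by simp)]
      simp
    rw [this, norm_zero]
    positivity
  have hd : ∀ j, ∀ t ∈ Set.Icc 0 a, iteratedDerivWithin j φ (Set.Icc 0 a) t =
      ((pd i ^ j) f : (ι → ℝ) → ℂ) (Function.update r i t) := by
    intro j t ht
    rw [iteratedDerivWithin_eq_iteratedDeriv (uniqueDiffOn_Icc ha')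
      (hφs.contDiffAt.of_le (by exact_mod_cast le_top)) ht, hφ, ← pd_pow_update]
  have h := taylor_mean_remainder_bound (f := φ) (a := 0) (b := a) (x := a) (n := n) (C := K) ha
    (hφs.contDiffOn.of_le (by exact_mod_cast le_top)) ⟨ha, le_rfl⟩
    (fun y hy => by rw [hd _ y hy]; exact hK y hy)
  have h2 : taylorWithinEval φ n (Set.Icc 0 a) 0 a = (jet i a (n + 1) f : (ι → ℝ) → ℂ) r := by
    rw [taylor_within_apply, jet_apply]
    refine Finset.sum_congr rfl fun j _ => ?_
    rw [hd j 0 ⟨le_rfl, ha⟩, Complex.real_smul]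
    push_cast
    rw [sub_zero, div_eq_inv_mul]
  rw [h2, sub_zero] at h
  refine h.trans ?_
  rw [mul_comm (a ^ (n + 1)) K]
  exact div_le_self (by positivity) (by exact_mod_cast Nat.succ_le_of_lt (Nat.factorial_pos n))

/-- The parameters `r` with `0 ≤ r i ≤ ρ i`, and `r i = 0` for `i ∉ T`. -/
def paramBox (ρ : ι → ℝ) (T : Finset ι) : Set (ι → ℝ) :=
  {r | ∀ i, 0 ≤ r i ∧ r i ≤ ρ i ∧ (i ∉ T → r i = 0)}

/-- All mixed partial derivatives of `f` of order at most `N` in the parameters in `A` are bounded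
by `K` on the box. -/
def MixedBound (ρ : ι → ℝ) (T : Finset ι) (A : Set ι) (N : ℕ) (f : SmoothFun ι) (K : ℝ) : Prop :=
  ∀ w : List ι, w.length ≤ N → (∀ i ∈ w, i ∈ A) → ∀ r ∈ paramBox ρ T,
    ‖(((w.map pd).prod) f : (ι → ℝ) → ℂ) r‖ ≤ K

variable {ρ : ι → ℝ} {T : Finset ι} {A : Set ι} {N k : ℕ} {f : SmoothFun ι} {K : ℝ} {i : ι}

omit [Fintype ι] in
lemma update_zero_mem_paramBox (hρ : ∀ i, 0 ≤ ρ i) {r : ι → ℝ} (hr : r ∈ paramBox ρ T) :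
    Function.update r i 0 ∈ paramBox ρ T := by
  intro j
  by_cases h : j = i
  · subst h; simp [hρ]
  · simpa [Function.update_of_ne h] using hr j

omit [Fintype ι] in
lemma update_mem_paramBox (hi : i ∈ T) {t : ℝ} (ht : t ∈ Set.Icc 0 (ρ i)) {r : ι → ℝ}
    (hr : r ∈ paramBox ρ T) : Function.update r i t ∈ paramBox ρ T := by
  intro j
  by_cases h : j = i
  · subst h; simp [ht.1, ht.2, hi]
  · simpa [Function.update_of_ne h] using hr j

lemma commute_prod_map_pd {w : List ι} {S : Module.End ℂ (SmoothFun ι)}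
    (h : ∀ j ∈ w, Commute (pd j) S) : Commute (w.map pd).prod S := by
  induction w with
  | nil => exact Commute.one_left _
  | cons j w ih =>
    rw [List.map_cons, List.prod_cons]
    exact (h j List.mem_cons_self).mul_left (ih fun j' h' => h j' (List.mem_cons_of_mem _ h'))

lemma MixedBound.pow (hb : MixedBound ρ T A (N + k) f K) (hi : i ∈ A) {w : List ι}
    (hw : w.length ≤ N) (hA : ∀ j ∈ w, j ∈ A) {j : ℕ} (hj : j ≤ k) {r : ι → ℝ}
    (hr : r ∈ paramBox ρ T) :
    ‖((pd i ^ j) ((w.map pd).prod f) : (ι → ℝ) → ℂ) r‖ ≤ K := by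
  have h := hb (List.replicate j i ++ w) (by simp; omega) (fun a ha => by
    rcases List.mem_append.1 ha with h | h
    · rw [(List.mem_replicate.1 h).2]; exact hi
    · exact hA a h) r hr
  rwa [List.map_append, List.prod_append, List.map_replicate, List.prod_replicate] at h

lemma MixedBound.jet (hρ : ∀ i, 0 ≤ ρ i) (hρ1 : ρ i ≤ 1)
    (hb : MixedBound ρ T A (N + k) f K) (hi : i ∈ A) :
    MixedBound ρ T (A \ {i}) N ((-jet i (ρ i) k) f) (k * K) := by
  intro w hw hA r hr
  have hc : Commute (w.map pd).prod (BPHZ.jet i (ρ i) k) := commute_prod_map_pd fun j hj =>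
    pd_commute_jet (by rintro rfl; exact (hA _ hj).2 rfl) _ _
  rw [LinearMap.neg_apply, map_neg, Submodule.coe_neg, Pi.neg_apply, norm_neg,
    ← Module.End.mul_apply, hc.eq, Module.End.mul_apply, jet_apply]
  calc _ ≤ ∑ j ∈ Finset.range k, K := by
        refine norm_sum_le_of_le _ fun j hj => ?_
        rw [norm_mul]
        have h1 := hb.pow hi hw (fun a ha => (hA a ha).1) (Finset.mem_range.1 hj).le
          (update_zero_mem_paramBox (i := i) hρ hr)
        refine (mul_le_of_le_one_left (norm_nonneg _) ?_).trans h1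
        rw [norm_div, norm_pow, Complex.norm_natCast, Complex.norm_real, Real.norm_eq_abs,
          abs_of_nonneg (hρ i)]
        refine (div_le_self (pow_nonneg (hρ i) _) ?_).trans (pow_le_one₀ (hρ i) hρ1)
        exact_mod_cast Nat.succ_le_of_lt (Nat.factorial_pos j)
    _ = k * K := by simp

lemma MixedBound.sub_jet (hρ : ∀ i, 0 ≤ ρ i) (hk : 0 < k) (hT : i ∈ T)
    (hb : MixedBound ρ T A (N + k) f K) (hi : i ∈ A) :
    MixedBound ρ T (A \ {i}) N ((-BPHZ.jet i (ρ i) k + evalAt i (ρ i)) f) (ρ i ^ k * K) := by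
  intro w hw hA r hr
  have hne : ∀ j ∈ w, j ≠ i := by rintro j hj rfl; exact (hA _ hj).2 rfl
  have hc1 : Commute (w.map pd).prod (evalAt i (ρ i)) :=
    commute_prod_map_pd fun j hj => pd_commute_evalAt (hne j hj) _
  have hc2 : Commute (w.map pd).prod (BPHZ.jet i (ρ i) k) :=
    commute_prod_map_pd fun j hj => pd_commute_jet (hne j hj) _ _
  have h : (w.map pd).prod ((-BPHZ.jet i (ρ i) k + evalAt i (ρ i)) f) =
      (evalAt i (ρ i) - BPHZ.jet i (ρ i) k) ((w.map pd).prod f) := by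
    rw [LinearMap.add_apply, LinearMap.neg_apply, map_add, map_neg, LinearMap.sub_apply,
      ← Module.End.mul_apply, ← Module.End.mul_apply, hc1.eq, hc2.eq, Module.End.mul_apply,
      Module.End.mul_apply, neg_add_eq_sub]
  rw [h]
  exact norm_sub_jet_le (hρ i) hk _ r fun t ht =>
    hb.pow hi hw (fun a ha => (hA a ha).1) le_rfl (update_mem_paramBox hT ht hr)

/-- Each subtraction `1 - t` in a parameter that runs over `[0, ρ]` gains the factor `ρ ^ k`, and
each operator `-t` is bounded. -/
lemma MixedBound.list (hρ : ∀ i, 0 ≤ ρ i) (k : ι → ℕ) :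
    ∀ (l : List ι) (N : ℕ), l.Nodup → (∀ i ∈ l, ρ i ≤ 1) → (∀ i ∈ l, 0 < k i) →
    MixedBound ρ T Set.univ (N + (l.map k).sum) f K →
    MixedBound ρ T {i | i ∉ l} N ((l.map (fun i => if i ∈ T then
      -BPHZ.jet i (ρ i) (k i) + evalAt i (ρ i) else -BPHZ.jet i (ρ i) (k i))).prod f)
      ((l.map (fun i => if i ∈ T then ρ i ^ k i else (k i : ℝ))).prod * K) := by
  intro l
  induction l with
  | nil => intro N _ _ _ h; simpa using h
  | cons i l ih =>
    intro N hnd h1 hk hb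
    have hb' := ih (N + k i) hnd.of_cons (fun j hj => h1 j (List.mem_cons_of_mem _ hj))
      (fun j hj => hk j (List.mem_cons_of_mem _ hj)) (by
        rw [List.map_cons, List.sum_cons, ← add_assoc] at hb; exact hb)
    have hi : i ∈ {i | i ∉ l} := (List.nodup_cons.1 hnd).1
    have hset : {j | j ∉ i :: l} = {j | j ∉ l} \ {i} := by
      ext j; simp [not_or, and_comm]
    rw [hset, List.map_cons, List.prod_cons, Module.End.mul_apply, List.map_cons, List.prod_cons,
      mul_assoc]
    split_ifs with hT
    · exact hb'.sub_jet hρ (hk i List.mem_cons_self) hT hi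
    · exact hb'.jet hρ (h1 i List.mem_cons_self) hi

/-- If all derivatives up to order `N` are bounded then so are the mixed partial derivatives. -/
lemma mixedBound_of_iteratedFDeriv (h : ∀ m ≤ N, ∀ r ∈ paramBox ρ T,
    ‖iteratedFDeriv ℝ m (f : (ι → ℝ) → ℂ) r‖ ≤ K) : MixedBound ρ T Set.univ N f K := by
  have key : ∀ w : List ι, ∃ v : Fin w.length → ι → ℝ, (∀ i, ‖v i‖ ≤ 1) ∧
      (((w.map pd).prod f : SmoothFun ι) : (ι → ℝ) → ℂ) =
        fun r => iteratedFDeriv ℝ w.length (f : (ι → ℝ) → ℂ) r v := by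
    intro w
    induction w with
    | nil => exact ⟨fun _ => 0, fun i => i.elim0, by ext r; simp⟩
    | cons i w ih =>
      obtain ⟨v, hv, hw⟩ := ih
      refine ⟨Fin.cons (Pi.single i 1) v, fun j => ?_, ?_⟩
      · refine Fin.cases ?_ (fun j => ?_) j
        · rw [Fin.cons_zero, Pi.norm_single, norm_one]
        · rw [Fin.cons_succ]; exact hv j
      · rw [List.map_cons, List.prod_cons, Module.End.mul_apply]
        change partialDeriv i _ = _
        rw [partialDeriv_eq (differentiable_coe _), hw]
        ext r
        have hd : DifferentiableAt ℝ (iteratedFDeriv ℝ w.length (f : (ι → ℝ) → ℂ)) r :=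
          ((contDiff_coe f).differentiable_iteratedFDeriv (by exact_mod_cast ENat.natCast_lt_top _)) r
        rw [fderiv_continuousMultilinear_apply_const_apply hd]
        symm
        refine (iteratedFDeriv_succ_apply_left (n := w.length) _).trans ?_
        rw [Fin.cons_zero, Fin.tail_cons]
  intro w hw _ r hr
  obtain ⟨v, hv, hvw⟩ := key w
  rw [hvw]
  calc _ ≤ ‖iteratedFDeriv ℝ w.length (f : (ι → ℝ) → ℂ) r‖ * ∏ i, ‖v i‖ :=
        ContinuousMultilinearMap.le_opNorm _ _
    _ ≤ ‖iteratedFDeriv ℝ w.length (f : (ι → ℝ) → ℂ) r‖ * 1 := by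
        gcongr
        exact Finset.prod_le_one (fun _ _ => norm_nonneg _) (fun i _ => hv i)
    _ ≤ K := by rw [mul_one]; exact h _ hw r hr

/-- The Taylor operators in the parameters of a list do not see how a function depends on the
other parameters. -/
lemma prod_jet_congr (a : ι → ℝ) (k : ι → ℕ) {b : ℝ} {c : ℂ} :
    ∀ (l : List ι), i ∉ l → ∀ f g : SmoothFun ι,
      (∀ r : ι → ℝ, r i = b → (f : (ι → ℝ) → ℂ) r = c * (g : (ι → ℝ) → ℂ) r) →
      ∀ r : ι → ℝ, r i = b → ((l.map (fun j => -BPHZ.jet j (a j) (k j))).prod f : (ι → ℝ) → ℂ) r =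
        c * ((l.map (fun j => -BPHZ.jet j (a j) (k j))).prod g : (ι → ℝ) → ℂ) r := by
  have hpd : ∀ j, j ≠ i → ∀ f g : SmoothFun ι,
      (∀ r : ι → ℝ, r i = b → (f : (ι → ℝ) → ℂ) r = c * (g : (ι → ℝ) → ℂ) r) →
      ∀ r : ι → ℝ, r i = b → (pd j f : (ι → ℝ) → ℂ) r = c * (pd j g : (ι → ℝ) → ℂ) r := by
    intro j hj f g hfg r hr
    simp only [pd_apply, partialDeriv]
    rw [← deriv_const_mul_field]
    congr 1
    ext t
    exact hfg _ (by rw [Function.update_of_ne hj.symm, hr])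
  have hpow : ∀ j, j ≠ i → ∀ n : ℕ, ∀ f g : SmoothFun ι,
      (∀ r : ι → ℝ, r i = b → (f : (ι → ℝ) → ℂ) r = c * (g : (ι → ℝ) → ℂ) r) →
      ∀ r : ι → ℝ, r i = b → ((pd j ^ n) f : (ι → ℝ) → ℂ) r =
        c * ((pd j ^ n) g : (ι → ℝ) → ℂ) r := by
    intro j hj n
    induction n with
    | zero => intro f g h; simpa using h
    | succ n ih =>
      intro f g h
      rw [pow_succ, Module.End.mul_apply, Module.End.mul_apply]
      exact ih _ _ (hpd j hj f g h)
  intro l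
  induction l with
  | nil => intro _ f g h; simpa using h
  | cons j l ih =>
    intro hi f g h r hr
    have hji : j ≠ i := fun h => hi (h ▸ List.mem_cons_self)
    have ih' := ih (fun h => hi (List.mem_cons_of_mem _ h)) f g h
    simp only [List.map_cons, List.prod_cons, Module.End.mul_apply, LinearMap.neg_apply,
      Submodule.coe_neg, Pi.neg_apply, jet_apply]
    rw [mul_neg, Finset.mul_sum]
    congr 1
    refine Finset.sum_congr rfl fun n _ => ?_
    rw [hpow j hji n _ _ ih' _ (by rw [Function.update_of_ne hji.symm, hr])]
    ring

omit [Fintype ι] in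
/-- Expansion of an ordered product of sums. -/
lemma sum_powerset_prod_map {R : Type*} [Ring R] (a b : ι → R) :
    ∀ (l : List ι) (T : Finset ι), l.Nodup → (∀ i ∈ T, i ∈ l) →
      ∑ X ∈ T.powerset, (l.map (fun i => if i ∈ T ∧ i ∉ X then b i else a i)).prod =
        (l.map (fun i => if i ∈ T then a i + b i else a i)).prod := by
  intro l
  induction l with
  | nil =>
    intro T _ hT
    have : T = ∅ := Finset.eq_empty_of_forall_notMem fun i hi => by simpa using hT i hi
    subst this; simp
  | cons i l ih =>
    intro T hnd hT
    have hil := (List.nodup_cons.1 hnd).1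
    have hne : ∀ j ∈ l, j ≠ i := by rintro j hj rfl; exact hil hj
    by_cases hi : i ∈ T
    · have hT0 : T = insert i (T.erase i) := (Finset.insert_erase hi).symm
      have hi0 : i ∉ T.erase i := Finset.notMem_erase i T
      have ih' := ih (T.erase i) hnd.of_cons (fun j hj => by
        rcases List.mem_cons.1 (hT j (Finset.mem_of_mem_erase hj)) with h | h
        · exact absurd h (Finset.ne_of_mem_erase hj)
        · exact h)
      have hrhs : (l.map (fun j => if j ∈ T then a j + b j else a j)) =
          l.map (fun j => if j ∈ T.erase i then a j + b j else a j) :=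
        List.map_congr_left fun j hj => by simp [hne j hj]
      rw [List.map_cons, List.prod_cons, hrhs, ← ih', if_pos hi, Finset.mul_sum]
      conv_lhs => rw [hT0]
      rw [Finset.sum_powerset_insert hi0, ← Finset.sum_add_distrib]
      refine Finset.sum_congr rfl fun X hX => ?_
      have hiX : i ∉ X := fun h => hi0 (Finset.mem_powerset.1 hX h)
      rw [List.map_cons, List.prod_cons, List.map_cons, List.prod_cons, add_mul, add_comm]
      congr 1
      · rw [if_neg (by simp)]
        congr 2
        exact List.map_congr_left fun j hj => by simp [hne j hj]
      · rw [if_pos (by simp [hiX])]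
        congr 2
        exact List.map_congr_left fun j hj => by simp [hne j hj]
    · have ih' := ih T hnd.of_cons (fun j hj => by
        rcases List.mem_cons.1 (hT j hj) with h | h
        · exact absurd hj (h ▸ hi)
        · exact h)
      rw [List.map_cons, List.prod_cons, ← ih', if_neg hi, Finset.mul_sum]
      refine Finset.sum_congr rfl fun X _ => ?_
      rw [List.map_cons, List.prod_cons, if_neg (by tauto)]

end Operators

end

end BPHZ

namespace BPHZ

noncomputable section

open scoped Classical

/-! ### Forest terms as Taylor operators in the interpolation parameters -/

section Calculus

variable {X E F : Type*} [NormedAddCommGroup X] [NormedSpace ℝ X] [NormedAddCommGroup E]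
  [NormedSpace ℝ E] [NormedAddCommGroup F] [NormedSpace ℝ F]

lemma contDiffAt_multilinear_apply_const [CompleteSpace F] {x : X} {h : X → E}
    (hh : ContDiffAt ℝ ∞ h x) (j : ℕ) (A : X → E [×j]→L[ℝ] F) (hA : ContDiffAt ℝ ∞ A x) :
    ContDiffAt ℝ ∞ (fun y => A y (fun _ => h y)) x := by
  have h1 : AnalyticAt ℝ (fun p : (E [×j]→L[ℝ] F) × (Fin j → E) =>
      (ContinuousLinearMap.id ℝ (E [×j]→L[ℝ] F)) p.1 p.2) (A x, fun _ => h x) :=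
    ContinuousLinearMap.analyticAt_uncurry_of_multilinear _
  exact h1.contDiffAt.comp x (f := fun y => (A y, fun _ => h y))
    (hA.prodMk (contDiffAt_pi.2 fun _ => hh))

lemma iteratedDeriv_line {f : E → F} (hf : ContDiff ℝ ∞ f) (c h : E) (j : ℕ) :
    iteratedDeriv j (fun t : ℝ => f (c + t • h)) =
      fun t => iteratedFDeriv ℝ j f (c + t • h) (fun _ => h) := by
  induction j with
  | zero => ext t; simp
  | succ j ih =>
    rw [iteratedDeriv_succ, ih]
    ext t
    have hd : DifferentiableAt ℝ (iteratedFDeriv ℝ j f) (c + t • h) :=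
      (hf.differentiable_iteratedFDeriv (by exact_mod_cast ENat.natCast_lt_top _)) _
    have h1 : HasDerivAt (fun t : ℝ => c + t • h) h t := by
      simpa using ((hasDerivAt_id t).smul_const h).const_add c
    have h2 := hd.hasFDerivAt.comp_hasDerivAt t h1
    have h3 := (ContinuousMultilinearMap.apply ℝ (fun _ : Fin j => E) F
      (fun _ => h)).hasFDerivAt.comp_hasDerivAt t h2
    refine h3.deriv.trans ?_
    symm
    exact iteratedFDeriv_succ_apply_left _

end Calculus

section Terms

variable {V : Type*} [Fintype V] (G : SimpleGraph V) {d : ℕ}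

lemma contDiff_contract (γ : Finset V) :
    ContDiff ℝ ∞ (fun x : Config V d => contract G γ x) := by
  refine contDiff_pi.2 fun v => ?_
  unfold contract meanPoint
  split_ifs
  · exact ContDiff.const_smul _ (ContDiff.sum fun w _ =>
      ContDiff.const_smul _ (contDiff_apply ℝ (Pt d) w))
  · exact contDiff_apply ℝ _ v

lemma contDiff_ends (e : Sym2 V) : ContDiff ℝ ∞ (fun x : Config V d => ends x e) :=
  (contDiff_apply (ι := V) ℝ (Pt d) (Quot.out e).1).prodMk
    (contDiff_apply (ι := V) ℝ (Pt d) (Quot.out e).2)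

/-- The forest term of a list for arbitrary subtraction degrees, edge functions and vertex
functions. -/
def termOf (k : Finset V → ℤ) (w : Sym2 V → Pt d × Pt d → ℂ) (ν : V → Pt d → ℂ) :
    List (Finset V) → Finset (Sym2 V) → Config V d → ℂ
  | [], S => fun x => (∏ e ∈ allEdges G \ S, w e (ends x e)) * ∏ v, ν v (x v)
  | γ :: l, S => fun x => (∏ e ∈ edgesIn G γ \ S, w e (ends x e)) *
      (- taylor G (k γ) γ (termOf k w ν l (S ∪ edgesIn G γ)) x)

lemma forestTerm_eq_termOf {G : SimpleGraph V} (u : GraphWeight G d) (l : List (Finset V)) :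
    ∀ S, u.forestTerm l S = termOf G u.subDegree u.edge u.vertex l S := by
  induction l with
  | nil => intro S; rfl
  | cons γ l ih =>
    intro S
    rw [GraphWeight.forestTerm, termOf, ← ih]
    rfl

variable {G} {k : Finset V → ℤ} {w w' : Sym2 V → Pt d × Pt d → ℂ} {ν : V → Pt d → ℂ}

lemma taylor_congr {f g : Config V d → ℂ} {γ : Finset V} {x : Config V d} (n : ℤ)
    (h : f =ᶠ[𝓝 (contract G γ x)] g) : taylor G n γ f =ᶠ[𝓝 x] taylor G n γ g := by
  have h1 : ∀ᶠ y in 𝓝 x, ∀ j ∈ Finset.range (n + 1).toNat,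
      iteratedFDeriv ℝ j f (contract G γ y) = iteratedFDeriv ℝ j g (contract G γ y) := by
    rw [Filter.eventually_all_finset]
    intro j _
    exact (contDiff_contract G γ).continuous.continuousAt.eventually (h.iteratedFDeriv ℝ j)
  filter_upwards [h1] with y hy
  unfold taylor
  exact Finset.sum_congr rfl fun j hj => by rw [hy j hj]

lemma termOf_congr {l : List (Finset V)} : ∀ {S : Finset (Sym2 V)} {x : Config V d},
    EdgesGood G (fun e p => w e =ᶠ[𝓝 p] w' e) l S x →
      termOf G k w ν l S =ᶠ[𝓝 x] termOf G k w' ν l S := by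
  have key : ∀ (T : Finset (Sym2 V)) (x : Config V d),
      (∀ e ∈ T, w e =ᶠ[𝓝 (ends x e)] w' e) →
      ∀ᶠ y in 𝓝 x, ∏ e ∈ T, w e (ends y e) = ∏ e ∈ T, w' e (ends y e) := by
    intro T x h
    have : ∀ᶠ y in 𝓝 x, ∀ e ∈ T, w e (ends y e) = w' e (ends y e) := by
      rw [Filter.eventually_all_finset]
      exact fun e he => (contDiff_ends e).continuous.continuousAt.eventually (h e he)
    filter_upwards [this] with y hy
    exact Finset.prod_congr rfl hy
  induction l with
  | nil =>
    intro S x h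
    filter_upwards [key _ x h] with y hy
    simp only [termOf, hy]
  | cons γ l ih =>
    intro S x h
    filter_upwards [key _ x h.1, taylor_congr (k γ) (ih h.2)] with y hy hy'
    simp only [termOf, hy, hy']

lemma contDiffAt_termOf (hν : ∀ v, ContDiff ℝ ∞ (ν v)) {l : List (Finset V)} :
    ∀ {S : Finset (Sym2 V)} {x : Config V d},
    EdgesGood G (fun e p => ContDiffAt ℝ ∞ (w e) p) l S x →
      ContDiffAt ℝ ∞ (termOf G k w ν l S) x := by
  have key : ∀ (T : Finset (Sym2 V)) (x : Config V d),
      (∀ e ∈ T, ContDiffAt ℝ ∞ (w e) (ends x e)) →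
      ContDiffAt ℝ ∞ (fun y => ∏ e ∈ T, w e (ends y e)) x := fun T x h =>
    contDiffAt_prod fun e he => (h e he).comp x (contDiff_ends e).contDiffAt
  induction l with
  | nil =>
    intro S x h
    exact (key _ x h).mul (contDiffAt_prod fun v _ =>
      ((hν v).comp (contDiff_apply ℝ _ v)).contDiffAt)
  | cons γ l ih =>
    intro S x h
    refine (key _ x h.1).mul (ContDiffAt.neg ?_)
    unfold taylor
    refine ContDiffAt.sum fun j _ => contDiffAt_const.mul ?_
    have h1 : ContDiffAt ℝ ∞ (iteratedFDeriv ℝ j (termOf G k w ν l (S ∪ edgesIn G γ)))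
        (contract G γ x) := (ih h.2).iteratedFDeriv_right (by
          exact_mod_cast (le_top : (⊤ : ℕ∞) + j ≤ ⊤))
    exact contDiffAt_multilinear_apply_const
      (contDiff_id.sub (contDiff_contract G γ)).contDiffAt j
      (fun y => iteratedFDeriv ℝ j (termOf G k w ν l (S ∪ edgesIn G γ)) (contract G γ y))
      (h1.comp x (contDiff_contract G γ).contDiffAt)

lemma edgesGood_of_all {P : Sym2 V → Pt d × Pt d → Prop} (h : ∀ e p, P e p)
    (l : List (Finset V)) : ∀ (S : Finset (Sym2 V)) (x : Config V d), EdgesGood G P l S x := by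
  induction l with
  | nil => exact fun _ _ _ _ => h _ _
  | cons γ l ih => exact fun _ _ => ⟨fun _ _ => h _ _, ih _ _⟩

variable (G) in
lemma contDiff_paramTerm (hw : ∀ e, ContDiff ℝ ∞ (w e)) (hν : ∀ v, ContDiff ℝ ∞ (ν v))
    (ρ : Finset V → ℝ) (l : List (Finset V)) : ∀ (S : Finset (Sym2 V)),
    ContDiff ℝ ∞ (fun p : Config V d × (Finset V → ℝ) => paramTerm G w ν ρ l S p.1 p.2) := by
  induction l with
  | nil =>
    intro S
    exact (contDiff_prod fun e _ => (hw e).comp ((contDiff_ends e).comp contDiff_fst)).mul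
      (contDiff_prod fun v _ => (hν v).comp ((contDiff_apply ℝ _ v).comp contDiff_fst))
  | cons γ l ih =>
    intro S
    refine (contDiff_prod fun e _ => (hw e).comp ((contDiff_ends e).comp contDiff_fst)).mul
      ((ih _).comp (ContDiff.prodMk ?_ contDiff_snd))
    have h1 : ContDiff ℝ ∞ (fun p : Config V d × (Finset V → ℝ) => contract G γ p.1) :=
      (contDiff_contract G γ).comp contDiff_fst
    have h2 : ContDiff ℝ ∞ (fun p : Config V d × (Finset V → ℝ) => p.2 γ) :=
      (contDiff_apply ℝ _ γ).comp contDiff_snd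
    exact h1.add ((h2.div_const _).smul (contDiff_fst.sub h1))

variable (G) in
/-- The function `paramTerm` as an element of the space of smooth functions of the parameters. -/
def paramFun (hw : ∀ e, ContDiff ℝ ∞ (w e)) (hν : ∀ v, ContDiff ℝ ∞ (ν v))
    (ρ : Finset V → ℝ) (l : List (Finset V)) (S : Finset (Sym2 V)) (x : Config V d) :
    SmoothFun (Finset V) :=
  ⟨fun r => paramTerm G w ν ρ l S x r,
    (contDiff_paramTerm G hw hν ρ l S).comp (contDiff_const.prodMk contDiff_id)⟩

/-- The forest term arises from the interpolated integrand by Taylor operators in the parameters. -/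
lemma termOf_eq_jets (hw : ∀ e, ContDiff ℝ ∞ (w e)) (hν : ∀ v, ContDiff ℝ ∞ (ν v))
    {ρ : Finset V → ℝ} {l : List (Finset V)} :
    ∀ (S : Finset (Sym2 V)) (x : Config V d) (r : Finset V → ℝ), l.Nodup → (∀ γ ∈ l, ρ γ ≠ 0) →
    termOf G k w ν l S x = ((l.map (fun γ => -jet γ (ρ γ) (k γ + 1).toNat)).prod
      (paramFun G hw hν ρ l S x) : (Finset V → ℝ) → ℂ) r := by
  induction l with
  | nil => intros; rfl
  | cons γ l ih =>
    intro S x r hnd hρ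
    have hρ0 := hρ γ List.mem_cons_self
    set f := termOf G k w ν l (S ∪ edgesIn G γ) with hf
    have hfs : ContDiff ℝ ∞ f := contDiff_iff_contDiffAt.2 fun y =>
      contDiffAt_termOf hν (edgesGood_of_all (fun e p => (hw e).contDiffAt) _ _ _)
    set E := ∏ e ∈ edgesIn G γ \ S, w e (ends x e) with hE
    set R := (l.map (fun γ => -jet γ (ρ γ) (k γ + 1).toNat)).prod
      (paramFun G hw hν ρ (γ :: l) S x) with hR
    have h1 : ∀ t, (R : (Finset V → ℝ) → ℂ) (Function.update r γ t) =
        E * f (contract G γ x + t • ((ρ γ)⁻¹ • (x - contract G γ x))) := by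
      intro t
      have h2 := prod_jet_congr ρ (fun γ => (k γ + 1).toNat) (i := γ) (b := t) (c := E) l
        (List.nodup_cons.1 hnd).1 (paramFun G hw hν ρ (γ :: l) S x)
        (paramFun G hw hν ρ l (S ∪ edgesIn G γ) (evolve G γ (t / ρ γ) x))
        (fun r hr => by
          change paramTerm G w ν ρ (γ :: l) S x r = E * paramTerm G w ν ρ l _ _ r
          rw [paramTerm, hr]) (Function.update r γ t) (Function.update_self _ _ _)
      rw [hR, h2, ← ih _ _ _ hnd.of_cons (fun γ' h => hρ γ' (List.mem_cons_of_mem _ h)), ← hf,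
        evolve, smul_smul, div_eq_mul_inv]
    rw [List.map_cons, List.prod_cons, Module.End.mul_apply, ← hR, LinearMap.neg_apply,
      Submodule.coe_neg, Pi.neg_apply, jet_apply]
    change E * -taylor G (k γ) γ f x = _
    rw [mul_neg, taylor, Finset.mul_sum]
    congr 1
    refine Finset.sum_congr rfl fun j _ => ?_
    have h3 := congrFun (pd_pow_update γ R r j) 0
    simp only [h1] at h3
    rw [h3, iteratedDeriv_const_mul_field, iteratedDeriv_line hfs]
    simp only [zero_smul, add_zero]
    have h4 := (iteratedFDeriv ℝ j f (contract G γ x)).map_smul_univ (fun _ => (ρ γ)⁻¹)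
      (fun _ => x - contract G γ x)
    rw [h4, Finset.prod_const, Finset.card_univ, Fintype.card_fin, Complex.real_smul]
    push_cast
    rw [inv_pow]
    have : ((ρ γ : ℝ) : ℂ) ^ j ≠ 0 := pow_ne_zero _ (Complex.ofReal_ne_zero.2 hρ0)
    field_simp

end Terms

end

end BPHZ

namespace BPHZ

noncomputable section

open scoped Classical

/-! ### Bounds of derivatives up to a fixed order -/

section DerivBound

variable {E F H : Type*} [NormedAddCommGroup E] [NormedSpace ℝ E] [NormedAddCommGroup F]
  [NormedSpace ℝ F] [NormedAddCommGroup H] [NormedSpace ℝ H]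

/-- All derivatives of `f` at `r` of order at most `N` are bounded by `K`. -/
def DerivBound (N : ℕ) (f : E → F) (r : E) (K : ℝ) : Prop :=
  ∀ m ≤ N, ‖iteratedFDeriv ℝ m f r‖ ≤ K

variable {N : ℕ} {f g : E → F} {r : E} {K L : ℝ}

lemma DerivBound.nonneg (h : DerivBound N f r K) : 0 ≤ K :=
  (norm_nonneg _).trans (h 0 (Nat.zero_le _))

lemma DerivBound.norm_le (h : DerivBound N f r K) : ‖f r‖ ≤ K := by
  simpa using h 0 (Nat.zero_le _)

lemma DerivBound.mono (h : DerivBound N f r K) (hKL : K ≤ L) : DerivBound N f r L :=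
  fun m hm => (h m hm).trans hKL

lemma contDiffAt_nat (hf : ContDiff ℝ ∞ f) (m : ℕ) : ContDiffAt ℝ m f r :=
  hf.contDiffAt.of_le (by exact_mod_cast le_top)

lemma DerivBound.add (hf : ContDiff ℝ ∞ f) (hg : ContDiff ℝ ∞ g) (h : DerivBound N f r K)
    (h' : DerivBound N g r L) : DerivBound N (fun r => f r + g r) r (K + L) := by
  intro m hm
  have := iteratedFDeriv_add_apply (contDiffAt_nat (r := r) hf m) (contDiffAt_nat hg m)
  rw [show (fun r => f r + g r) = f + g from rfl, this]
  exact (norm_add_le _ _).trans (add_le_add (h m hm) (h' m hm))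

lemma DerivBound.const_smul (hf : ContDiff ℝ ∞ f) (h : DerivBound N f r K) (c : ℝ) :
    DerivBound N (fun r => c • f r) r (|c| * K) := by
  intro m hm
  have := iteratedFDeriv_const_smul_apply (a := c) (contDiffAt_nat (r := r) hf m)
  rw [show (fun r => c • f r) = c • f from rfl, this, norm_smul, Real.norm_eq_abs]
  exact mul_le_mul_of_nonneg_left (h m hm) (abs_nonneg c)

lemma DerivBound.sub (hf : ContDiff ℝ ∞ f) (hg : ContDiff ℝ ∞ g) (h : DerivBound N f r K)
    (h' : DerivBound N g r L) : DerivBound N (fun r => f r - g r) r (K + L) := by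
  have h2 := h.add hf (contDiff_const.smul hg) (h'.const_smul hg (-1))
  simpa [sub_eq_add_neg] using h2

lemma derivBound_const {c : F} (h : ‖c‖ ≤ K) : DerivBound N (fun _ : E => c) r K := by
  intro m _
  rcases Nat.eq_zero_or_pos m with rfl | hm
  · simpa using h
  · rw [iteratedFDeriv_const_of_ne hm.ne']
    simpa using (norm_nonneg c).trans h

lemma derivBound_clm (A : E →L[ℝ] F) (h0 : ‖A r‖ ≤ K) (h1 : ‖A‖ ≤ K) :
    DerivBound N (fun r => A r) r K := by
  intro m _
  rcases m with _ | m
  · simpa using h0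
  · rw [← norm_iteratedFDeriv_fderiv]
    have : fderiv ℝ (fun r => A r) = fun _ => A := by
      ext1 r; exact A.fderiv
    rw [this]
    exact derivBound_const (N := m) h1 m le_rfl

lemma DerivBound.smul {θ : E → ℝ} (hθ : ContDiff ℝ ∞ θ) (hf : ContDiff ℝ ∞ f)
    (h : DerivBound N θ r L) (h' : DerivBound N f r K) :
    DerivBound N (fun r => θ r • f r) r (2 ^ N * (L * K)) := by
  intro m hm
  refine (norm_iteratedFDeriv_smul_le hθ hf r (by exact_mod_cast le_top)).trans ?_
  have hLK : 0 ≤ L * K := mul_nonneg h.nonneg h'.nonneg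
  calc _ ≤ ∑ i ∈ Finset.range (m + 1), (m.choose i : ℝ) * (L * K) := by
        refine Finset.sum_le_sum fun i hi => ?_
        have hi := Finset.mem_range.1 hi
        rw [mul_assoc]
        exact mul_le_mul_of_nonneg_left (mul_le_mul (h i (by omega)) (h' (m - i) (by omega))
          (norm_nonneg _) h.nonneg) (Nat.cast_nonneg _)
    _ = 2 ^ m * (L * K) := by
        rw [← Finset.sum_mul, ← Nat.cast_sum, Nat.sum_range_choose]; push_cast; ring
    _ ≤ 2 ^ N * (L * K) := by gcongr; norm_num

lemma DerivBound.mul {f g : E → ℂ} (hf : ContDiff ℝ ∞ f) (hg : ContDiff ℝ ∞ g)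
    (h : DerivBound N f r L) (h' : DerivBound N g r K) :
    DerivBound N (fun r => f r * g r) r (2 ^ N * (L * K)) := by
  intro m hm
  refine (norm_iteratedFDeriv_mul_le hf hg r (by exact_mod_cast le_top)).trans ?_
  have hLK : 0 ≤ L * K := mul_nonneg h.nonneg h'.nonneg
  calc _ ≤ ∑ i ∈ Finset.range (m + 1), (m.choose i : ℝ) * (L * K) := by
        refine Finset.sum_le_sum fun i hi => ?_
        have hi := Finset.mem_range.1 hi
        rw [mul_assoc]
        exact mul_le_mul_of_nonneg_left (mul_le_mul (h i (by omega)) (h' (m - i) (by omega))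
          (norm_nonneg _) h.nonneg) (Nat.cast_nonneg _)
    _ = 2 ^ m * (L * K) := by
        rw [← Finset.sum_mul, ← Nat.cast_sum, Nat.sum_range_choose]; push_cast; ring
    _ ≤ 2 ^ N * (L * K) := by gcongr; norm_num

lemma DerivBound.prod {ι : Type*} (s : Finset ι) {f : ι → E → ℂ} {K : ι → ℝ}
    (hf : ∀ i ∈ s, ContDiff ℝ ∞ (f i)) (h : ∀ i ∈ s, DerivBound N (f i) r (K i)) :
    DerivBound N (fun r => ∏ i ∈ s, f i r) r ((2 ^ N) ^ s.card * ∏ i ∈ s, K i) := by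
  induction s using Finset.induction_on with
  | empty => simpa using derivBound_const (c := (1 : ℂ)) (by simp)
  | insert i s hi ih =>
    have h1 := (h i (Finset.mem_insert_self _ _)).mul (hf i (Finset.mem_insert_self _ _))
      (contDiff_prod fun j hj => hf j (Finset.mem_insert_of_mem hj))
      (ih (fun j hj => hf j (Finset.mem_insert_of_mem hj))
        (fun j hj => h j (Finset.mem_insert_of_mem hj)))
    simp only [Finset.prod_insert hi, Finset.card_insert_of_notMem hi]
    refine h1.mono (le_of_eq ?_)
    ring

lemma DerivBound.sum_smul {ι : Type*} (s : Finset ι) {f : ι → E → F} {wt : ι → ℝ}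
    (hf : ∀ i ∈ s, ContDiff ℝ ∞ (f i)) (h : ∀ i ∈ s, DerivBound N (f i) r K) :
    DerivBound N (fun r => ∑ i ∈ s, wt i • f i r) r ((∑ i ∈ s, |wt i|) * K) := by
  induction s using Finset.induction_on with
  | empty => simpa using derivBound_const (c := (0 : F)) (by simp)
  | insert i s hi ih =>
    have h1 := ((h i (Finset.mem_insert_self _ _)).const_smul
      (hf i (Finset.mem_insert_self _ _)) (wt i)).add
      (contDiff_const.smul (hf i (Finset.mem_insert_self _ _)))
      (ContDiff.sum fun j hj => contDiff_const.smul (hf j (Finset.mem_insert_of_mem hj)))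
      (ih (fun j hj => hf j (Finset.mem_insert_of_mem hj))
        (fun j hj => h j (Finset.mem_insert_of_mem hj)))
    simp only [Finset.sum_insert hi]
    refine h1.mono (le_of_eq ?_)
    ring

lemma DerivBound.clm_comp (hf : ContDiff ℝ ∞ f) (h : DerivBound N f r K) (A : F →L[ℝ] H)
    (hA : ‖A‖ ≤ 1) : DerivBound N (fun r => A (f r)) r K := by
  intro m hm
  refine (A.norm_iteratedFDeriv_comp_left (contDiffAt_nat (r := r) hf m) le_rfl).trans ?_
  exact (mul_le_of_le_one_left (norm_nonneg _) hA).trans (h m hm)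

/-- The chain rule at the scale `L`: each derivative of the outer function costs a factor `L⁻¹`,
and the inner function moves by at most `K * L`. -/
lemma derivBound_comp_scale {g : F → H} {f : E → F} (hg : ContDiff ℝ ∞ g) (hf : ContDiff ℝ ∞ f)
    (hL : 0 < L) {C : ℝ} (hK : 1 ≤ K) (hC : ∀ i ≤ N, ‖iteratedFDeriv ℝ i g (f r)‖ * L ^ i ≤ C)
    (hD : ∀ i, 1 ≤ i → i ≤ N → ‖iteratedFDeriv ℝ i f r‖ ≤ K * L) :
    DerivBound N (fun r => g (f r)) r (N.factorial * C * K ^ N) := by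
  have hC0 : 0 ≤ C := le_trans (by positivity) (hC 0 (Nat.zero_le _))
  intro m hm
  set A : F →L[ℝ] F := L • ContinuousLinearMap.id ℝ F with hA
  have hA1 : ‖A‖ ≤ L := by
    rw [hA, norm_smul, Real.norm_eq_abs, abs_of_pos hL]
    exact mul_le_of_le_one_right hL.le ContinuousLinearMap.norm_id_le
  have hcomp : (fun r => g (f r)) = (g ∘ A) ∘ (fun r => L⁻¹ • f r) := by
    ext r
    simp [hA, smul_smul, hL.ne']
  have hgA : ContDiff ℝ ∞ (g ∘ A) := hg.comp A.contDiff
  have hfL : ContDiff ℝ ∞ (fun r => L⁻¹ • f r) := contDiff_const.smul hf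
  rw [hcomp]
  refine (norm_iteratedFDeriv_comp_le (N := ∞) hgA hfL
    (by exact_mod_cast le_top) r (C := C) (D := K) ?_ ?_).trans ?_
  · intro i hi
    rw [A.iteratedFDeriv_comp_right hg _ (by exact_mod_cast le_top)]
    refine le_trans ?_ (hC i (hi.trans hm))
    refine (ContinuousMultilinearMap.norm_compContinuousLinearMap_le _ _).trans ?_
    have : A (L⁻¹ • f r) = f r := by simp [hA, smul_smul, hL.ne']
    rw [this, Finset.prod_const, Finset.card_univ, Fintype.card_fin]
    gcongr
  · intro i hi hi'
    have h1 := iteratedFDeriv_const_smul_apply (a := L⁻¹) (contDiffAt_nat (r := r) hf i)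
    rw [show (fun r => L⁻¹ • f r) = L⁻¹ • f from rfl, h1, norm_smul, norm_inv, Real.norm_eq_abs,
      abs_of_pos hL]
    calc L⁻¹ * ‖iteratedFDeriv ℝ i f r‖ ≤ L⁻¹ * (K * L) := by
          gcongr; exact hD i hi (hi'.trans hm)
      _ = K := by field_simp
      _ ≤ K ^ i := le_self_pow₀ hK (by omega)
  · gcongr

end DerivBound

/-! ### Derivatives of the interpolated contractions -/

section FlowBound

variable {V : Type*} [Fintype V] (G : SimpleGraph V) {d : ℕ}

lemma sum_incidence (γ : Finset V) : ∑ v ∈ γ, incidence G γ v = 2 * (edgesIn G γ).card := by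
  have h := Finset.sum_card_bipartiteAbove_eq_sum_card_bipartiteBelow (s := γ) (t := edgesIn G γ)
    (fun v e => v ∈ e)
  have h2 : ∀ e ∈ edgesIn G γ, (γ.bipartiteBelow (fun v e => v ∈ e) e).card = 2 := by
    intro e he
    obtain ⟨he1, he2⟩ := mem_edgesIn.1 he
    rw [← Sym2.card_toFinset_of_not_isDiag e (G.not_isDiag_of_mem_edgeSet he1)]
    congr 1
    ext v
    simp only [Finset.mem_bipartiteBelow, Sym2.mem_toFinset]
    exact ⟨fun h => h.2, fun h => ⟨he2 v h, h⟩⟩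
  rw [Finset.sum_congr rfl h2, Finset.sum_const, smul_eq_mul, mul_comm] at h
  exact h

/-- The weight of `v` in the mean point of `γ`. -/
def meanWeight (γ : Finset V) (v : V) : ℝ :=
  (2 * ((edgesIn G γ).card : ℝ))⁻¹ * (incidence G γ v : ℝ)

lemma meanPoint_eq (γ : Finset V) (x : Config V d) :
    meanPoint G γ x = ∑ v ∈ γ, meanWeight G γ v • x v := by
  simp [meanPoint, meanWeight, Finset.smul_sum, smul_smul]

lemma meanWeight_nonneg (γ : Finset V) (v : V) : 0 ≤ meanWeight G γ v := by
  unfold meanWeight; positivity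

variable {G}

lemma sum_meanWeight {γ : Finset V} (h : (edgesIn G γ).Nonempty) :
    ∑ v ∈ γ, meanWeight G γ v = 1 := by
  have h0 : ((edgesIn G γ).card : ℝ) ≠ 0 := by
    exact_mod_cast (Finset.card_pos.2 h).ne'
  unfold meanWeight
  rw [← Finset.mul_sum, ← Nat.cast_sum, sum_incidence]
  push_cast
  field_simp

lemma sum_abs_meanWeight {γ : Finset V} (h : (edgesIn G γ).Nonempty) :
    ∑ v ∈ γ, |meanWeight G γ v| = 1 := by
  rw [← sum_meanWeight h]
  exact Finset.sum_congr rfl fun v _ => abs_of_nonneg (meanWeight_nonneg G γ v)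

lemma meanPoint_sub_eq {γ : Finset V} (h : (edgesIn G γ).Nonempty) (x : Config V d) (p : Pt d) :
    meanPoint G γ x - p = ∑ v ∈ γ, meanWeight G γ v • (x v - p) := by
  simp only [smul_sub, Finset.sum_sub_distrib, ← Finset.sum_smul, sum_meanWeight h, one_smul,
    meanPoint_eq]

lemma norm_meanPoint_sub_le {γ : Finset V} (h : (edgesIn G γ).Nonempty) {x : Config V d}
    {p : Pt d} {K : ℝ} (hK : ∀ v ∈ γ, ‖x v - p‖ ≤ K) : ‖meanPoint G γ x - p‖ ≤ K := by
  rw [meanPoint_sub_eq h]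
  calc _ ≤ ∑ v ∈ γ, meanWeight G γ v * K := by
        refine norm_sum_le_of_le _ fun v hv => ?_
        rw [norm_smul, Real.norm_eq_abs, abs_of_nonneg (meanWeight_nonneg G γ v)]
        exact mul_le_mul_of_nonneg_left (hK v hv) (meanWeight_nonneg G γ v)
    _ = K := by rw [← Finset.sum_mul, sum_meanWeight h, one_mul]

lemma contDiff_meanPoint_sub {E : Type*} [NormedAddCommGroup E] [NormedSpace ℝ E] (γ : Finset V)
    {y : E → Config V d} (hy : ∀ w, ContDiff ℝ ∞ (fun r => y r w)) (p : Pt d) :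
    ContDiff ℝ ∞ (fun r => meanPoint G γ (y r) - p) := by
  have h : ContDiff ℝ ∞ (fun r => ∑ w ∈ γ, meanWeight G γ w • y r w) :=
    ContDiff.sum fun w _ => ContDiff.const_smul _ (hy w)
  simp only [meanPoint_eq]
  exact h.sub contDiff_const

lemma derivBound_meanPoint_sub {E : Type*} [NormedAddCommGroup E] [NormedSpace ℝ E] {N : ℕ}
    {γ : Finset V} (h : (edgesIn G γ).Nonempty) {y : E → Config V d}
    (hy : ∀ w, ContDiff ℝ ∞ (fun r => y r w)) {x : Config V d} {p : Pt d} {r : E} {K L : ℝ}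
    (hK : ∀ w ∈ γ, DerivBound N (fun r => y r w - x w) r K) (hL : ∀ w ∈ γ, ‖x w - p‖ ≤ L) :
    DerivBound N (fun r => meanPoint G γ (y r) - p) r (K + L) := by
  have hcd : ∀ w, ContDiff ℝ ∞ (fun r => y r w - x w) := fun w => (hy w).sub contDiff_const
  have h0 : ContDiff ℝ ∞ (fun r => ∑ w ∈ γ, meanWeight G γ w • (y r w - x w)) :=
    ContDiff.sum fun w _ => ContDiff.const_smul _ (hcd w)
  have h1 := (DerivBound.sum_smul (wt := meanWeight G γ) γ (fun w _ => hcd w) hK).add h0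
    contDiff_const (derivBound_const (c := meanPoint G γ x - p) (K := L)
      (norm_meanPoint_sub_le h hL))
  rw [sum_abs_meanWeight h, one_mul] at h1
  have h2 : ∀ r, meanPoint G γ (y r) - p =
      (∑ w ∈ γ, meanWeight G γ w • (y r w - x w)) + (meanPoint G γ x - p) := by
    intro r
    simp only [smul_sub, Finset.sum_sub_distrib, meanPoint_eq]
    abel
  simp only [h2]
  exact h1

/-- The sum of the scales of those members of `l` that move `v`. -/
def moveScale (lam : Finset V → ℝ) (l : List (Finset V)) (v : V) : ℝ :=
  ((l.filter (fun γ => decide (v ∈ γ))).map lam).sum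

omit [Fintype V] in
lemma moveScale_append_singleton (lam : Finset V → ℝ) (l : List (Finset V)) (γ : Finset V) (v : V) :
    moveScale lam (l ++ [γ]) v = moveScale lam l v + if v ∈ γ then lam γ else 0 := by
  unfold moveScale
  rw [List.filter_append, List.map_append, List.sum_append]
  congr 1
  by_cases h : v ∈ γ <;> simp [h]

omit [Fintype V] in
lemma moveScale_le {lam : Finset V → ℝ} {l : List (Finset V)} {v : V} {K : ℝ}
    (hK0 : 0 ≤ K) (h : ∀ γ ∈ l, v ∈ γ → lam γ ≤ K) : moveScale lam l v ≤ l.length * K := by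
  have h1 : moveScale lam l v ≤ (l.filter (fun γ => decide (v ∈ γ))).length • K := by
    unfold moveScale
    refine (List.sum_le_card_nsmul _ K fun a ha => ?_).trans (by rw [List.length_map])
    obtain ⟨γ, hγ, rfl⟩ := List.mem_map.1 ha
    rw [List.mem_filter, decide_eq_true_eq] at hγ
    exact h γ hγ.1 hγ.2
  rw [nsmul_eq_mul] at h1
  refine h1.trans (mul_le_mul_of_nonneg_right ?_ hK0)
  exact_mod_cast List.length_filter_le _ _

omit [Fintype V] in
lemma moveScale_nonneg {lam : Finset V → ℝ} {l : List (Finset V)} {v : V}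
    (h : ∀ γ ∈ l, 0 ≤ lam γ) : 0 ≤ moveScale lam l v := by
  unfold moveScale
  refine List.sum_nonneg fun a ha => ?_
  obtain ⟨γ, hγ, rfl⟩ := List.mem_map.1 ha
  exact h γ (List.mem_filter.1 hγ).1

variable (G) in
/-- The scales `del γ` of the diameter of `γ` and `lam γ` up to which the expansion about its mean
point is controlled are compatible with the configuration `x`, for all members `γ` of the list. -/
structure ScaledList (A : ℝ) (del lam : Finset V → ℝ) (l : List (Finset V)) (x : Config V d) :
    Prop where
  edges : ∀ γ ∈ l, (edgesIn G γ).Nonempty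
  pos : ∀ γ ∈ l, 0 < del γ
  le : ∀ γ ∈ l, del γ ≤ lam γ
  diam : ∀ γ ∈ l, ∀ v ∈ γ, ∀ w ∈ γ, ‖x v - x w‖ ≤ A * del γ
  nested : l.Pairwise (fun γ γ' => Disjoint γ γ' ∨ (γ ⊂ γ' ∧ lam γ ≤ del γ'))

variable {A : ℝ} {del lam : Finset V → ℝ} {l : List (Finset V)} {x : Config V d}

lemma ScaledList.lam_nonneg (h : ScaledList G A del lam l x) : ∀ γ ∈ l, 0 ≤ lam γ :=
  fun γ hγ => (h.pos γ hγ).le.trans (h.le γ hγ)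

lemma ScaledList.sublist {l' : List (Finset V)} (h : ScaledList G A del lam l x)
    (hl : l'.Sublist l) : ScaledList G A del lam l' x where
  edges γ hγ := h.edges γ (hl.subset hγ)
  pos γ hγ := h.pos γ (hl.subset hγ)
  le γ hγ := h.le γ (hl.subset hγ)
  diam γ hγ := h.diam γ (hl.subset hγ)
  nested := h.nested.sublist hl

lemma ScaledList.moveScale_le {γ : Finset V} (h : ScaledList G A del lam (l ++ [γ]) x) {v : V}
    (hv : v ∈ γ) : moveScale lam l v ≤ l.length * del γ := by
  refine BPHZ.moveScale_le (h.pos γ (by simp)).le fun γ' hγ' hv' => ?_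
  rcases (List.pairwise_append.1 h.nested).2.2 γ' hγ' γ (by simp) with h1 | h1
  · exact absurd hv (Finset.disjoint_left.1 h1 hv')
  · exact h1.2

lemma contDiff_flow (ρ : Finset V → ℝ) (l : List (Finset V)) (x : Config V d) :
    ContDiff ℝ ∞ (fun r : Finset V → ℝ => flow G ρ l r x) := by
  induction l using List.reverseRecOn with
  | nil => exact contDiff_const
  | append_singleton l γ ih =>
    simp only [flow_append_singleton, evolve]
    have h1 : ContDiff ℝ ∞ (fun r : Finset V → ℝ => contract G γ (flow G ρ l r x)) :=
      (contDiff_contract G γ).comp ih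
    exact h1.add (((contDiff_apply ℝ ℝ γ).div_const _).smul (ih.sub h1))

lemma contDiff_flow_apply (ρ : Finset V → ℝ) (l : List (Finset V)) (x : Config V d) (v : V) :
    ContDiff ℝ ∞ (fun r : Finset V → ℝ => flow G ρ l r x v) :=
  (contDiff_apply ℝ (Pt d) v).comp (contDiff_flow ρ l x)

/-- The displacement of `v` by the interpolated contractions is, together with its derivatives,
bounded by the scales of the sets that move `v`. -/
lemma exists_derivBound_flow (N : ℕ) {A : ℝ} (hA : 0 ≤ A) (l : List (Finset V)) :
    ∃ C : ℝ, 0 ≤ C ∧ ∀ (del lam ρ : Finset V → ℝ) (x : Config V d) (r : Finset V → ℝ),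
      ScaledList G A del lam l x → (∀ γ ∈ l, ρ γ = del γ / lam γ) →
      (∀ γ, 0 ≤ r γ ∧ r γ ≤ ρ γ) → ∀ v,
        DerivBound N (fun r => flow G ρ l r x v - x v) r (C * moveScale lam l v) := by
  induction l using List.reverseRecOn with
  | nil =>
    refine ⟨0, le_rfl, fun del lam ρ x r _ _ _ v => ?_⟩
    exact derivBound_const (c := x v - x v) (by simp)
  | append_singleton l γ ih =>
    obtain ⟨C, hC, hl⟩ := ih
    set K1 : ℝ := C * l.length + A with hK1
    set K2 : ℝ := C * l.length + K1 with hK2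
    have hK1' : 0 ≤ K1 := by positivity
    have hK2' : 0 ≤ K2 := by positivity
    refine ⟨C + (K1 + 2 ^ N * K2), by positivity, fun del lam ρ x r hs hρ hr v => ?_⟩
    have hs' := hs.sublist (List.sublist_append_left l [γ])
    have hl' := fun v => hl del lam ρ x r hs' (fun γ h => hρ γ (List.mem_append_left _ h)) hr v
    have hcd := fun v => (contDiff_flow_apply (G := G) ρ l x v).sub (contDiff_const (c := x v))
    rw [moveScale_append_singleton]
    simp only [flow_append_singleton]
    have hm0 : 0 ≤ moveScale lam l v := moveScale_nonneg hs'.lam_nonneg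
    by_cases hv : v ∈ γ
    · have hmem : γ ∈ l ++ [γ] := by simp
      have hdel := hs.pos γ hmem
      have hlam : 0 < lam γ := hdel.trans_le (hs.le γ hmem)
      have hρ' := hρ γ hmem
      have hρpos : 0 < ρ γ := by rw [hρ']; positivity
      have hρ1 : ρ γ ≤ 1 := by rw [hρ']; exact div_le_one_of_le₀ (hs.le γ hmem) hlam.le
      simp only [evolve_of_mem G hv, if_pos hv]
      have hq : ∀ w ∈ γ, DerivBound N (fun r => flow G ρ l r x w - x w) r
          (C * l.length * del γ) := fun w hw => (hl' w).mono (by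
        rw [mul_assoc]; exact mul_le_mul_of_nonneg_left (hs.moveScale_le hw) hC)
      have hedge := hs.edges γ hmem
      have hmean : DerivBound N (fun r => meanPoint G γ (flow G ρ l r x) - x v) r
          (K1 * del γ) := by
        refine (derivBound_meanPoint_sub hedge (contDiff_flow_apply ρ l x) hq
          (fun w hw => hs.diam γ hmem w hw v hv)).mono (le_of_eq ?_)
        rw [hK1]; ring
      have hmc : ContDiff ℝ ∞ (fun r => meanPoint G γ (flow G ρ l r x) - x v) :=
        contDiff_meanPoint_sub γ (contDiff_flow_apply ρ l x) _
      have hdiff := (hq v hv).sub (hcd v) hmc hmean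
      -- a derivative in `r γ` costs `(ρ γ)⁻¹ = lam γ / del γ`, and it acts on a vector of the order
      -- of `del γ`
      have hθ : DerivBound N (fun r : Finset V → ℝ => r γ / ρ γ) r (ρ γ)⁻¹ := by
        have h1 := derivBound_clm (N := N) (r := r) (K := (ρ γ)⁻¹)
          ((ρ γ)⁻¹ • (ContinuousLinearMap.proj γ : (Finset V → ℝ) →L[ℝ] ℝ)) ?_ ?_
        · simpa [div_eq_inv_mul] using h1
        · simp only [_root_.smul_apply, ContinuousLinearMap.proj_apply, smul_eq_mul,
            norm_mul, norm_inv, Real.norm_eq_abs, abs_of_pos hρpos, abs_of_nonneg (hr γ).1]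
          exact mul_le_of_le_one_right (by positivity) ((hr γ).2.trans hρ1)
        · rw [norm_smul, norm_inv, Real.norm_eq_abs, abs_of_pos hρpos]
          refine mul_le_of_le_one_right (by positivity) ?_
          refine ContinuousLinearMap.opNorm_le_bound _ zero_le_one fun y => ?_
          rw [one_mul]; exact norm_le_pi_norm y γ
      have hcθ : ContDiff ℝ ∞ (fun r : Finset V → ℝ => r γ / ρ γ) :=
        (contDiff_apply ℝ ℝ γ).div_const _
      have h3 := hmean.add hmc (hcθ.smul ((hcd v).sub hmc))
        (hθ.smul hcθ ((hcd v).sub hmc) hdiff)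
      have h4 : (fun r => meanPoint G γ (flow G ρ l r x) + (r γ / ρ γ) •
          (flow G ρ l r x v - meanPoint G γ (flow G ρ l r x)) - x v) = fun r =>
          (meanPoint G γ (flow G ρ l r x) - x v) + (r γ / ρ γ) •
            ((flow G ρ l r x v - x v) - (meanPoint G γ (flow G ρ l r x) - x v)) := by
        ext1 r
        rw [sub_sub_sub_cancel_right]
        abel
      rw [h4]
      refine h3.mono ?_
      have h5 : (ρ γ)⁻¹ * (C * l.length * del γ + K1 * del γ) = K2 * lam γ := by
        rw [hρ', hK2]; field_simp
      rw [h5]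
      have h6 : K1 * del γ ≤ K1 * lam γ := mul_le_mul_of_nonneg_left (hs.le γ hmem) hK1'
      have h7 : 0 ≤ C * (moveScale lam l v + lam γ) := by positivity
      have h8 : 0 ≤ (K1 + 2 ^ N * K2) * moveScale lam l v := by positivity
      linarith
    · simp only [evolve_of_notMem G hv, if_neg hv, add_zero]
      refine (hl' v).mono (mul_le_mul_of_nonneg_right ?_ hm0)
      have : 0 ≤ K1 + 2 ^ N * K2 := by positivity
      linarith

/-- Moving the parameters of sets that are small in comparison with their scale hardly changes the
configuration. -/
lemma exists_norm_flow_sub_le {A : ℝ} (hA : 0 ≤ A) (l : List (Finset V)) :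
    ∃ C : ℝ, 0 ≤ C ∧ ∀ (del lam ρ : Finset V → ℝ) (x : Config V d) (r : Finset V → ℝ)
      (T : Finset (Finset V)) (κ : ℝ), 0 ≤ κ →
      ScaledList G A del lam l x → (∀ γ ∈ l, ρ γ = del γ / lam γ) →
      r ∈ paramBox ρ T → (∀ γ ∈ l, γ ∈ T → del γ ≤ κ * lam γ) → ∀ v,
        ‖flow G ρ l r x v - flow G ρ l (fun γ => if γ ∈ T then ρ γ else 0) x v‖ ≤
          κ * (C * moveScale lam l v) := by
  induction l using List.reverseRecOn with
  | nil =>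
    refine ⟨0, le_rfl, fun del lam ρ x r T κ _ _ _ _ _ v => ?_⟩
    simp [flow]
  | append_singleton l γ ih =>
    obtain ⟨C, hC, hl⟩ := ih
    obtain ⟨C0, hC0, hl0⟩ := exists_derivBound_flow (G := G) (d := d) 0 hA l
    set K1 : ℝ := C0 * l.length + A with hK1
    set K2 : ℝ := C0 * l.length + K1 with hK2
    have hK1' : 0 ≤ K1 := by positivity
    have hK2' : 0 ≤ K2 := by positivity
    refine ⟨C + K2 + C * l.length, by positivity,
      fun del lam ρ x r T κ hκ hs hρ hr hT v => ?_⟩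
    have hs' := hs.sublist (List.sublist_append_left l [γ])
    have hρl : ∀ γ ∈ l, ρ γ = del γ / lam γ := fun γ h => hρ γ (List.mem_append_left _ h)
    have hl' := hl del lam ρ x r T κ hκ hs' hρl hr (fun γ h => hT γ (List.mem_append_left _ h))
    have hl0' := fun v => (hl0 del lam ρ x r hs' hρl (fun γ => ⟨(hr γ).1, (hr γ).2.1⟩) v).norm_le
    rw [moveScale_append_singleton, flow_append_singleton, flow_append_singleton]
    set y := flow G ρ l r x with hy
    set z := flow G ρ l (fun γ => if γ ∈ T then ρ γ else 0) x with hz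
    have hm0 : 0 ≤ moveScale lam l v := moveScale_nonneg hs'.lam_nonneg
    by_cases hv : v ∈ γ
    · have hmem : γ ∈ l ++ [γ] := by simp
      have hdel := hs.pos γ hmem
      have hlam : 0 < lam γ := hdel.trans_le (hs.le γ hmem)
      have hρ' := hρ γ hmem
      have hρpos : 0 < ρ γ := by rw [hρ']; positivity
      have hedge := hs.edges γ hmem
      have hyx : ∀ w ∈ γ, ‖y w - x w‖ ≤ C0 * l.length * del γ := fun w hw =>
        (hl0' w).trans (by
          rw [mul_assoc]; exact mul_le_mul_of_nonneg_left (hs.moveScale_le hw) hC0)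
      rw [if_pos hv, evolve_of_mem G hv]
      by_cases hγT : γ ∈ T
      · -- an almost trivial interpolation against the identity
        rw [if_pos hγT, div_self hρpos.ne', evolve_one]
        have h1 : ‖meanPoint G γ y - x v‖ ≤ K1 * del γ := by
          refine norm_meanPoint_sub_le hedge fun w hw => ?_
          calc ‖y w - x v‖ = ‖(y w - x w) + (x w - x v)‖ := by congr 1; abel
            _ ≤ C0 * l.length * del γ + A * del γ :=
              (norm_add_le _ _).trans (add_le_add (hyx w hw) (hs.diam γ hmem w hw v hv))
            _ = K1 * del γ := by rw [hK1]; ring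
        have h2 : ‖meanPoint G γ y - y v‖ ≤ K2 * del γ := by
          calc ‖meanPoint G γ y - y v‖ = ‖(meanPoint G γ y - x v) - (y v - x v)‖ := by
                congr 1; abel
            _ ≤ K1 * del γ + C0 * l.length * del γ :=
              (norm_sub_le _ _).trans (add_le_add h1 (hyx v hv))
            _ = K2 * del γ := by rw [hK2]; ring
        have hs01 : 0 ≤ r γ / ρ γ ∧ r γ / ρ γ ≤ 1 :=
          ⟨div_nonneg (hr γ).1 hρpos.le, div_le_one_of_le₀ (hr γ).2.1 hρpos.le⟩
        have h3 : meanPoint G γ y + (r γ / ρ γ) • (y v - meanPoint G γ y) - z v =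
            (1 - r γ / ρ γ) • (meanPoint G γ y - y v) + (y v - z v) := by
          rw [sub_smul, one_smul, smul_sub, smul_sub]; abel
        rw [h3]
        have h4 : ‖(1 - r γ / ρ γ) • (meanPoint G γ y - y v)‖ ≤ K2 * (κ * lam γ) := by
          rw [norm_smul, Real.norm_eq_abs, abs_of_nonneg (by linarith [hs01.2])]
          calc (1 - r γ / ρ γ) * ‖meanPoint G γ y - y v‖ ≤ 1 * (K2 * del γ) :=
                mul_le_mul (by linarith [hs01.1]) h2 (norm_nonneg _) zero_le_one
            _ ≤ K2 * (κ * lam γ) := by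
                rw [one_mul]; exact mul_le_mul_of_nonneg_left (hT γ hmem hγT) hK2'
        refine (norm_add_le _ _).trans ((add_le_add h4 (hl' v)).trans ?_)
        have h7 : 0 ≤ κ * (C * lam γ) := by positivity
        have h8 : 0 ≤ κ * (K2 * moveScale lam l v) := by positivity
        have h9 : 0 ≤ κ * (C * l.length * (moveScale lam l v + lam γ)) := by positivity
        nlinarith
      · rw [if_neg hγT, (hr γ).2.2 hγT, zero_div, evolve_of_mem G hv, zero_smul, zero_smul, add_zero,
          add_zero]
        have h1 : ‖meanPoint G γ y - meanPoint G γ z‖ ≤ κ * (C * (l.length * del γ)) := by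
          have h2 : meanPoint G γ y - meanPoint G γ z =
              meanPoint G γ (fun w => y w - z w) - 0 := by
            simp only [meanPoint_eq, smul_sub, Finset.sum_sub_distrib, sub_zero]
          rw [h2]
          refine norm_meanPoint_sub_le hedge fun w hw => ?_
          rw [sub_zero]
          exact (hl' w).trans (mul_le_mul_of_nonneg_left
            (mul_le_mul_of_nonneg_left (hs.moveScale_le hw) hC) hκ)
        refine h1.trans ?_
        have h6 : κ * (C * (l.length * del γ)) ≤ κ * (C * (l.length * lam γ)) := by
          gcongr; exact hs.le γ hmem
        have h7 : 0 ≤ κ * ((C + K2) * (moveScale lam l v + lam γ)) := by positivity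
        have h8 : 0 ≤ κ * (C * l.length * moveScale lam l v) := by positivity
        nlinarith
    · rw [evolve_of_notMem G hv, evolve_of_notMem G hv, if_neg hv, add_zero]
      refine (hl' v).trans (mul_le_mul_of_nonneg_left
        (mul_le_mul_of_nonneg_right ?_ hm0) hκ)
      have : 0 ≤ C * l.length := by positivity
      linarith

end FlowBound

end

end BPHZ

namespace BPHZ

noncomputable section

open scoped Classical

/-! ### Edge weights near the diagonal -/

section Edge

variable {d : ℕ}

lemma isOpen_offDiag : IsOpen {p : Pt d × Pt d | p.1 ≠ p.2} :=
  isOpen_ne_fun continuous_fst continuous_snd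

lemma norm_iteratedFDeriv_le_of_scaled {u : Pt d × Pt d → ℂ}
    (hu : ContDiffOn ℝ ∞ u {p | p.1 ≠ p.2}) {α l : ℝ} (hl : 0 < l) {k : ℕ} {p z : Pt d × Pt d}
    (hp : p.1 ≠ p.2) (a : Pt d) (hz : p = (a + l • z.1, a + l • z.2))
    (h : ‖iteratedFDeriv ℝ k (fun q : Pt d × Pt d =>
      ((l ^ α : ℝ) : ℂ) * u (a + l • q.1, a + l • q.2)) z‖ ≤ 1) :
    ‖iteratedFDeriv ℝ k u p‖ ≤ l ^ (-α - k) := by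
  set A : (Pt d × Pt d) ≃L[ℝ] (Pt d × Pt d) :=
    ContinuousLinearEquiv.smulLeft (Units.mk0 l hl.ne') with hA
  have hAz : ∀ z, A z = l • z := fun z => rfl
  set v : Pt d × Pt d → ℂ := fun q => u ((a, a) + q) with hv
  have hfun : (fun q : Pt d × Pt d => ((l ^ α : ℝ) : ℂ) * u (a + l • q.1, a + l • q.2)) =
      (l ^ α) • (v ∘ A) := by
    ext q
    simp only [Pi.smul_apply, Complex.real_smul, hv, Function.comp, hAz]
    rfl
  have hpz : (a, a) + A z = p := by rw [hz, hAz]; rfl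
  have hup : ContDiffAt ℝ k u ((a, a) + A z) := by
    rw [hpz]
    exact (hu.contDiffAt (isOpen_offDiag.mem_nhds hp)).of_le (by exact_mod_cast le_top)
  have hvs : ContDiffAt ℝ k v (A z) :=
    ContDiffAt.comp (A z) (f := fun q => (a, a) + q) hup (contDiffAt_const.add contDiffAt_id)
  have hvA : ContDiffAt ℝ k (v ∘ A) z := hvs.comp z A.contDiff.contDiffAt
  rw [hfun, iteratedFDeriv_const_smul_apply hvA, norm_smul, Real.norm_eq_abs,
    abs_of_pos (Real.rpow_pos_of_pos hl α)] at h
  have h1 : iteratedFDeriv ℝ k u p = iteratedFDeriv ℝ k v (A z) := by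
    rw [hv, iteratedFDeriv_comp_add_left, hpz]
  have h2 : v = (v ∘ A) ∘ A.symm := by ext q; simp
  have h3 : ‖iteratedFDeriv ℝ k v (A z)‖ ≤ ‖iteratedFDeriv ℝ k (v ∘ A) z‖ * (l⁻¹) ^ k := by
    conv_lhs => rw [h2]
    have h5 := A.symm.iteratedFDerivWithin_comp_right (v ∘ A) (s := Set.univ) (x := A z)
      uniqueDiffOn_univ (Set.mem_univ _) k
    rw [Set.preimage_univ, iteratedFDerivWithin_univ, iteratedFDerivWithin_univ,
      A.symm_apply_apply] at h5
    rw [h5]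
    refine (ContinuousMultilinearMap.norm_compContinuousLinearMap_le _ _).trans ?_
    rw [Finset.prod_const, Finset.card_univ, Fintype.card_fin]
    gcongr
    refine ContinuousLinearMap.opNorm_le_bound _ (by positivity) fun q => ?_
    have : A.symm q = l⁻¹ • q := by
      rw [ContinuousLinearEquiv.symm_apply_eq, hAz, smul_smul, mul_inv_cancel₀ hl.ne', one_smul]
    change ‖A.symm q‖ ≤ _
    rw [this, norm_smul, norm_inv, Real.norm_eq_abs, abs_of_pos hl]
  have h4 : ‖iteratedFDeriv ℝ k (v ∘ A) z‖ ≤ l ^ (-α) := by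
    rw [Real.rpow_neg hl.le, ← one_div, le_div_iff₀ (Real.rpow_pos_of_pos hl α), mul_comm]
    exact h
  rw [h1, Real.rpow_sub hl, Real.rpow_natCast, div_eq_mul_inv, ← inv_pow]
  exact h3.trans (mul_le_mul_of_nonneg_right h4 (by positivity))

/-- The scaling degree controls all derivatives at the diagonal, locally uniformly. -/
lemma exists_norm_iteratedFDeriv_le {u : Pt d × Pt d → ℂ}
    (hu : ContDiffOn ℝ ∞ u {p | p.1 ≠ p.2}) {α : ℝ} (hα : ScalesAt u α) (k : ℕ) (R : ℝ) :
    ∃ C : ℝ, 0 ≤ C ∧ ∀ p : Pt d × Pt d, p.1 ≠ p.2 → ‖p.1‖ ≤ R → ‖p.2‖ ≤ R →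
      ‖iteratedFDeriv ℝ k u p‖ ≤ C * ‖p.1 - p.2‖ ^ (-α - k) := by
  set Q : Set (Pt d × (Pt d × Pt d)) :=
    Metric.closedBall 0 R ×ˢ ({0} ×ˢ Metric.sphere 0 1) with hQ
  have hQc : IsCompact Q := (isCompact_closedBall 0 R).prod
    (isCompact_singleton.prod (isCompact_sphere 0 1))
  have hQS : Q ⊆ {q | q.2.1 ≠ q.2.2} := by
    rintro ⟨a, b, c⟩ ⟨-, hb, hc⟩ h
    simp only [Set.mem_singleton_iff] at hb
    simp only at h
    subst h hb
    simp at hc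
  have h1 := (tendstoLocallyUniformlyOn_iff_tendstoUniformlyOn_of_compact hQc).1
    ((hα k).mono hQS)
  have h2 := Metric.tendstoUniformlyOn_iff.1 h1 1 one_pos
  obtain ⟨l0, hl0, hl⟩ := (mem_nhdsGT_iff_exists_Ioo_subset).1 h2
  have hl0 : 0 < l0 := hl0
  set K : Set (Pt d × Pt d) := {p | ‖p.1‖ ≤ R ∧ ‖p.2‖ ≤ R ∧ l0 ≤ ‖p.1 - p.2‖} with hK
  have hKsub : K ⊆ {p | p.1 ≠ p.2} := by
    rintro p ⟨-, -, hp⟩ h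
    have h : p.1 = p.2 := h
    rw [h, sub_self, norm_zero] at hp
    linarith
  have hKc : IsCompact K := by
    have hcl : IsClosed K :=
      (isClosed_le continuous_fst.norm continuous_const).inter ((isClosed_le continuous_snd.norm
        continuous_const).inter (isClosed_le continuous_const
          (continuous_fst.sub continuous_snd).norm))
    refine ((isCompact_closedBall (0 : Pt d) R).prod
      (isCompact_closedBall (0 : Pt d) R)).of_isClosed_subset hcl ?_
    rintro p ⟨h1, h2, -⟩
    simp [Set.mem_prod, h1, h2]
  have hcont : ContinuousOn (fun p : Pt d × Pt d =>
      ‖iteratedFDeriv ℝ k u p‖ * ‖p.1 - p.2‖ ^ (α + k)) K := by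
    intro p hp
    have hne : p.1 - p.2 ≠ 0 := sub_ne_zero.2 (hKsub hp)
    have hs : ContDiffAt ℝ ∞ u p := hu.contDiffAt (isOpen_offDiag.mem_nhds (hKsub hp))
    have h3 : ContDiffAt ℝ 0 (iteratedFDeriv ℝ k u) p :=
      hs.iteratedFDeriv_right (by rw [zero_add]; exact_mod_cast le_top)
    refine ContinuousAt.continuousWithinAt ?_
    exact h3.continuousAt.norm.mul (ContinuousAt.rpow_const
      (continuous_fst.sub continuous_snd).norm.continuousAt (Or.inl (norm_ne_zero_iff.2 hne)))
  obtain ⟨C1, hC1⟩ := (hKc.image_of_continuousOn hcont).bddAbove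
  refine ⟨max 1 C1, le_max_of_le_left zero_le_one, fun p hp hp1 hp2 => ?_⟩
  have hpos : 0 < ‖p.1 - p.2‖ := norm_pos_iff.2 (sub_ne_zero.2 hp)
  rcases lt_or_ge (‖p.1 - p.2‖) l0 with hlt | hge
  · set l := ‖p.1 - p.2‖ with hldef
    have h3 := hl (show l ∈ Set.Ioo 0 l0 from ⟨hpos, hlt⟩) (p.1, (0, l⁻¹ • (p.2 - p.1)))
      ⟨by simpa using hp1, rfl, by
        rw [mem_sphere_zero_iff_norm, norm_smul, norm_inv, norm_sub_rev, ← hldef, hldef, norm_norm,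
          inv_mul_cancel₀ hpos.ne']⟩
    rw [dist_zero_left] at h3
    have h4 := norm_iteratedFDeriv_le_of_scaled hu hpos hp p.1 (by
      simp [smul_smul, hpos.ne']) h3.le
    refine h4.trans (le_mul_of_one_le_left (Real.rpow_nonneg hpos.le _) (le_max_left _ _))
  · have h3 : ‖iteratedFDeriv ℝ k u p‖ * ‖p.1 - p.2‖ ^ (α + k) ≤ C1 :=
      hC1 ⟨p, ⟨hp1, hp2, hge⟩, rfl⟩
    have h4 : 0 < ‖p.1 - p.2‖ ^ (α + k) := Real.rpow_pos_of_pos hpos _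
    rw [show -α - (k : ℝ) = -(α + k) by ring, Real.rpow_neg hpos.le, ← div_eq_mul_inv,
      le_div_iff₀ h4]
    exact h3.trans (le_max_right _ _)

lemma exists_norm_iteratedFDeriv_le_all {u : Pt d × Pt d → ℂ}
    (hu : ContDiffOn ℝ ∞ u {p | p.1 ≠ p.2}) {α : ℝ} (hα : ScalesAt u α) (N : ℕ) (R : ℝ) :
    ∃ C : ℝ, 0 ≤ C ∧ ∀ k ≤ N, ∀ p : Pt d × Pt d, p.1 ≠ p.2 → ‖p.1‖ ≤ R → ‖p.2‖ ≤ R →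
      ‖iteratedFDeriv ℝ k u p‖ ≤ C * ‖p.1 - p.2‖ ^ (-α - k) := by
  choose C hC0 hC using fun k => exists_norm_iteratedFDeriv_le hu hα k R
  refine ⟨∑ k ∈ Finset.range (N + 1), C k, Finset.sum_nonneg fun k _ => hC0 k,
    fun k hk p hp h1 h2 => (hC k p hp h1 h2).trans ?_⟩
  refine mul_le_mul_of_nonneg_right ?_ (Real.rpow_nonneg (norm_nonneg _) _)
  exact Finset.single_le_sum (f := C) (fun k _ => hC0 k) (Finset.mem_range.2 (by omega))

lemma exists_norm_iteratedFDeriv_le_of_contDiff {E F : Type*} [NormedAddCommGroup E]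
    [NormedSpace ℝ E] [ProperSpace E] [NormedAddCommGroup F] [NormedSpace ℝ F] {f : E → F}
    (hf : ContDiff ℝ ∞ f) (N : ℕ) (R : ℝ) :
    ∃ C : ℝ, 0 ≤ C ∧ ∀ k ≤ N, ∀ p : E, ‖p‖ ≤ R → ‖iteratedFDeriv ℝ k f p‖ ≤ C := by
  have h : ∀ k : ℕ, ∃ C : ℝ, 0 ≤ C ∧ ∀ p : E, ‖p‖ ≤ R → ‖iteratedFDeriv ℝ k f p‖ ≤ C := by
    intro k
    have hc : Continuous (fun p => ‖iteratedFDeriv ℝ k f p‖) :=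
      (hf.continuous_iteratedFDeriv (by exact_mod_cast le_top)).norm
    obtain ⟨C, hC⟩ := ((isCompact_closedBall (0 : E) R).image hc).bddAbove
    exact ⟨max 0 C, le_max_left _ _, fun p hp => le_max_of_le_right
      (hC ⟨p, by simpa using hp, rfl⟩)⟩
  choose C hC0 hC using h
  refine ⟨∑ k ∈ Finset.range (N + 1), C k, Finset.sum_nonneg fun k _ => hC0 k,
    fun k hk p hp => (hC k p hp).trans ?_⟩
  exact Finset.single_le_sum (f := C) (fun k _ => hC0 k) (Finset.mem_range.2 (by omega))

/-- A function that is smooth off the diagonal, set to zero near the diagonal by a smooth cut-off at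
the distance `η`. -/
def cutoff (η : ℝ) (w : Pt d × Pt d → ℂ) (p : Pt d × Pt d) : ℂ :=
  (Real.smoothTransition (‖p.1 - p.2‖ ^ 2 / η ^ 2 - 1)) • w p

lemma contDiff_cutoff {η : ℝ} (hη : 0 < η) {w : Pt d × Pt d → ℂ}
    (hw : ContDiffOn ℝ ∞ w {p | p.1 ≠ p.2}) : ContDiff ℝ ∞ (cutoff η w) := by
  rw [contDiff_iff_contDiffAt]
  intro p
  by_cases hp : p.1 = p.2
  · have hev : ∀ᶠ q : Pt d × Pt d in 𝓝 p, ‖q.1 - q.2‖ < η := by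
      have hc : Continuous fun q : Pt d × Pt d => ‖q.1 - q.2‖ := by fun_prop
      exact hc.continuousAt.eventually_lt continuousAt_const (by simpa [hp] using hη)
    refine (contDiffAt_const (c := (0 : ℂ))).congr_of_eventuallyEq ?_
    filter_upwards [hev] with q hq
    rw [cutoff, Real.smoothTransition.zero_of_nonpos, zero_smul]
    rw [sub_nonpos, div_le_one (by positivity)]
    gcongr
  · have h1 : ContDiff ℝ ∞ (fun q : Pt d × Pt d =>
        Real.smoothTransition (‖q.1 - q.2‖ ^ 2 / η ^ 2 - 1)) :=
      Real.smoothTransition.contDiff.comp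
        ((((contDiff_fst.sub contDiff_snd).norm_sq ℝ).div_const _).sub contDiff_const)
    exact h1.contDiffAt.smul (hw.contDiffAt (isOpen_offDiag.mem_nhds hp))

lemma eventuallyEq_cutoff {η : ℝ} (hη : 0 < η) (w : Pt d × Pt d → ℂ) {p : Pt d × Pt d}
    (hp : 2 * η ≤ ‖p.1 - p.2‖) : w =ᶠ[𝓝 p] cutoff η w := by
  have hev : ∀ᶠ q : Pt d × Pt d in 𝓝 p, 3 / 2 * η < ‖q.1 - q.2‖ := by
    have hc : Continuous fun q : Pt d × Pt d => ‖q.1 - q.2‖ := by fun_prop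
    exact continuousAt_const.eventually_lt hc.continuousAt (by linarith)
  filter_upwards [hev] with q hq
  rw [cutoff, Real.smoothTransition.one_of_one_le, one_smul]
  rw [le_sub_iff_add_le, le_div_iff₀ (by positivity)]
  nlinarith

end Edge

section Misc

variable {E F : Type*} [NormedAddCommGroup E] [NormedSpace ℝ E] [NormedAddCommGroup F]
  [NormedSpace ℝ F]

lemma DerivBound.norm_iteratedFDeriv_le {N : ℕ} {f : E → F} {p : F} {r : E} {K : ℝ}
    (hf : ContDiff ℝ ∞ f) (h : DerivBound N (fun r => f r - p) r K) {i : ℕ} (hi : 1 ≤ i)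
    (hiN : i ≤ N) : ‖iteratedFDeriv ℝ i f r‖ ≤ K := by
  have h1 : ContDiff ℝ ∞ (fun r => f r - p) := hf.sub contDiff_const
  have h2 : f = (fun r => f r - p) + (fun _ => p) := by ext r; simp
  rw [h2, iteratedFDeriv_add_apply (contDiffAt_nat h1 i) contDiffAt_const,
    iteratedFDeriv_const_of_ne (by omega)]
  simpa using h i hiN

lemma DerivBound.prodMk {N : ℕ} {f g : E → F} {r : E} {K L : ℝ} (hf : ContDiff ℝ ∞ f)
    (hg : ContDiff ℝ ∞ g) (h : DerivBound N f r K) (h' : DerivBound N g r L) :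
    DerivBound N (fun r => (f r, g r)) r (K + L) := by
  have h1 := h.clm_comp hf (ContinuousLinearMap.inl ℝ F F)
    (ContinuousLinearMap.norm_inl_le_one ℝ F F)
  have h2 := h'.clm_comp hg (ContinuousLinearMap.inr ℝ F F)
    (ContinuousLinearMap.norm_inr_le_one ℝ F F)
  have h3 := h1.add ((ContinuousLinearMap.inl ℝ F F).contDiff.comp hf)
    ((ContinuousLinearMap.inr ℝ F F).contDiff.comp hg) h2
  simpa using h3

variable {ι : Type*} [Fintype ι] [DecidableEq ι]

lemma prod_map_evalAt_apply (a : ι → ℝ) (l : List ι) (f : SmoothFun ι) (r : ι → ℝ) :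
    ((l.map (fun i => evalAt i (a i))).prod f : (ι → ℝ) → ℂ) r =
      (f : (ι → ℝ) → ℂ) (fun i => if i ∈ l then a i else r i) := by
  induction l generalizing r with
  | nil => simp
  | cons i l ih =>
    rw [List.map_cons, List.prod_cons, Module.End.mul_apply, evalAt_apply, ih]
    refine congrArg _ (funext fun j => ?_)
    by_cases h1 : j ∈ l
    · simp [h1]
    · by_cases h2 : j = i
      · subst h2; simp [h1]
      · simp [h1, h2]

end Misc

end

end BPHZ

namespace BPHZ

noncomputable section

open scoped Classical

/-! ### Configurations adapted to a rank -/

section Adapted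

variable {V : Type*} [Fintype V] {G : SimpleGraph V} {d : ℕ}

/-- Sets whose parameter has its maximal value `ρ γ` are not contracted at all and may be dropped
from the list. -/
lemma flow_eq_of_subset {ρ r : Finset V → ℝ} {l l' : List (Finset V)} {x : Config V d}
    (hl : l.Pairwise (fun a b => a.card ≤ b.card)) (hl' : l'.Pairwise (fun a b => a.card ≤ b.card))
    (hnd : l.Nodup) (hnd' : l'.Nodup) (hlam : ∀ a ∈ l, ∀ b ∈ l, ¬ Overlapping a b)
    (hρ : ∀ γ ∈ l, ρ γ ≠ 0) (hsub : ∀ γ ∈ l', γ ∈ l) (h : ∀ γ ∈ l, γ ∉ l' → r γ = ρ γ) :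
    flow G ρ l r x = flow G ρ l' r x := by
  rw [flow_filter G hρ (fun γ => decide (γ ∈ l')) (fun γ hγ hp => h γ hγ (by simpa using hp))]
  refine flow_eq_of_perm G ?_ (hl.filter _) hl' fun a ha b hb =>
    hlam a (List.mem_filter.1 ha).1 b (List.mem_filter.1 hb).1
  rw [List.perm_ext_iff_of_nodup (hnd.filter _) hnd']
  intro γ
  rw [List.mem_filter, decide_eq_true_eq]
  exact ⟨fun h => h.2, fun h => ⟨hsub γ h, h⟩⟩

/-- The rank `r` separates points and takes values below `N`. -/
structure RankData (r : V → V → ℕ) (N : ℕ) : Prop where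
  rank : IsRank r
  pos : ∀ v w, v ≠ w → 0 < r v w
  lt : ∀ v w, r v w < N
  pos_top : 0 < N

/-- The distances of the points of the configuration `x` are comparable, up to the factor `A`, with
scales `sc n` that depend on their ranks only, and distances of different ranks are separated by the
factor `κ`. -/
structure Adapted (r : V → V → ℕ) (N : ℕ) (A κ : ℝ) (sc : ℕ → ℝ) (x : Config V d) : Prop where
  mono : Monotone sc
  pos : ∀ n, 0 < sc n
  top : sc N = A
  norm_le : ∀ i j, i ≠ j → ‖x i - x j‖ ≤ A * sc (r i j)
  le_norm : ∀ i j, i ≠ j → sc (r i j) ≤ A * ‖x i - x j‖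
  gap : ∀ i j k l, i ≠ j → k ≠ l → r i j < r k l → sc (r i j) ≤ κ * sc (r k l)
  bdd : ∀ v, ‖x v‖ ≤ A

namespace GraphWeight

/-- The vertex sets on which the `R`-operation acts nontrivially. -/
def Adm (u : GraphWeight G d) (γ : Finset V) : Prop :=
  (edgesIn G γ).Nonempty ∧ 0 ≤ u.subDegree γ

end GraphWeight

variable {u : GraphWeight G d} {r : V → V → ℕ} {N : ℕ} {A κ ε : ℝ} {B : Finset (Finset V)}
  {γ : Finset V} {sc : ℕ → ℝ} {x : Config V d}

lemma exists_ne_mem_of_edgesIn_nonempty (h : (edgesIn G γ).Nonempty) :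
    ∃ a ∈ γ, ∃ b ∈ γ, a ≠ b := by
  obtain ⟨e, he⟩ := h
  have h1 := mem_edgesIn_iff_out.1 he
  exact ⟨_, h1.2.1, _, h1.2.2, (adj_out h1.1).ne⟩

lemma exists_diamRank_eq (hr : RankData r N) (h : (edgesIn G γ).Nonempty) :
    ∃ i ∈ γ, ∃ j ∈ γ, i ≠ j ∧ diamRank r γ = r i j := by
  obtain ⟨a, ha, b, hb, hab⟩ := exists_ne_mem_of_edgesIn_nonempty h
  obtain ⟨i, hi, j, hj, hij⟩ := exists_eq_diamRank (r := r) ⟨a, ha⟩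
  refine ⟨i, hi, j, hj, ?_, hij⟩
  rintro rfl
  have h1 := le_diamRank (r := r) ha hb
  have h2 := hr.pos a b hab
  rw [hij, hr.rank.self] at h1
  omega

lemma mem_bases : B ∈ bases u.Adm r ↔ ((∀ γ ∈ B, u.Adm γ) ∧ Laminar B) ∧
    Disjoint B (tight u.Adm r B) := by
  rw [bases, Finset.mem_filter, mem_admForests]

lemma adm_of_mem (hB : B ∈ bases u.Adm r) (h : γ ∈ B ∪ tight u.Adm r B) : u.Adm γ := by
  rcases Finset.mem_union.1 h with h | h
  · exact (mem_bases.1 hB).1.1 γ h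
  · exact (mem_tight.1 h).1

lemma Adapted.scaledList (hr : RankData r N) (hB : B ∈ bases u.Adm r)
    (hx : Adapted r N A κ sc x) :
    ScaledList G A (fun γ => sc (diamRank r γ)) (fun γ => sc (outerRank u.Adm r N B γ))
      (innerFirst (B ∪ tight u.Adm r B)) x where
  edges γ hγ := (adm_of_mem hB (mem_innerFirst.1 hγ)).1
  pos γ _ := hx.pos _
  le γ _ := hx.mono (diamRank_le_outerRank hr.rank hr.lt hr.pos_top)
  diam γ _ v hv w hw := by
    have hA : 0 < A := hx.top ▸ hx.pos N
    by_cases h : v = w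
    · rw [h, sub_self, norm_zero]
      exact mul_nonneg hA.le (hx.pos _).le
    · exact (hx.norm_le v w h).trans
        (mul_le_mul_of_nonneg_left (hx.mono (le_diamRank hv hw)) hA.le)
  nested := by
    have hlam := (mem_bases.1 hB).1.2
    refine (hlam.union_tight hr.rank).nested_innerFirst.imp_of_mem fun {a b} ha hb hab => ?_
    rw [mem_innerFirst] at ha hb
    refine hab.imp id fun h => ⟨h, hx.mono (outerRank_le_diamRank hr.rank hlam ha hb ?_ h)⟩
    obtain ⟨i, hi, -⟩ := exists_ne_mem_of_edgesIn_nonempty (adm_of_mem hB ha).1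
    exact ⟨i, hi⟩

lemma sep_of_notMem_edgesIn {e : Sym2 V} (he : e ∈ G.edgeSet) (h : e ∉ edgesIn G γ) {v : V}
    (hv : v ∈ e) (hvγ : v ∈ γ) : Sep γ (Quot.out e).1 (Quot.out e).2 := by
  intro h'
  rw [← mk_out e, Sym2.mem_iff] at hv
  apply h
  rw [mem_edgesIn_iff_out]
  rcases hv with rfl | rfl
  · exact ⟨he, hvγ, h'.1 hvγ⟩
  · exact ⟨he, h'.2 hvγ, hvγ⟩

/-- After contraction of the members of `B` that do not contain the edge, the length of the edge is
not smaller than the scale of its forest rank. -/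
lemma exists_le_norm_contractAll (hr : RankData r N) (hA : 1 ≤ A) (hε : 0 < ε)
    (hB : B ∈ bases u.Adm r) {e : Sym2 V} (he : e ∈ G.edgeSet) :
    ∃ c > 0, ∀ᶠ κ in 𝓝[>] (0 : ℝ), ∀ (sc : ℕ → ℝ) (x : Config V d), Adapted r N A κ sc x →
      x ∈ u.nonExceptional ε → c * sc (edgeRank (forestRank r B) e) ≤
        ‖(ends (contractAll G (B.filter (fun γ => e ∉ edgesIn G γ)) x) e).1 -
          (ends (contractAll G (B.filter (fun γ => e ∉ edgesIn G γ)) x) e).2‖ := by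
  set Be := B.filter (fun γ => e ∉ edgesIn G γ) with hBe
  obtain ⟨hBa, hBd⟩ := mem_bases.1 hB
  have hA0 : 0 < A := by linarith
  obtain ⟨C, hC0, hC⟩ := exists_derivBound_flow (V := V) (G := G) (d := d) 0 hA0.le (innerFirst Be)
  set v := (Quot.out e).1 with hv
  set w := (Quot.out e).2 with hw
  have hvw : G.Adj v w := adj_out he
  have hve : v ∈ e := Sym2.out_fst_mem e
  have hwe : w ∈ e := Sym2.out_snd_mem e
  set n := (innerFirst Be).length with hn
  refine ⟨min (ε / A) (1 / (2 * A)), by positivity, ?_⟩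
  have hev : ∀ᶠ κ in 𝓝[>] (0 : ℝ), κ * (2 * C * n) < 1 / (2 * A) := by
    have hc : Tendsto (fun κ : ℝ => κ * (2 * C * n)) (𝓝[>] 0) (𝓝 (0 * (2 * C * n))) :=
      (tendsto_nhdsWithin_of_tendsto_nhds tendsto_id).mul_const _
    rw [zero_mul] at hc
    exact hc.eventually_lt_const (by positivity)
  filter_upwards [hev, self_mem_nhdsWithin] with κ hκ hκ0 sc x hx hxN
  change min (ε / A) (1 / (2 * A)) * sc (forestRank r B v w) ≤
    ‖contractAll G Be x v - contractAll G Be x w‖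
  have hBeF : Be ∈ forests G := by
    rw [forests, Finset.mem_filter]
    exact ⟨Finset.mem_univ _, fun γ hγ => (hBa.1 γ (Finset.mem_filter.1 hγ).1).1,
      fun γ hγ γ' hγ' => hBa.2 γ (Finset.mem_filter.1 hγ).1 γ' (Finset.mem_filter.1 hγ').1⟩
  have hnot : ∀ γ ∈ Be, ¬ (v ∈ γ ∧ w ∈ γ) := fun γ hγ h =>
    (Finset.mem_filter.1 hγ).2 (mem_edgesIn_iff_out.2 ⟨he, h⟩)
  have hsc := hx.pos (forestRank r B v w)
  -- Either the forest rank is attained by a contracted set that contains one end of the edge, and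
  -- the configuration being non-exceptional gives the bound; or all such sets are much smaller than
  -- the distance of the ends, and their contraction does not change this distance much.
  by_cases hcase : ∃ γ ∈ B, Sep γ v w ∧ diamRank r γ = forestRank r B v w
  · obtain ⟨γ, hγB, hsep, hγ⟩ := hcase
    have hγe : γ ∈ Be := Finset.mem_filter.2 ⟨hγB, fun h =>
      hsep (by have := (mem_edgesIn_iff_out.1 h).2; tauto)⟩
    obtain ⟨i, hi, j, hj, hij, hd⟩ := exists_diamRank_eq hr (hBa.1 γ hγB).1
    have h1 : ε * ‖x i - x j‖ ≤ ‖contractAll G Be x v - contractAll G Be x w‖ := by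
      by_cases hvγ : v ∈ γ
      · exact hxN Be hBeF (fun γ hγ => (hBa.1 γ (Finset.mem_filter.1 hγ).1).2) v w hvw hnot γ hγe
          hvγ i hi j hj
      · rw [norm_sub_rev (contractAll G Be x v)]
        exact hxN Be hBeF (fun γ hγ => (hBa.1 γ (Finset.mem_filter.1 hγ).1).2) w v hvw.symm
          (fun γ hγ h => hnot γ hγ h.symm) γ hγe (by unfold Sep at hsep; tauto) i hi j hj
    refine (mul_le_mul_of_nonneg_right (min_le_left _ _) hsc.le).trans (le_trans ?_ h1)
    rw [← hγ, hd, div_mul_eq_mul_div, div_le_iff₀ hA0, mul_assoc, mul_comm _ A]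
    exact mul_le_mul_of_nonneg_left (hx.le_norm i j hij) hε.le
  · push Not at hcase
    have hlt : ∀ γ ∈ B, Sep γ v w → diamRank r γ < forestRank r B v w := fun γ hγ hs =>
      lt_of_le_of_ne (diamRank_le_forestRank hγ hs) (hcase γ hγ hs)
    have hrvw : forestRank r B v w = r v w := by
      refine le_antisymm ?_ le_forestRank
      by_contra hlt'
      have h2 : forestRank r B v w ≤ forestRank r B v w - 1 := by
        rw [forestRank_le_iff]
        exact ⟨by omega, fun γ hγ hs => by have := hlt γ hγ hs; omega⟩
      omega
    have hscale := (hx.scaledList (G := G) (u := u) hr hB)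
    have hlist : ScaledList G A (fun γ => sc (diamRank r γ))
        (fun γ => sc (outerRank u.Adm r N B γ)) (innerFirst Be) x := by
      refine ⟨fun γ hγ => hscale.edges γ ?_, fun γ _ => hx.pos _, fun γ hγ => hscale.le γ ?_,
        fun γ hγ => hscale.diam γ ?_, ?_⟩
      any_goals exact mem_innerFirst.2 (Finset.mem_union_left _
        (Finset.mem_filter.1 (mem_innerFirst.1 hγ)).1)
      have hlam : Laminar Be := fun γ hγ γ' hγ' => hBa.2 γ (Finset.mem_filter.1 hγ).1 γ'
        (Finset.mem_filter.1 hγ').1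
      refine hlam.nested_innerFirst.imp_of_mem fun {a b} ha hb hab => ?_
      have ha' := (Finset.mem_filter.1 (mem_innerFirst.1 ha)).1
      have hb' := (Finset.mem_filter.1 (mem_innerFirst.1 hb)).1
      refine hab.imp id fun h => ⟨h, hx.mono (outerRank_le_diamRank hr.rank hBa.2
        (Finset.mem_union_left _ ha') (Finset.mem_union_left _ hb') ?_ h)⟩
      obtain ⟨i, hi, -⟩ := exists_ne_mem_of_edgesIn_nonempty (hBa.1 a ha').1
      exact ⟨i, hi⟩
    have hmove : ∀ z ∈ e, ‖contractAll G Be x z - x z‖ ≤ C * (n * (κ * sc (r v w))) := by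
      intro z hz
      have h3 := (hC _ _ (fun γ => sc (diamRank r γ) / sc (outerRank u.Adm r N B γ)) x
        (fun _ => 0) hlist (fun _ _ => rfl)
        (fun γ => ⟨le_rfl, (div_pos (hx.pos _) (hx.pos _)).le⟩) z).norm_le
      rw [flow_eq_foldl_contract G (fun _ _ => rfl)] at h3
      refine h3.trans (mul_le_mul_of_nonneg_left (moveScale_le
        (mul_nonneg (le_of_lt hκ0) (hx.pos _).le) fun γ hγ hzγ => ?_) hC0)
      have hγ' := Finset.mem_filter.1 (mem_innerFirst.1 hγ)
      have hs := hlt γ hγ'.1 (sep_of_notMem_edgesIn he hγ'.2 hz hzγ)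
      have hout : outerRank u.Adm r N B γ = diamRank r γ := by
        rw [outerRank, if_neg (Finset.disjoint_left.1 hBd hγ'.1)]
      obtain ⟨i, -, j, -, hij, hd⟩ := exists_diamRank_eq hr (hBa.1 γ hγ'.1).1
      rw [hout, hd]
      rw [hd, hrvw] at hs
      exact hx.gap i j v w hij hvw.ne hs
    have h4 : sc (r v w) / A ≤ ‖x v - x w‖ := by
      rw [div_le_iff₀ hA0, mul_comm]
      exact hx.le_norm v w hvw.ne
    have h5 : ‖x v - x w‖ ≤ ‖contractAll G Be x v - contractAll G Be x w‖ +
        (‖contractAll G Be x v - x v‖ + ‖contractAll G Be x w - x w‖) := by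
      have : x v - x w = (contractAll G Be x v - contractAll G Be x w) -
        ((contractAll G Be x v - x v) - (contractAll G Be x w - x w)) := by abel
      rw [this]
      exact (norm_sub_le _ _).trans (add_le_add le_rfl (norm_sub_le _ _))
    have h6 := hmove v hve
    have h7 := hmove w hwe
    rw [hrvw] at hsc ⊢
    have h8 : κ * (2 * C * n) * sc (r v w) ≤ 1 / (2 * A) * sc (r v w) :=
      mul_le_mul_of_nonneg_right hκ.le hsc.le
    have h9 : sc (r v w) / A = 1 / (2 * A) * sc (r v w) + 1 / (2 * A) * sc (r v w) := by
      field_simp; ring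
    have h10 : min (ε / A) (1 / (2 * A)) * sc (r v w) ≤ 1 / (2 * A) * sc (r v w) :=
      mul_le_mul_of_nonneg_right (min_le_right _ _) hsc.le
    nlinarith

/-- The length of an edge stays above the scale of its forest rank on the whole parameter box. -/
lemma exists_le_norm_ends (hr : RankData r N) (hA : 1 ≤ A) (hε : 0 < ε)
    (hB : B ∈ bases u.Adm r) {e : Sym2 V} (he : e ∈ G.edgeSet) :
    ∃ c > 0, ∀ᶠ κ in 𝓝[>] (0 : ℝ), ∀ (sc : ℕ → ℝ) (x : Config V d), Adapted r N A κ sc x →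
      x ∈ u.nonExceptional ε → ∀ (ρ : Finset V → ℝ),
      (∀ γ, ρ γ = sc (diamRank r γ) / sc (outerRank u.Adm r N B γ)) →
      ∀ s ∈ paramBox ρ (tight u.Adm r B),
        c * sc (edgeRank (forestRank r B) e) ≤
        ‖(ends (flow G ρ (movers G (innerFirst (B ∪ tight u.Adm r B)) e) s x) e).1 -
          (ends (flow G ρ (movers G (innerFirst (B ∪ tight u.Adm r B)) e) s x) e).2‖ := by
  set T := tight u.Adm r B with hT
  obtain ⟨hBa, hBd⟩ := mem_bases.1 hB
  have hA0 : 0 < A := by linarith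
  obtain ⟨c, hc, hev⟩ := exists_le_norm_contractAll hr hA hε hB he
  set l := movers G (innerFirst (B ∪ T)) e with hl
  obtain ⟨C, hC0, hC⟩ := exists_norm_flow_sub_le (V := V) (G := G) (d := d) hA0.le l
  have hev2 : ∀ᶠ κ in 𝓝[>] (0 : ℝ), κ * (2 * C * l.length) < c / 2 := by
    have hc' : Tendsto (fun κ : ℝ => κ * (2 * C * l.length)) (𝓝[>] 0)
        (𝓝 (0 * (2 * C * l.length))) :=
      (tendsto_nhdsWithin_of_tendsto_nhds tendsto_id).mul_const _
    rw [zero_mul] at hc'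
    exact hc'.eventually_lt_const (by positivity)
  refine ⟨c / 2, by positivity, ?_⟩
  filter_upwards [hev, hev2, self_mem_nhdsWithin] with κ hκ1 hκ2 hκ0 sc x hx hxN ρ hρ s hs
  have h1 := hκ1 sc x hx hxN
  have hlam : Laminar (B ∪ T) := hBa.2.union_tight hr.rank
  have hmem : ∀ γ ∈ l, γ ∈ B ∪ T ∧ e ∉ edgesIn G γ := fun γ hγ => by
    have := List.mem_filter.1 hγ
    exact ⟨mem_innerFirst.1 this.1, by simpa using this.2⟩
  -- at this corner of the box the tight sets are not contracted and those of `B` are contracted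
  -- completely
  have hbase : flow G ρ l (fun γ => if γ ∈ T then ρ γ else 0) x =
      contractAll G (B.filter (fun γ => e ∉ edgesIn G γ)) x := by
    rw [contractAll, ← flow_eq_foldl_contract G (ρ := ρ)
      (r := fun γ => if γ ∈ T then ρ γ else 0) (fun γ hγ => ?_)]
    · refine flow_eq_of_subset ((innerFirst_sorted _).filter _) (innerFirst_sorted _)
        ((innerFirst_nodup _).filter _) (innerFirst_nodup _)
        (fun a ha b hb => hlam a (hmem a ha).1 b (hmem b hb).1)
        (fun γ _ => by rw [hρ]; exact (div_pos (hx.pos _) (hx.pos _)).ne') (fun γ hγ => ?_)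
        (fun γ hγ hγ' => if_pos ?_)
      · have h2 := Finset.mem_filter.1 (mem_innerFirst.1 hγ)
        exact List.mem_filter.2 ⟨mem_innerFirst.2 (Finset.mem_union_left _ h2.1), by simpa using h2.2⟩
      · have h2 := hmem γ hγ
        refine (Finset.mem_union.1 h2.1).resolve_left fun h3 => hγ' ?_
        exact mem_innerFirst.2 (Finset.mem_filter.2 ⟨h3, h2.2⟩)
    · exact if_neg (Finset.disjoint_left.1 hBd (Finset.mem_filter.1 (mem_innerFirst.1 hγ)).1)
  have hgap : ∀ γ ∈ l, γ ∈ T → sc (diamRank r γ) ≤ κ * sc (outerRank u.Adm r N B γ) := by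
    intro γ hγ hγT
    have hne := (adm_of_mem hB (hmem γ hγ).1).1
    obtain ⟨a, ha, -⟩ := exists_ne_mem_of_edgesIn_nonempty hne
    obtain ⟨i, -, j, -, hij, hd⟩ := exists_diamRank_eq hr hne
    have hlt := diamRank_lt_outerRank (N := N) hr.rank hr.lt hr.pos_top hγT
    -- the outer rank of `γ` is a rank of a distance since `γ ≠ univ`, as `univ` contains the edge
    obtain ⟨i', j', hij', ho⟩ := exists_eq_outerRank hr.rank hr.pos hr.lt hγT ⟨a, ha⟩ (by
      rintro rfl
      exact (hmem _ hγ).2 (mem_edgesIn.2 ⟨he, fun _ _ => Finset.mem_univ _⟩))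
    rw [ho, hd] at hlt ⊢
    exact hx.gap _ _ _ _ hij hij' hlt
  have hdiff : ∀ z ∈ e, ‖flow G ρ l s x z - contractAll G
      (B.filter (fun γ => e ∉ edgesIn G γ)) x z‖ ≤
        κ * (C * (l.length * sc (edgeRank (forestRank r B) e))) := by
    intro z hz
    have h2 := hC _ _ ρ x s T κ (le_of_lt hκ0) ((hx.scaledList hr hB).sublist List.filter_sublist)
      (fun γ _ => hρ γ) hs hgap z
    rw [hbase] at h2
    refine h2.trans (mul_le_mul_of_nonneg_left (mul_le_mul_of_nonneg_left (moveScale_le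
      (hx.pos _).le fun γ hγ hzγ => hx.mono ?_) hC0) (le_of_lt hκ0))
    exact outerRank_le_forestRank hr.rank (hmem γ hγ).1
      (sep_of_notMem_edgesIn he (hmem γ hγ).2 hz hzγ)
  have h3 := hdiff _ (Sym2.out_fst_mem e)
  have h4 := hdiff _ (Sym2.out_snd_mem e)
  unfold ends at h1 ⊢
  dsimp only at h1 ⊢
  have h5 := norm_sub_le_norm_sub_add_norm_sub (contractAll G (B.filter (fun γ => e ∉ edgesIn G γ))
    x (Quot.out e).1) (flow G ρ l s x (Quot.out e).1) (contractAll G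
      (B.filter (fun γ => e ∉ edgesIn G γ)) x (Quot.out e).2)
  have h6 := norm_sub_le_norm_sub_add_norm_sub (flow G ρ l s x (Quot.out e).1)
    (flow G ρ l s x (Quot.out e).2) (contractAll G
      (B.filter (fun γ => e ∉ edgesIn G γ)) x (Quot.out e).2)
  rw [norm_sub_rev] at h3
  have h8 : κ * (2 * C * l.length) * sc (edgeRank (forestRank r B) e) ≤
      c / 2 * sc (edgeRank (forestRank r B) e) :=
    mul_le_mul_of_nonneg_right hκ2.le (hx.pos _).le
  nlinarith

end Adapted

end

end BPHZ

namespace BPHZ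

noncomputable section

open scoped Classical

/-! ### The bound for a group of forests -/

section Group

variable {V : Type*} [Fintype V] {G : SimpleGraph V} {d : ℕ}

lemma commute_neg_right {M : Type*} [AddCommGroup M] [Module ℂ M] {S T : Module.End ℂ M}
    (h : Commute S T) : Commute S (-T) := by
  refine LinearMap.ext fun f => ?_
  have h1 := LinearMap.congr_fun h.eq f
  rw [Module.End.mul_apply, Module.End.mul_apply] at h1
  rw [Module.End.mul_apply, Module.End.mul_apply, LinearMap.neg_apply, LinearMap.neg_apply,
    map_neg, h1]

/-- Removing sets from the forest amounts to setting their parameters to the maximal value. -/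
lemma paramFun_eq_prod_evalAt {w : Sym2 V → Pt d × Pt d → ℂ} {ν : V → Pt d → ℂ}
    (hw : ∀ e, ContDiff ℝ ∞ (w e)) (hν : ∀ v, ContDiff ℝ ∞ (ν v)) {ρ : Finset V → ℝ}
    (hρ : ∀ γ, ρ γ ≠ 0) {F F' : Finset (Finset V)} (hF : Laminar F) (hsub : F' ⊆ F)
    (x : Config V d) :
    paramFun G hw hν ρ (innerFirst F') ∅ x =
      (((F \ F').toList.map (fun γ => evalAt γ (ρ γ))).prod
        (paramFun G hw hν ρ (innerFirst F) ∅ x)) := by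
  refine Subtype.ext (funext fun s => ?_)
  rw [prod_map_evalAt_apply]
  set s' : Finset V → ℝ := fun γ => if γ ∈ (F \ F').toList then ρ γ else s γ with hs'
  have hs0 : ∀ γ ∈ F', s' γ = s γ := fun γ hγ => by simp [hs', hγ]
  have hs1 : ∀ γ ∈ F, γ ∉ F' → s' γ = ρ γ := fun γ hγ hγ' => by simp [hs', hγ, hγ']
  have hF' : Laminar F' := fun γ hγ γ' hγ' => hF γ (hsub hγ) γ' (hsub hγ')
  have key : ∀ p : Finset V → Bool, flow G ρ ((innerFirst F').filter p) s x =
      flow G ρ ((innerFirst F).filter p) s' x := by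
    intro p
    rw [flow_congr G (r := s) (r' := s') fun γ hγ =>
      (hs0 γ (mem_innerFirst.1 (List.mem_filter.1 hγ).1)).symm]
    refine (flow_eq_of_subset ((innerFirst_sorted _).filter _) ((innerFirst_sorted _).filter _)
        ((innerFirst_nodup _).filter _) ((innerFirst_nodup _).filter _)
        (fun a ha b hb => hF a ?_ b ?_) (fun γ _ => hρ γ) (fun γ hγ => ?_)
        (fun γ hγ hγ' => hs1 γ ?_ fun h => hγ' ?_)).symm
    · exact mem_innerFirst.1 (List.mem_filter.1 ha).1
    · exact mem_innerFirst.1 (List.mem_filter.1 hb).1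
    · have h := List.mem_filter.1 hγ
      exact List.mem_filter.2 ⟨mem_innerFirst.2 (hsub (mem_innerFirst.1 h.1)), h.2⟩
    · exact mem_innerFirst.1 (List.mem_filter.1 hγ).1
    · exact List.mem_filter.2 ⟨mem_innerFirst.2 h, (List.mem_filter.1 hγ).2⟩
  change paramTerm G w ν ρ (innerFirst F') ∅ x s = paramTerm G w ν ρ (innerFirst F) ∅ x s'
  rw [paramTerm_eq G w ν hF'.nested_innerFirst, paramTerm_eq G w ν hF.nested_innerFirst]
  have h1 := key (fun _ => true)
  rw [List.filter_true, List.filter_true] at h1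
  rw [h1]
  refine congrArg (· * _) (Finset.prod_congr rfl fun e _ => ?_)
  rw [movers, movers, key]

/-- The forests that differ from the base `B` by tight members add up to a single product of Taylor
operators, in which every tight `γ` contributes a Taylor remainder. -/
lemma sum_forestTerm_eq (u : GraphWeight G d) {B T : Finset (Finset V)} (hlam : Laminar (B ∪ T))
    (hBT : Disjoint B T) {w : Sym2 V → Pt d × Pt d → ℂ} (hw : ∀ e, ContDiff ℝ ∞ (w e))
    {ρ : Finset V → ℝ} (hρ : ∀ γ, 0 < ρ γ) (x : Config V d)
    (hgerm : ∀ e ∈ G.edgeSet, ∀ s ∈ paramBox ρ T,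
      u.edge e =ᶠ[𝓝 (ends (flow G ρ (movers G (innerFirst (B ∪ T)) e) s x) e)] w e) :
    ∑ X ∈ T.powerset, u.forestTerm (innerFirst (B ∪ X)) ∅ x =
      (((innerFirst (B ∪ T)).map (fun γ => if γ ∈ T then
        -jet γ (ρ γ) (u.subDegree γ + 1).toNat + evalAt γ (ρ γ)
        else -jet γ (ρ γ) (u.subDegree γ + 1).toNat)).prod
          (paramFun G hw u.vertex_smooth ρ (innerFirst (B ∪ T)) ∅ x) :
            (Finset V → ℝ) → ℂ) 0 := by
  set m := innerFirst (B ∪ T) with hm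
  set Φ := paramFun G hw u.vertex_smooth ρ m ∅ x with hΦ
  have hterm : ∀ X ∈ T.powerset, u.forestTerm (innerFirst (B ∪ X)) ∅ x =
      ((m.map (fun γ => if γ ∈ T ∧ γ ∉ X then evalAt γ (ρ γ) else
        -jet γ (ρ γ) (u.subDegree γ + 1).toNat)).prod Φ : (Finset V → ℝ) → ℂ) 0 := by
    intro X hX
    rw [Finset.mem_powerset] at hX
    have hsub : B ∪ X ⊆ B ∪ T := Finset.union_subset_union subset_rfl hX
    have hlam' : Laminar (B ∪ X) := fun γ hγ γ' hγ' => hlam γ (hsub hγ) γ' (hsub hγ')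
    have hgood : EdgesGood G (fun e p => u.edge e =ᶠ[𝓝 p] w e) (innerFirst (B ∪ X)) ∅ x := by
      refine edgesGood_of_forall G hlam'.nested_innerFirst fun e he => ?_
      rw [Finset.sdiff_empty, mem_allEdges] at he
      set s : Finset V → ℝ := fun γ => if γ ∈ T \ X then ρ γ else 0 with hs
      have h1 := hgerm e he s (fun γ => by
        by_cases h : γ ∈ T \ X
        · simp only [hs, if_pos h]
          exact ⟨(hρ γ).le, le_rfl, fun h' => absurd (Finset.mem_sdiff.1 h).1 h'⟩
        · simp only [hs, if_neg h]
          exact ⟨le_rfl, (hρ γ).le, fun _ => trivial⟩)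
      convert h1 using 4
      rw [← flow_eq_foldl_contract G (ρ := ρ) (r := s) fun γ hγ => ?_]
      · refine (flow_eq_of_subset ((innerFirst_sorted _).filter _)
          ((innerFirst_sorted _).filter _) ((innerFirst_nodup _).filter _)
          ((innerFirst_nodup _).filter _) (fun a ha b hb => hlam a ?_ b ?_) (fun γ _ => (hρ γ).ne')
          (fun γ hγ => ?_) (fun γ hγ hγ' => ?_)).symm
        · exact mem_innerFirst.1 (List.mem_filter.1 ha).1
        · exact mem_innerFirst.1 (List.mem_filter.1 hb).1
        · have h := List.mem_filter.1 hγ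
          exact List.mem_filter.2 ⟨mem_innerFirst.2 (hsub (mem_innerFirst.1 h.1)), h.2⟩
        · have h := List.mem_filter.1 hγ
          refine if_pos ?_
          have h2 : γ ∉ B ∪ X := fun h2 => hγ' (List.mem_filter.2 ⟨mem_innerFirst.2 h2, h.2⟩)
          have h3 := mem_innerFirst.1 h.1
          rw [Finset.mem_union] at h2 h3
          rw [Finset.mem_sdiff]
          tauto
      · have h := mem_innerFirst.1 (List.mem_filter.1 hγ).1
        refine if_neg fun h2 => ?_
        rw [Finset.mem_sdiff] at h2
        rcases Finset.mem_union.1 h with h | h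
        · exact Finset.disjoint_left.1 hBT h h2.1
        · exact h2.2 h
    rw [forestTerm_eq_termOf, (termOf_congr hgood).self_of_nhds,
      termOf_eq_jets hw u.vertex_smooth ∅ x 0 (innerFirst_nodup _) (fun γ _ => (hρ γ).ne'),
      paramFun_eq_prod_evalAt hw u.vertex_smooth (fun γ => (hρ γ).ne') hlam hsub, ← hΦ,
      ← Module.End.mul_apply]
    -- the operator of a tight set outside `X` is the evaluation at `ρ γ`; all operators commute, so
    -- that they may be put into the order of `B ∪ T`
    set f : Finset V → Module.End ℂ (SmoothFun (Finset V)) := fun γ =>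
      if γ ∈ T ∧ γ ∉ X then evalAt γ (ρ γ) else -jet γ (ρ γ) (u.subDegree γ + 1).toNat with hf
    have h1 : (innerFirst (B ∪ X)).map (fun γ => -jet γ (ρ γ) (u.subDegree γ + 1).toNat) =
        (innerFirst (B ∪ X)).map f := List.map_congr_left fun γ hγ => by
      rw [hf]
      dsimp only
      rw [if_neg]
      rintro ⟨h1, h2⟩
      rcases Finset.mem_union.1 (mem_innerFirst.1 hγ) with h | h
      · exact Finset.disjoint_left.1 hBT h h1
      · exact h2 h
    have h2 : ((B ∪ T) \ (B ∪ X)).toList.map (fun γ => evalAt γ (ρ γ)) =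
        ((B ∪ T) \ (B ∪ X)).toList.map f := List.map_congr_left fun γ hγ => by
      rw [hf]
      dsimp only
      rw [if_pos]
      simp only [Finset.mem_toList, Finset.mem_sdiff, Finset.mem_union] at hγ
      tauto
    have hcomm : ∀ a b, a ≠ b → Commute (f a) (f b) := by
      intro a b hab
      have e1 := evalAt_commute hab (ρ a) (ρ b)
      have e2 := evalAt_commute_jet hab (ρ b) (ρ a) (u.subDegree b + 1).toNat
      have e3 := (evalAt_commute_jet hab.symm (ρ a) (ρ b) (u.subDegree a + 1).toNat).symm
      have e4 := jet_commute hab (ρ a) (ρ b) (u.subDegree a + 1).toNat (u.subDegree b + 1).toNat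
      simp only [hf]
      split_ifs
      · exact e1
      · exact commute_neg_right e2
      · exact (commute_neg_right e3.symm).symm
      · exact (commute_neg_right (commute_neg_right e4).symm).symm
    rw [h1, h2, ← List.prod_append, ← List.map_append]
    have hperm : (innerFirst (B ∪ X) ++ ((B ∪ T) \ (B ∪ X)).toList).Perm m := by
      rw [List.perm_ext_iff_of_nodup _ (innerFirst_nodup _)]
      · intro γ
        rw [List.mem_append, mem_innerFirst, mem_innerFirst, Finset.mem_toList, Finset.mem_sdiff]
        constructor
        · rintro (h | h)
          · exact hsub h
          · exact h.1
        · tauto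
      · rw [List.nodup_append]
        refine ⟨innerFirst_nodup _, Finset.nodup_toList _, ?_⟩
        rintro a ha b hb rfl
        rw [Finset.mem_toList, Finset.mem_sdiff] at hb
        exact hb.2 (mem_innerFirst.1 ha)
    rw [(hperm.map f).prod_eq']
    rw [List.pairwise_map]
    exact (hperm.nodup_iff.2 (innerFirst_nodup _)).imp fun h => hcomm _ _ h
  rw [Finset.sum_congr rfl hterm]
  have h1 := sum_powerset_prod_map (fun γ => -jet γ (ρ γ) (u.subDegree γ + 1).toNat)
    (fun γ => evalAt γ (ρ γ)) m T (innerFirst_nodup _)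
    (fun γ hγ => mem_innerFirst.2 (Finset.mem_union_right _ hγ))
  rw [← h1, LinearMap.sum_apply, Submodule.coe_sum, Finset.sum_apply]

end Group

end

end BPHZ

namespace BPHZ

noncomputable section

open scoped Classical

section GroupBound

variable {V : Type*} [Fintype V] {G : SimpleGraph V} {d : ℕ} {u : GraphWeight G d}
  {r : V → V → ℕ} {N : ℕ} {A κ ε : ℝ} {B : Finset (Finset V)} {γ : Finset V} {sc : ℕ → ℝ}
  {x : Config V d}

lemma outerRank_le (hr : RankData r N) : outerRank u.Adm r N B γ ≤ N := by
  unfold outerRank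
  split_ifs
  · exact Finset.min'_le _ _ (Finset.mem_insert_self _ _)
  · exact diamRank_le fun v _ w _ => (hr.lt v w).le

omit [Fintype V] in
lemma forestRank_lt (hr : RankData r N) {v w : V} (h : v ≠ w) : forestRank r B v w < N := by
  obtain ⟨i, j, -, hij⟩ := exists_eq_forestRank (F := B) h hr.pos hr.rank
  rw [hij]
  exact hr.lt i j

/-- On the parameter box, the weight of an edge and all its derivatives with respect to the
parameters are of the order of the weight at the scale of the forest rank. -/
lemma exists_derivBound_edge (hr : RankData r N) (hA : 1 ≤ A) (hε : 0 < ε)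
    (hB : B ∈ bases u.Adm r) (M : ℕ) {e : Sym2 V} (he : e ∈ G.edgeSet) {α : ℝ} (hα0 : 0 < α)
    (hα : ScalesAt (u.edge e) α) :
    ∃ c > 0, ∃ C : ℝ, 0 ≤ C ∧ ∀ᶠ κ in 𝓝[>] (0 : ℝ), ∀ (sc : ℕ → ℝ) (x : Config V d),
      Adapted r N A κ sc x → x ∈ u.nonExceptional ε → ∀ (ρ : Finset V → ℝ),
      (∀ γ, ρ γ = sc (diamRank r γ) / sc (outerRank u.Adm r N B γ)) →
      ∀ s ∈ paramBox ρ (tight u.Adm r B),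
        u.edge e =ᶠ[𝓝 (ends (flow G ρ (movers G (innerFirst (B ∪ tight u.Adm r B)) e) s x) e)]
          cutoff (c * sc (edgeRank (forestRank r B) e)) (u.edge e) ∧
        DerivBound M (fun s => cutoff (c * sc (edgeRank (forestRank r B) e)) (u.edge e)
          (ends (flow G ρ (movers G (innerFirst (B ∪ tight u.Adm r B)) e) s x) e)) s
          (C * sc (edgeRank (forestRank r B) e) ^ (-α)) := by
  set T := tight u.Adm r B with hT
  have hA0 : 0 < A := by linarith
  obtain ⟨c', hc', hev⟩ := exists_le_norm_ends hr hA hε hB he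
  set l := movers G (innerFirst (B ∪ T)) e with hl
  obtain ⟨C1, hC10, hC1⟩ := exists_derivBound_flow (V := V) (G := G) (d := d) M hA0.le l
  -- with `c ≤ 1`, negative powers of `c` are largest for the largest number of derivatives
  set c := min c' 1 with hc
  have hc0 : 0 < c := lt_min hc' one_pos
  set R : ℝ := A + C1 * (l.length * A) with hR
  obtain ⟨D, hD0, hD⟩ := exists_norm_iteratedFDeriv_le_all (u.edge_smooth e he) hα M R
  set K : ℝ := max 1 (2 * C1 * l.length) with hK
  refine ⟨c / 2, by positivity, M.factorial * (D * c ^ (-α - M)) * K ^ M, by positivity, ?_⟩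
  filter_upwards [hev] with κ hκ sc x hx hxN ρ hρ s hs
  set L := sc (edgeRank (forestRank r B) e) with hL
  have hL0 : 0 < L := hx.pos _
  have hLA : L ≤ A := by
    rw [← hx.top]
    exact hx.mono (forestRank_lt hr (adj_out he).ne).le
  have hmem : ∀ γ ∈ l, γ ∈ B ∪ T ∧ e ∉ edgesIn G γ := fun γ hγ => by
    have := List.mem_filter.1 hγ
    exact ⟨mem_innerFirst.1 this.1, by simpa using this.2⟩
  have hlow : c * L ≤ ‖(ends (flow G ρ l s x) e).1 - (ends (flow G ρ l s x) e).2‖ :=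
    (mul_le_mul_of_nonneg_right (min_le_left _ _) hL0.le).trans (hκ sc x hx hxN ρ hρ s hs)
  have hgerm : u.edge e =ᶠ[𝓝 (ends (flow G ρ l s x) e)] cutoff (c / 2 * L) (u.edge e) :=
    eventuallyEq_cutoff (by positivity) _ (by
      have : 2 * (c / 2 * L) = c * L := by ring
      rwa [this])
  refine ⟨hgerm, ?_⟩
  have hflow : ∀ z ∈ e, DerivBound M (fun s => flow G ρ l s x z - x z) s
      (C1 * (l.length * L)) := by
    intro z hz
    refine (hC1 _ _ ρ x s ((hx.scaledList hr hB).sublist List.filter_sublist) (fun γ _ => hρ γ)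
      (fun γ => ⟨(hs γ).1, (hs γ).2.1⟩) z).mono ?_
    refine mul_le_mul_of_nonneg_left (moveScale_le hL0.le fun γ hγ hzγ => hx.mono ?_) hC10
    exact outerRank_le_forestRank hr.rank (hmem γ hγ).1
      (sep_of_notMem_edgesIn he (hmem γ hγ).2 hz hzγ)
  have hnorm : ∀ z ∈ e, ‖flow G ρ l s x z‖ ≤ R := by
    intro z hz
    have h1 := (hflow z hz).norm_le
    have h2 := hx.bdd z
    have h3 : ‖flow G ρ l s x z‖ ≤ ‖flow G ρ l s x z - x z‖ + ‖x z‖ := by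
      simpa using norm_add_le (flow G ρ l s x z - x z) (x z)
    have h4 : C1 * (l.length * L) ≤ C1 * (l.length * A) := by gcongr
    linarith
  have hm1 : (Quot.out e).1 ∈ e := Sym2.out_fst_mem e
  have hm2 : (Quot.out e).2 ∈ e := Sym2.out_snd_mem e
  have hne : (ends (flow G ρ l s x) e).1 ≠ (ends (flow G ρ l s x) e).2 := by
    intro h
    rw [h, sub_self, norm_zero] at hlow
    exact absurd hlow (not_le.2 (by positivity))
  have hcd : ∀ z, ContDiff ℝ ∞ (fun s : Finset V → ℝ => flow G ρ l s x z) :=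
    fun z => contDiff_flow_apply ρ l x z
  have hf : ContDiff ℝ ∞ (fun s : Finset V → ℝ => ends (flow G ρ l s x) e) :=
    (hcd _).prodMk (hcd _)
  have hcut : ContDiff ℝ ∞ (cutoff (c / 2 * L) (u.edge e)) :=
    contDiff_cutoff (by positivity) (u.edge_smooth e he)
  refine (derivBound_comp_scale (N := M) (K := K) (L := L) (C := D * c ^ (-α - M) * L ^ (-α))
    hcut hf hL0 (le_max_left _ _) (fun i hi => ?_) (fun i hi hiM => ?_)).mono (le_of_eq (by ring))
  · rw [← (hgerm.iteratedFDeriv ℝ i).self_of_nhds]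
    have h1 := hD i hi _ hne (hnorm _ hm1) (hnorm _ hm2)
    have h2 : ‖(ends (flow G ρ l s x) e).1 - (ends (flow G ρ l s x) e).2‖ ^ (-α - i : ℝ) ≤
        (c * L) ^ (-α - i : ℝ) :=
      Real.rpow_le_rpow_of_nonpos (by positivity) hlow (by
        have : (0 : ℝ) ≤ i := i.cast_nonneg
        linarith)
    have h3 : (c * L) ^ (-α - i : ℝ) * L ^ i = c ^ (-α - i : ℝ) * L ^ (-α) := by
      rw [Real.mul_rpow hc0.le hL0.le, mul_assoc, ← Real.rpow_natCast L i, ← Real.rpow_add hL0]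
      congr 2
      ring
    have h4 : c ^ (-α - i : ℝ) ≤ c ^ (-α - M : ℝ) :=
      Real.rpow_le_rpow_of_exponent_ge hc0 (min_le_right _ _) (by
        have : (i : ℝ) ≤ M := by exact_mod_cast hi
        linarith)
    calc _ ≤ D * (c * L) ^ (-α - i : ℝ) * L ^ i := by
          gcongr
          exact h1.trans (mul_le_mul_of_nonneg_left h2 hD0)
      _ = D * (c ^ (-α - i : ℝ) * L ^ (-α)) := by rw [mul_assoc, h3]
      _ ≤ D * (c ^ (-α - M : ℝ) * L ^ (-α)) := by gcongr
      _ = _ := by ring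
  · have h1 := (hflow _ hm1).prodMk ((hcd _).sub contDiff_const) ((hcd _).sub contDiff_const)
      (hflow _ hm2)
    have h2 : DerivBound M (fun s => ends (flow G ρ l s x) e - (x (Quot.out e).1, x (Quot.out e).2))
        s (C1 * (l.length * L) + C1 * (l.length * L)) := h1
    refine (h2.norm_iteratedFDeriv_le hf hi hiM).trans ?_
    have : C1 * (l.length * L) + C1 * (l.length * L) = 2 * C1 * l.length * L := by ring
    rw [this]
    exact mul_le_mul_of_nonneg_right (le_max_right _ _) hL0.le

/-- The vertex weights are smooth, and their arguments stay in a bounded set. -/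
lemma exists_derivBound_vertex (hr : RankData r N) (hA : 1 ≤ A)
    (hB : B ∈ bases u.Adm r) (M : ℕ) (v : V) :
    ∃ C : ℝ, 0 ≤ C ∧ ∀ (κ : ℝ) (sc : ℕ → ℝ) (x : Config V d),
      Adapted r N A κ sc x → ∀ (ρ : Finset V → ℝ),
      (∀ γ, ρ γ = sc (diamRank r γ) / sc (outerRank u.Adm r N B γ)) →
      ∀ s ∈ paramBox ρ (tight u.Adm r B),
        DerivBound M (fun s => u.vertex v
          (flow G ρ (innerFirst (B ∪ tight u.Adm r B)) s x v)) s C := by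
  set T := tight u.Adm r B with hT
  have hA0 : 0 < A := by linarith
  set l := innerFirst (B ∪ T) with hl
  obtain ⟨C1, hC10, hC1⟩ := exists_derivBound_flow (V := V) (G := G) (d := d) M hA0.le l
  set Q : ℝ := C1 * (l.length * A) with hQ
  obtain ⟨D, hD0, hD⟩ := exists_norm_iteratedFDeriv_le_of_contDiff (u.vertex_smooth v) M (A + Q)
  refine ⟨M.factorial * D * (max 1 Q) ^ M, by positivity, fun κ sc x hx ρ hρ s hs => ?_⟩
  have hflow : DerivBound M (fun s => flow G ρ l s x v - x v) s Q := by
    refine (hC1 _ _ ρ x s (hx.scaledList hr hB) (fun γ _ => hρ γ)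
      (fun γ => ⟨(hs γ).1, (hs γ).2.1⟩) v).mono ?_
    refine mul_le_mul_of_nonneg_left (moveScale_le hA0.le fun γ _ _ => ?_) hC10
    exact (hx.mono (outerRank_le hr)).trans_eq hx.top
  have hcd : ContDiff ℝ ∞ (fun s : Finset V → ℝ => flow G ρ l s x v) :=
    contDiff_flow_apply ρ l x v
  refine derivBound_comp_scale (u.vertex_smooth v) hcd one_pos (le_max_left _ _) (fun i hi => ?_)
    (fun i hi hiM => ?_)
  · rw [one_pow, mul_one]
    refine hD i hi _ ?_
    have h1 := hflow.norm_le
    have h2 := hx.bdd v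
    have h3 : ‖flow G ρ l s x v‖ ≤ ‖flow G ρ l s x v - x v‖ + ‖x v‖ := by
      simpa using norm_add_le (flow G ρ l s x v - x v) (x v)
    linarith
  · rw [mul_one]
    exact (hflow.norm_iteratedFDeriv_le hcd hi hiM).trans (le_max_right _ _)

/-- The sum of the forest terms of a group is bounded by the product of the edge weights at the
scales of their forest ranks, times a power of the ratio of the inner and the outer scale for every
tight member. -/
lemma exists_norm_group_le (hr : RankData r N) (hA : 1 ≤ A) (hε : 0 < ε)
    (hB : B ∈ bases u.Adm r) {α : Sym2 V → ℝ}
    (hα : ∀ e ∈ G.edgeSet, 0 < α e ∧ ScalesAt (u.edge e) (α e)) :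
    ∃ C : ℝ, 0 ≤ C ∧ ∀ᶠ κ in 𝓝[>] (0 : ℝ), ∀ (sc : ℕ → ℝ) (x : Config V d),
      Adapted r N A κ sc x → x ∈ u.nonExceptional ε →
      ‖∑ X ∈ (tight u.Adm r B).powerset, u.forestTerm (innerFirst (B ∪ X)) ∅ x‖ ≤
        C * ((∏ e ∈ allEdges G, sc (edgeRank (forestRank r B) e) ^ (-α e)) *
          ∏ γ ∈ tight u.Adm r B, (sc (diamRank r γ) / sc (outerRank u.Adm r N B γ)) ^
            (u.subDegree γ + 1).toNat) := by
  set T := tight u.Adm r B with hT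
  obtain ⟨hBa, hBd⟩ := mem_bases.1 hB
  have hlam : Laminar (B ∪ T) := hBa.2.union_tight hr.rank
  set m := innerFirst (B ∪ T) with hm
  set k : Finset V → ℕ := fun γ => (u.subDegree γ + 1).toNat with hk
  -- the Taylor remainders and Taylor polynomials involve at most this number of derivatives
  set M := 0 + (m.map k).sum with hM
  have hedge : ∀ e : Sym2 V, ∃ c > 0, ∃ C : ℝ, 0 ≤ C ∧ (e ∈ G.edgeSet → ∀ᶠ κ in 𝓝[>] (0 : ℝ),
      ∀ (sc : ℕ → ℝ) (x : Config V d), Adapted r N A κ sc x → x ∈ u.nonExceptional ε →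
      ∀ (ρ : Finset V → ℝ), (∀ γ, ρ γ = sc (diamRank r γ) / sc (outerRank u.Adm r N B γ)) →
      ∀ s ∈ paramBox ρ T,
        u.edge e =ᶠ[𝓝 (ends (flow G ρ (movers G m e) s x) e)]
          cutoff (c * sc (edgeRank (forestRank r B) e)) (u.edge e) ∧
        DerivBound M (fun s => cutoff (c * sc (edgeRank (forestRank r B) e)) (u.edge e)
          (ends (flow G ρ (movers G m e) s x) e)) s
          (C * sc (edgeRank (forestRank r B) e) ^ (-α e))) := by
    intro e
    by_cases he : e ∈ G.edgeSet
    · obtain ⟨c, hc, C, hC, h⟩ := exists_derivBound_edge hr hA hε hB M he (hα e he).1 (hα e he).2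
      exact ⟨c, hc, C, hC, fun _ => h⟩
    · exact ⟨1, one_pos, 0, le_rfl, fun h => absurd h he⟩
  choose c hc C hC hev using hedge
  choose Cv hCv0 hCv using fun v => exists_derivBound_vertex (u := u) hr hA hB M v
  set K1 : ℝ := (2 ^ M) ^ (allEdges G).card * ∏ e ∈ allEdges G, C e with hK1
  set K2 : ℝ := (2 ^ M) ^ (Finset.univ : Finset V).card * ∏ v, Cv v with hK2
  have hK10 : 0 ≤ K1 := mul_nonneg (by positivity) (Finset.prod_nonneg fun e _ => hC e)
  have hK20 : 0 ≤ K2 := mul_nonneg (by positivity) (Finset.prod_nonneg fun e _ => hCv0 e)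
  refine ⟨(∏ γ ∈ B, (k γ : ℝ)) * (2 ^ M * (K1 * K2)), by positivity, ?_⟩
  have hall : ∀ᶠ κ in 𝓝[>] (0 : ℝ), ∀ e : Sym2 V, e ∈ G.edgeSet → _ :=
    eventually_all.2 fun e => eventually_imp_distrib_left.2 (hev e)
  filter_upwards [hall] with κ hκ sc x hx hxN
  set ρ : Finset V → ℝ := fun γ => sc (diamRank r γ) / sc (outerRank u.Adm r N B γ) with hρ
  have hρ0 : ∀ γ, 0 < ρ γ := fun γ => div_pos (hx.pos _) (hx.pos _)
  have hρ1 : ∀ γ, ρ γ ≤ 1 := fun γ =>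
    (div_le_one (hx.pos _)).2 (hx.mono (diamRank_le_outerRank hr.rank hr.lt hr.pos_top))
  -- the edge weights are made smooth by a cut-off below the lengths of the edges on the box
  set w : Sym2 V → Pt d × Pt d → ℂ := fun e => if e ∈ G.edgeSet then
    cutoff (c e * sc (edgeRank (forestRank r B) e)) (u.edge e) else 0 with hw
  have hws : ∀ e, ContDiff ℝ ∞ (w e) := by
    intro e
    simp only [hw]
    split_ifs with he
    · exact contDiff_cutoff (mul_pos (hc e) (hx.pos _)) (u.edge_smooth e he)
    · exact contDiff_const
  have hwe : ∀ e ∈ G.edgeSet, w e = cutoff (c e * sc (edgeRank (forestRank r B) e)) (u.edge e) :=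
    fun e he => if_pos he
  have hedges := fun e he => hκ e he sc x hx hxN ρ (fun _ => rfl)
  rw [sum_forestTerm_eq u hlam hBd hws hρ0 x fun e he s hs => by
    rw [hwe e he]; exact (hedges e he s hs).1]
  set Φ := paramFun G hws u.vertex_smooth ρ m ∅ x with hΦ
  have hΦeq : (Φ : (Finset V → ℝ) → ℂ) = fun s =>
      (∏ e ∈ allEdges G, w e (ends (flow G ρ (movers G m e) s x) e)) *
        ∏ v, u.vertex v (flow G ρ m s x v) := by
    ext s
    change paramTerm G w u.vertex ρ m ∅ x s = _
    rw [paramTerm_eq G w u.vertex hlam.nested_innerFirst, Finset.sdiff_empty]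
  set P := ∏ e ∈ allEdges G, sc (edgeRank (forestRank r B) e) ^ (-α e) with hP
  have hbound : ∀ s ∈ paramBox ρ T, DerivBound M (Φ : (Finset V → ℝ) → ℂ) s
      (2 ^ M * ((K1 * P) * K2)) := by
    intro s hs
    rw [hΦeq]
    have hc1 : ∀ e ∈ allEdges G, ContDiff ℝ ∞
        (fun s => w e (ends (flow G ρ (movers G m e) s x) e)) := fun e _ =>
      (hws e).comp ((contDiff_ends e).comp (contDiff_flow ρ _ x))
    have hc2 : ∀ v ∈ Finset.univ, ContDiff ℝ ∞ (fun s => u.vertex v (flow G ρ m s x v)) :=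
      fun v _ => (u.vertex_smooth v).comp (contDiff_flow_apply ρ m x v)
    have h1 := DerivBound.prod (N := M) (r := s) (allEdges G) hc1
      (K := fun e => C e * sc (edgeRank (forestRank r B) e) ^ (-α e)) fun e he => by
        rw [mem_allEdges] at he
        have := (hedges e he s hs).2
        rw [hwe e he]
        exact this
    have h2 := DerivBound.prod (N := M) (r := s) Finset.univ hc2 (K := Cv)
      fun v _ => hCv v κ sc x hx ρ (fun _ => rfl) s hs
    refine (h1.mul (contDiff_prod hc1) (contDiff_prod hc2) h2).mono (le_of_eq ?_)
    rw [Finset.prod_mul_distrib, hK1, hK2, hP]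
    ring
  have hmb := MixedBound.list (T := T) (fun γ => (hρ0 γ).le) k m 0 (innerFirst_nodup _)
    (fun γ _ => hρ1 γ) (fun γ hγ => by
      have := (adm_of_mem hB (mem_innerFirst.1 hγ)).2
      simp only [hk]
      omega) (mixedBound_of_iteratedFDeriv (N := M) fun i hi s hs => hbound s hs i hi)
  have h0 := hmb [] (by simp) (by simp) 0 (fun γ => ⟨le_rfl, (hρ0 γ).le, fun _ => rfl⟩)
  refine h0.trans (le_of_eq ?_)
  have hprod : (m.map (fun γ => if γ ∈ T then ρ γ ^ k γ else (k γ : ℝ))).prod =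
      (∏ γ ∈ B, (k γ : ℝ)) * ∏ γ ∈ T, ρ γ ^ k γ := by
    rw [((innerFirst_perm (B ∪ T)).map _).prod_eq, Finset.prod_map_toList,
      Finset.prod_union hBd]
    congr 1
    · exact Finset.prod_congr rfl fun γ hγ => if_neg (Finset.disjoint_left.1 hBd hγ)
    · exact Finset.prod_congr rfl fun γ hγ => if_pos hγ
  rw [hprod]
  ring

end GroupBound

end

end BPHZ

namespace BPHZ

noncomputable section

open scoped Classical

/-! ### Power counting -/

section PowerCounting

variable {V : Type*} [Fintype V] {G : SimpleGraph V} {d : ℕ} {u : GraphWeight G d}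
  {r : V → V → ℕ} {N : ℕ} {A κ ε : ℝ} {B : Finset (Finset V)} {γ : Finset V} {sc : ℕ → ℝ}
  {x : Config V d}

/-- An exponent at which a function scales and which exceeds its scaling degree by at most `δ`. -/
lemma exists_scalesAt_lt {w : Pt d × Pt d → ℂ} (h0 : 0 < scalingDegree w)
    (h1 : scalingDegree w < ⊤) {δ : ℝ} (hδ : 0 < δ) :
    ∃ α : ℝ, 0 < α ∧ ScalesAt w α ∧ α ≤ (scalingDegree w).toReal + δ := by
  have hs : ((scalingDegree w).toReal : EReal) = scalingDegree w :=
    EReal.coe_toReal h1.ne (ne_bot_of_gt h0)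
  have h2 : scalingDegree w < (((scalingDegree w).toReal + δ : ℝ) : EReal) := by
    conv_lhs => rw [← hs]
    exact EReal.coe_lt_coe (by linarith)
  obtain ⟨_, ⟨α, hα, rfl⟩, hlt⟩ := sInf_lt_iff.1 h2
  refine ⟨α, ?_, hα, (EReal.coe_lt_coe_iff.1 hlt).le⟩
  have h3 : scalingDegree w ≤ (α : EReal) := sInf_le ⟨α, hα, rfl⟩
  exact_mod_cast h0.trans_le h3

/-- Exponents close to the scaling degrees for which every vertex set has a negative degree of
divergence after subtraction, uniformly. -/
lemma exists_exponents (u : GraphWeight G d) (hd : 0 < d)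
    (hpos : ∀ e ∈ G.edgeSet, 0 < scalingDegree (u.edge e))
    (hfin : ∀ e ∈ G.edgeSet, scalingDegree (u.edge e) < ⊤) :
    ∃ β : ℝ, 0 ≤ β ∧ β < d ∧ ∃ α : Sym2 V → ℝ,
      (∀ e ∈ G.edgeSet, 0 < α e ∧ ScalesAt (u.edge e) (α e)) ∧
      ∀ D : Finset V, D.Nonempty → ∑ e ∈ edgesIn G D, α e -
        (if u.Adm D then ((u.subDegree D + 1).toNat : ℝ) else 0) ≤ β * ((D.card : ℝ) - 1) := by
  set gap : Finset V → ℝ := fun D => (d : ℝ) * ((D.card : ℝ) - 1) -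
    ∑ e ∈ edgesIn G D, (scalingDegree (u.edge e)).toReal +
      (if u.Adm D then ((u.subDegree D + 1).toNat : ℝ) else 0) with hgap
  -- the degree of divergence after subtraction is `-gap D`, and `t < ⌊t⌋ + 1`
  have hgap0 : ∀ D, (edgesIn G D).Nonempty → 0 < gap D := by
    intro D hD
    have hdeg : u.uvDegree D = ∑ e ∈ edgesIn G D, (scalingDegree (u.edge e)).toReal -
      (d : ℝ) * ((D.card : ℝ) - 1) := rfl
    have hfl : u.uvDegree D < u.subDegree D + 1 := Int.lt_floor_add_one _
    simp only [hgap]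
    by_cases h : 0 ≤ u.subDegree D
    · rw [if_pos ⟨hD, h⟩]
      have h1 : (((u.subDegree D + 1).toNat : ℤ) : ℝ) = u.subDegree D + 1 := by
        rw [Int.toNat_of_nonneg (by omega)]; push_cast; ring
      rw [Int.cast_natCast] at h1
      linarith
    · rw [if_neg fun h' => h h'.2]
      have h1 : (u.subDegree D : ℝ) + 1 ≤ 0 := by
        have : u.subDegree D + 1 ≤ 0 := by omega
        exact_mod_cast this
      linarith
  -- raising the exponents by `δ` and lowering `d` to `d - δ` costs at most `δ * n`
  set n : ℝ := (allEdges G).card + Fintype.card V with hn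
  have hev : ∀ᶠ δ in 𝓝[>] (0 : ℝ), ∀ D : Finset V, (edgesIn G D).Nonempty → δ * n < gap D := by
    refine eventually_all.2 fun D => eventually_imp_distrib_left.2 fun hD => ?_
    have hc : Tendsto (fun δ : ℝ => δ * n) (𝓝[>] 0) (𝓝 (0 * n)) :=
      (tendsto_nhdsWithin_of_tendsto_nhds tendsto_id).mul_const _
    rw [zero_mul] at hc
    exact hc.eventually_lt_const (hgap0 D hD)
  have hev2 : ∀ᶠ δ : ℝ in 𝓝[>] (0 : ℝ), δ < (d : ℝ) :=
    (tendsto_nhdsWithin_of_tendsto_nhds tendsto_id).eventually_lt_const (by exact_mod_cast hd)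
  obtain ⟨δ, hδ1, hδ2, hδ0⟩ := (hev.and (hev2.and self_mem_nhdsWithin)).exists
  have hδ0 : 0 < δ := hδ0
  have hα : ∀ e : Sym2 V, ∃ α : ℝ, e ∈ G.edgeSet → 0 < α ∧ ScalesAt (u.edge e) α ∧
      α ≤ (scalingDegree (u.edge e)).toReal + δ := by
    intro e
    by_cases he : e ∈ G.edgeSet
    · obtain ⟨α, h⟩ := exists_scalesAt_lt (hpos e he) (hfin e he) hδ0
      exact ⟨α, fun _ => h⟩
    · exact ⟨0, fun h => absurd h he⟩
  choose α hα using hα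
  refine ⟨d - δ, by linarith, by linarith, α, fun e he => ⟨(hα e he).1, (hα e he).2.1⟩,
    fun D hD => ?_⟩
  by_cases hE : (edgesIn G D).Nonempty
  · have h1 : ∑ e ∈ edgesIn G D, α e ≤ ∑ e ∈ edgesIn G D,
        ((scalingDegree (u.edge e)).toReal + δ) :=
      Finset.sum_le_sum fun e he => (hα e (mem_edgesIn.1 he).1).2.2
    rw [Finset.sum_add_distrib, Finset.sum_const, nsmul_eq_mul] at h1
    have h2 := hδ1 D hE
    simp only [hgap] at h2
    have h3 : ((edgesIn G D).card : ℝ) ≤ (allEdges G).card := by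
      exact_mod_cast Finset.card_le_card (edgesIn_subset D)
    have h4 : (D.card : ℝ) ≤ Fintype.card V := by exact_mod_cast Finset.card_le_univ D
    nlinarith
  · rw [Finset.not_nonempty_iff_eq_empty.1 hE, Finset.sum_empty, if_neg fun h => hE h.1]
    have : (1 : ℝ) ≤ D.card := by exact_mod_cast hD.card_pos
    rw [sub_zero]
    exact mul_nonneg (by linarith) (by linarith)

lemma sum_ite_le_sub (g : ℕ → ℝ) (n : ℕ) : ∀ {N : ℕ}, n ≤ N →
    ∑ m ∈ Finset.range N, (if n ≤ m then g (m + 1) - g m else 0) = g N - g n := by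
  intro N
  induction N with
  | zero => intro h; simp [Nat.le_zero.1 h]
  | succ N ih =>
    intro h
    rw [Finset.sum_range_succ]
    rcases Nat.lt_or_eq_of_le h with h1 | h1
    · rw [ih (by omega), if_pos (by omega)]
      ring
    · rw [if_neg (by omega), Finset.sum_eq_zero fun m hm => if_neg (by
        rw [Finset.mem_range] at hm; omega), ← h1]
      ring

lemma sum_ite_and_sub (g : ℕ → ℝ) {n n' N : ℕ} (h : n ≤ n') (h' : n' ≤ N) :
    ∑ m ∈ Finset.range N, (if n ≤ m ∧ m < n' then g (m + 1) - g m else 0) = g n' - g n := by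
  have h1 := sum_ite_le_sub g n (h.trans h')
  have h2 := sum_ite_le_sub g n' h'
  have h3 : g n' - g n = (g N - g n) - (g N - g n') := by ring
  rw [h3, ← h1, ← h2, ← Finset.sum_sub_distrib]
  refine Finset.sum_congr rfl fun m _ => ?_
  split_ifs <;> first | omega | ring1

variable [LinearOrder V]

/-- The integrable majorant. On bounded sets, the factor of `i` is comparable to the power `-β` of the
distance from `x i` to the nearest of the points that follow it in the order of `V`. -/
def majorant (β : ℝ) (x : Config V d) : ℝ :=
  ∏ i, (1 + ∑ j ∈ Finset.univ.filter (fun j => i < j), ‖x i - x j‖ ^ (-β))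

/-- The levels that count for `i` are those above the rank of its nearest successor, and they add up
to the logarithm of this distance. -/
lemma exp_level_le (hr : RankData r N) (hA : 1 ≤ A) (hx : Adapted r N A κ sc x) {β : ℝ}
    (hβ : 0 ≤ β) (i : V) :
    Real.exp (β * ∑ m ∈ Finset.range N, (if ∃ j, i < j ∧ r i j ≤ m then
      Real.log (sc (m + 1)) - Real.log (sc m) else 0)) ≤
    A ^ (2 * β) * (1 + ∑ j ∈ Finset.univ.filter (fun j => i < j), ‖x i - x j‖ ^ (-β)) := by
  have hA0 : 0 < A := by linarith
  have hA1 : 1 ≤ A ^ (2 * β) := Real.one_le_rpow hA (by positivity)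
  have hnn : ∀ j, 0 ≤ ‖x i - x j‖ ^ (-β) := fun j => Real.rpow_nonneg (norm_nonneg _) _
  rcases (Finset.univ.filter (fun j => i < j)).eq_empty_or_nonempty with he | hne
  · have h1 : ∀ m, ¬ ∃ j, i < j ∧ r i j ≤ m := by
      rintro m ⟨j, hj, -⟩
      have : j ∈ Finset.univ.filter (fun j => i < j) := by simpa using hj
      rw [he] at this
      simp at this
    simp only [h1, if_false, Finset.sum_const_zero, mul_zero, Real.exp_zero, he, Finset.sum_empty]
    linarith
  · obtain ⟨j, hj, hmin⟩ := Finset.exists_min_image _ (fun j => r i j) hne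
    have hij : i < j := (Finset.mem_filter.1 hj).2
    have h1 : ∀ m, (∃ j, i < j ∧ r i j ≤ m) ↔ r i j ≤ m := fun m =>
      ⟨fun ⟨k, hk, hkm⟩ => (hmin k (by simpa using hk)).trans hkm, fun h => ⟨j, hij, h⟩⟩
    simp only [h1]
    rw [sum_ite_le_sub (fun m => Real.log (sc m)) (r i j) (hr.lt i j).le, hx.top]
    have h2 := hx.norm_le i j hij.ne
    have h3 := hx.le_norm i j hij.ne
    have hsc := hx.pos (r i j)
    have hn : 0 < ‖x i - x j‖ := by
      by_contra h
      have : ‖x i - x j‖ = 0 := le_antisymm (not_lt.1 h) (norm_nonneg _)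
      rw [this, mul_zero] at h3
      linarith
    have h4 : Real.exp (β * (Real.log A - Real.log (sc (r i j)))) = A ^ β * sc (r i j) ^ (-β) := by
      rw [Real.rpow_def_of_pos hA0, Real.rpow_def_of_pos hsc, ← Real.exp_add]
      congr 1
      ring
    have h5 : sc (r i j) ^ (-β) ≤ A ^ β * ‖x i - x j‖ ^ (-β) := by
      have h6 : ‖x i - x j‖ / A ≤ sc (r i j) := by
        rw [div_le_iff₀ hA0, mul_comm]
        exact h2
      refine (Real.rpow_le_rpow_of_nonpos (by positivity) h6 (by linarith)).trans (le_of_eq ?_)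
      rw [Real.div_rpow hn.le hA0.le, Real.rpow_neg hA0.le, div_inv_eq_mul, mul_comm]
    rw [h4]
    calc A ^ β * sc (r i j) ^ (-β) ≤ A ^ β * (A ^ β * ‖x i - x j‖ ^ (-β)) := by gcongr
      _ = A ^ (2 * β) * ‖x i - x j‖ ^ (-β) := by
        rw [← mul_assoc, ← Real.rpow_add hA0]
        congr 2
        ring
      _ ≤ _ := by
        refine mul_le_mul_of_nonneg_left ?_ (by linarith)
        have := Finset.single_le_sum (f := fun j => ‖x i - x j‖ ^ (-β)) (fun k _ => hnn k) hj
        linarith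

/-- The scales of all ranks telescope into the contributions of the single levels, each of which
is controlled by the degree of divergence of the clusters of that level. -/
lemma prod_le_majorant (hr : RankData r N) (hA : 1 ≤ A) (hx : Adapted r N A κ sc x)
    {α : Sym2 V → ℝ} {k : Finset V → ℕ} {β : ℝ} (hβ : 0 ≤ β)
    (hpc : ∀ D : Finset V, D.Nonempty → ∑ e ∈ edgesIn G D, α e -
        (if u.Adm D then (k D : ℝ) else 0) ≤ β * ((D.card : ℝ) - 1)) :
    (∏ e ∈ allEdges G, sc (edgeRank (forestRank r B) e) ^ (-α e)) *
      ∏ γ ∈ tight u.Adm r B, (sc (diamRank r γ) / sc (outerRank u.Adm r N B γ)) ^ k γ ≤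
    A ^ (-∑ e ∈ allEdges G, α e) * ((A ^ (2 * β)) ^ Fintype.card V * majorant β x) := by
  have hA0 : 0 < A := by linarith
  set T := tight u.Adm r B with hT
  set g : ℕ → ℝ := fun n => Real.log (sc n) with hg
  have hgN : g N = Real.log A := by simp only [hg, hx.top]
  have hmono : ∀ m, 0 ≤ g (m + 1) - g m := fun m =>
    sub_nonneg.2 (Real.log_le_log (hx.pos _) (hx.mono (Nat.le_succ m)))
  have h1 : ∏ e ∈ allEdges G, sc (edgeRank (forestRank r B) e) ^ (-α e) =
      A ^ (-∑ e ∈ allEdges G, α e) * Real.exp (∑ e ∈ allEdges G, α e *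
        (g N - g (edgeRank (forestRank r B) e))) := by
    rw [Real.rpow_def_of_pos hA0, ← Real.exp_add, mul_neg, Finset.mul_sum,
      ← Finset.sum_neg_distrib, ← Finset.sum_add_distrib, Real.exp_sum]
    refine Finset.prod_congr rfl fun e _ => ?_
    rw [Real.rpow_def_of_pos (hx.pos _), hgN]
    congr 1
    simp only [hg]
    ring
  have h2 : ∏ γ ∈ T, (sc (diamRank r γ) / sc (outerRank u.Adm r N B γ)) ^ k γ =
      Real.exp (-∑ γ ∈ T, (k γ : ℝ) * (g (outerRank u.Adm r N B γ) - g (diamRank r γ))) := by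
    rw [← Finset.sum_neg_distrib, Real.exp_sum]
    refine Finset.prod_congr rfl fun γ _ => ?_
    rw [← Real.rpow_natCast, Real.rpow_def_of_pos (div_pos (hx.pos _) (hx.pos _)),
      Real.log_div (hx.pos _).ne' (hx.pos _).ne']
    congr 1
    simp only [hg]
    ring
  have h3 : ∑ e ∈ allEdges G, α e * (g N - g (edgeRank (forestRank r B) e)) -
      ∑ γ ∈ T, (k γ : ℝ) * (g (outerRank u.Adm r N B γ) - g (diamRank r γ)) ≤
      ∑ i : V, β * ∑ m ∈ Finset.range N,
        (if ∃ j, i < j ∧ r i j ≤ m then g (m + 1) - g m else 0) := by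
    have e1 : ∑ e ∈ allEdges G, α e * (g N - g (edgeRank (forestRank r B) e)) =
        ∑ m ∈ Finset.range N, (g (m + 1) - g m) * ∑ e ∈ (allEdges G).filter
          (fun e => edgeRank (forestRank r B) e ≤ m), α e := by
      simp only [Finset.sum_filter, Finset.mul_sum]
      rw [Finset.sum_comm]
      refine Finset.sum_congr rfl fun e he => ?_
      have h5 : edgeRank (forestRank r B) e ≤ N :=
        (forestRank_lt hr (adj_out (mem_allEdges.1 he)).ne).le
      rw [← sum_ite_le_sub g _ h5, Finset.mul_sum]
      refine Finset.sum_congr rfl fun m _ => ?_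
      split_ifs <;> ring
    have e2 : ∑ γ ∈ T, (k γ : ℝ) * (g (outerRank u.Adm r N B γ) - g (diamRank r γ)) =
        ∑ m ∈ Finset.range N, (g (m + 1) - g m) * ∑ γ ∈ T.filter
          (fun γ => diamRank r γ ≤ m ∧ m < outerRank u.Adm r N B γ), (k γ : ℝ) := by
      simp only [Finset.sum_filter, Finset.mul_sum]
      rw [Finset.sum_comm]
      refine Finset.sum_congr rfl fun γ _ => ?_
      rw [← sum_ite_and_sub g (diamRank_le_outerRank hr.rank hr.lt hr.pos_top) (outerRank_le hr),
        Finset.mul_sum]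
      refine Finset.sum_congr rfl fun m _ => ?_
      split_ifs <;> ring
    rw [e1, e2, ← Finset.sum_sub_distrib, ← Finset.mul_sum, Finset.sum_comm, Finset.mul_sum]
    refine Finset.sum_le_sum fun m hm => ?_
    rw [← mul_sub]
    have h4 := sum_level_le (G := G) hr.rank (adm := u.Adm) (B := B) (Finset.mem_range.1 hm) hβ
      (c := fun γ => (k γ : ℝ)) (fun γ _ => Nat.cast_nonneg _) hpc
    refine (mul_le_mul_of_nonneg_left h4 (hmono m)).trans (le_of_eq ?_)
    rw [← Finset.sum_filter, Finset.sum_const, nsmul_eq_mul]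
    ring
  rw [h1, h2, mul_assoc, ← Real.exp_add, ← sub_eq_add_neg]
  refine mul_le_mul_of_nonneg_left ?_ (by positivity)
  refine (Real.exp_le_exp.2 h3).trans ?_
  rw [Real.exp_sum, majorant, Fintype.card, ← Finset.prod_const, ← Finset.prod_mul_distrib]
  exact Finset.prod_le_prod (fun _ _ => (Real.exp_pos _).le) fun i _ => exp_level_le hr hA hx hβ i

end PowerCounting

end

end BPHZ

namespace BPHZ

noncomputable section

open scoped Classical

/-! ### The pointwise bound -/

section Pointwise

variable {V : Type*} [Fintype V] {G : SimpleGraph V} {d : ℕ}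

/-- The scale of the rank `n`: the smallest distance of rank at least `n`. -/
def minScale (r : V → V → ℕ) (A : ℝ) (x : Config V d) (n : ℕ) : ℝ :=
  (insert A ((Finset.univ.filter (fun p : V × V => p.1 ≠ p.2 ∧ n ≤ r p.1 p.2)).image
    (fun p => ‖x p.1 - x p.2‖))).min' (Finset.insert_nonempty _ _)

lemma minScale_le {r : V → V → ℕ} {A : ℝ} {x : Config V d} {n : ℕ} {i j : V} (hij : i ≠ j)
    (h : n ≤ r i j) : minScale r A x n ≤ ‖x i - x j‖ :=
  Finset.min'_le _ _ (Finset.mem_insert_of_mem (Finset.mem_image.2 ⟨(i, j), by simp [hij, h], rfl⟩))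

lemma le_minScale {r : V → V → ℕ} {A : ℝ} {x : Config V d} {n : ℕ} {a : ℝ} (hA : a ≤ A)
    (h : ∀ i j, i ≠ j → n ≤ r i j → a ≤ ‖x i - x j‖) : a ≤ minScale r A x n := by
  refine Finset.le_min' _ _ _ fun y hy => ?_
  rcases Finset.mem_insert.1 hy with rfl | hy
  · exact hA
  · obtain ⟨p, hp, rfl⟩ := Finset.mem_image.1 hy
    have := (Finset.mem_filter.1 hp).2
    exact h _ _ this.1 this.2

lemma minScale_le_top {r : V → V → ℕ} {A : ℝ} {x : Config V d} {n : ℕ} : minScale r A x n ≤ A :=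
  Finset.min'_le _ _ (Finset.mem_insert_self _ _)

/-- Along an ultrafilter the distances of a bounded sequence of configurations are totally
preordered by their asymptotic size. The position in this preorder is an ultrametric rank to which the
configurations are adapted. -/
lemma exists_adapted (xs : ℕ → Config V d) (hinj : ∀ n, Function.Injective (xs n)) {R : ℝ}
    (hR : ∀ n v, ‖xs n v‖ ≤ R) (𝒰 : Ultrafilter ℕ) :
    ∃ (r : V → V → ℕ) (N : ℕ) (A : ℝ), 1 ≤ A ∧ RankData r N ∧ ∀ κ > 0, ∀ᶠ n in (𝒰 : Filter ℕ),
      ∃ sc : ℕ → ℝ, Adapted r N A κ sc (xs n) := by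
  set ℓ : V × V → ℕ → ℝ := fun p n => ‖xs n p.1 - xs n p.2‖ with hℓ
  have hℓ0 : ∀ p n, 0 ≤ ℓ p n := fun p n => norm_nonneg _
  have hℓpos : ∀ p : V × V, p.1 ≠ p.2 → ∀ n, 0 < ℓ p n := fun p hp n =>
    norm_pos_iff.2 (sub_ne_zero.2 fun h => hp (hinj n h))
  have hℓdiag : ∀ i n, ℓ (i, i) n = 0 := fun i n => by simp [hℓ]
  set le : V × V → V × V → Prop := fun p q =>
    ∃ C : ℝ, 0 ≤ C ∧ ∀ᶠ n in (𝒰 : Filter ℕ), ℓ p n ≤ C * ℓ q n with hle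
  have hrefl : ∀ p, le p p := fun p => ⟨1, zero_le_one, Eventually.of_forall fun n => by simp⟩
  have htrans : ∀ p q s, le p q → le q s → le p s := by
    rintro p q s ⟨C, hC, h⟩ ⟨C', hC', h'⟩
    refine ⟨C * C', by positivity, ?_⟩
    filter_upwards [h, h'] with n h1 h2
    rw [mul_assoc]
    exact h1.trans (mul_le_mul_of_nonneg_left h2 hC)
  have hgap : ∀ p q, ¬ le q p → ∀ κ > 0, ∀ᶠ n in (𝒰 : Filter ℕ), ℓ p n ≤ κ * ℓ q n := by
    intro p q h κ hκ
    have h1 : ¬ ∀ᶠ n in (𝒰 : Filter ℕ), ℓ q n ≤ κ⁻¹ * ℓ p n := fun h' =>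
      h ⟨κ⁻¹, by positivity, h'⟩
    rw [← Ultrafilter.eventually_not] at h1
    filter_upwards [h1] with n hn
    rw [not_le, inv_mul_lt_iff₀ hκ] at hn
    exact hn.le
  have htotal : ∀ p q, le p q ∨ le q p := by
    intro p q
    by_cases h : le q p
    · exact Or.inr h
    · exact Or.inl ⟨1, zero_le_one, hgap p q h 1 one_pos⟩
  -- the number of pairs that are of strictly smaller order
  set rk : V × V → ℕ := fun p => (Finset.univ.filter (fun s => ¬ le p s)).card with hrk
  have hmono : ∀ p q, le p q → rk p ≤ rk q := fun p q h => Finset.card_le_card fun s hs => by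
    rw [Finset.mem_filter] at hs ⊢
    exact ⟨hs.1, fun h' => hs.2 (htrans _ _ _ h h')⟩
  have hstrict : ∀ p q, ¬ le q p → rk p < rk q := fun p q h => by
    refine Finset.card_lt_card ((Finset.ssubset_iff_of_subset fun s hs => ?_).2 ⟨p, ?_, ?_⟩)
    · rw [Finset.mem_filter] at hs ⊢
      exact ⟨hs.1, fun h' => hs.2 (htrans _ _ _ ((htotal p q).resolve_right h) h')⟩
    · simpa using h
    · simpa using hrefl p
  have hle_of : ∀ p q, rk p ≤ rk q → le p q := fun p q h => by
    by_contra h'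
    exact absurd (hstrict q p h') (by omega)
  have hdiag : ∀ i q, le (i, i) q := fun i q => ⟨0, le_rfl, Eventually.of_forall fun n => by
    rw [hℓdiag]; simp⟩
  have hndiag : ∀ p i, p.1 ≠ p.2 → ¬ le p (i, i) := by
    rintro p i hp ⟨C, -, h⟩
    obtain ⟨n, hn⟩ := h.exists
    rw [hℓdiag, mul_zero] at hn
    exact absurd (hℓpos p hp n) (not_lt.2 hn)
  set r : V → V → ℕ := fun i j => rk (i, j) with hr
  have hrank : IsRank r := by
    refine ⟨fun v => ?_, fun v w => ?_, fun a b c => ?_⟩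
    · refine Finset.card_eq_zero.2 (Finset.filter_eq_empty_iff.2 fun s _ h => h (hdiag v s))
    · have hsymm : ∀ v w, le (v, w) (w, v) := fun v w =>
        ⟨1, zero_le_one, Eventually.of_forall fun n => by
          simp only [hℓ, one_mul]
          rw [norm_sub_rev]⟩
      exact le_antisymm (hmono _ _ (hsymm v w)) (hmono _ _ (hsymm w v))
    · have htri : ∀ n, ℓ (a, c) n ≤ ℓ (a, b) n + ℓ (b, c) n := fun n =>
        norm_sub_le_norm_sub_add_norm_sub _ _ _
      rcases htotal (a, b) (b, c) with ⟨C, hC, h⟩ | ⟨C, hC, h⟩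
      · refine le_max_of_le_right (hmono _ _ ⟨C + 1, by positivity, ?_⟩)
        filter_upwards [h] with n hn
        linarith [htri n]
      · refine le_max_of_le_left (hmono _ _ ⟨C + 1, by positivity, ?_⟩)
        filter_upwards [h] with n hn
        linarith [htri n]
  have hconst : ∀ p q, ∃ C : ℝ, 0 ≤ C ∧ (le p q →
      ∀ᶠ n in (𝒰 : Filter ℕ), ℓ p n ≤ C * ℓ q n) := by
    intro p q
    by_cases h : le p q
    · obtain ⟨C, hC, h'⟩ := h
      exact ⟨C, hC, fun _ => h'⟩
    · exact ⟨0, le_rfl, fun h' => absurd h' h⟩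
  choose C hC0 hC using hconst
  -- bounds all constants of comparison, and all distances
  set A : ℝ := 1 + 2 * |R| + ∑ p, ∑ q, C p q with hA
  have hsum0 : 0 ≤ ∑ p, ∑ q, C p q :=
    Finset.sum_nonneg fun p _ => Finset.sum_nonneg fun q _ => hC0 p q
  have hCA : ∀ p q, C p q ≤ A := by
    intro p q
    have h1 : C p q ≤ ∑ q, C p q :=
      Finset.single_le_sum (f := fun q => C p q) (fun q _ => hC0 p q) (Finset.mem_univ q)
    have h2 : ∑ q, C p q ≤ ∑ p, ∑ q, C p q := Finset.single_le_sum (f := fun p => ∑ q, C p q)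
      (fun p _ => Finset.sum_nonneg fun q _ => hC0 p q) (Finset.mem_univ p)
    have := abs_nonneg R
    linarith
  have hA1 : 1 ≤ A := by have := abs_nonneg R; linarith
  have hlt : ∀ v w, r v w < Fintype.card (V × V) + 1 := fun v w =>
    Nat.lt_succ_of_le (Finset.card_le_univ _)
  refine ⟨r, Fintype.card (V × V) + 1, A, hA1, ⟨hrank, fun v w hvw => ?_, hlt, by omega⟩,
    fun κ hκ => ?_⟩
  · rw [← hrank.self v]
    exact hstrict _ _ (hndiag (v, w) v hvw)
  have hev1 : ∀ᶠ n in (𝒰 : Filter ℕ), ∀ p q, le p q → ℓ p n ≤ C p q * ℓ q n :=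
    eventually_all.2 fun p => eventually_all.2 fun q => eventually_imp_distrib_left.2 (hC p q)
  have hev2 : ∀ᶠ n in (𝒰 : Filter ℕ), ∀ p q, ¬ le q p → ℓ p n ≤ κ / A * ℓ q n :=
    eventually_all.2 fun p => eventually_all.2 fun q => eventually_imp_distrib_left.2 fun h =>
      hgap p q h _ (by positivity)
  filter_upwards [hev1, hev2] with n h1 h2
  have hcomp : ∀ i j, i ≠ j → ‖xs n i - xs n j‖ ≤ A * minScale r A (xs n) (r i j) := by
    intro i j hij
    rw [← div_le_iff₀' (by positivity)]
    refine le_minScale ?_ fun k l hkl hr => ?_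
    · rw [div_le_iff₀ (by positivity)]
      have := norm_sub_le (xs n i) (xs n j)
      have := hR n i
      have := hR n j
      have := le_abs_self R
      nlinarith
    · rw [div_le_iff₀' (by positivity)]
      exact (h1 (i, j) (k, l) (hle_of _ _ hr)).trans
        (mul_le_mul_of_nonneg_right (hCA _ _) (hℓ0 _ _))
  refine ⟨minScale r A (xs n), ⟨fun a b hab => ?_, fun a => ?_, ?_, hcomp, fun i j hij => ?_,
    fun i j k l hij hkl hlt => ?_, fun v => ?_⟩⟩
  · exact le_minScale minScale_le_top fun i j hij h => minScale_le hij (hab.trans h)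
  · rw [minScale, Finset.lt_min'_iff]
    intro y hy
    rcases Finset.mem_insert.1 hy with rfl | hy
    · linarith
    · obtain ⟨p, hp, rfl⟩ := Finset.mem_image.1 hy
      exact hℓpos p (Finset.mem_filter.1 hp).2.1 n
  · exact le_antisymm minScale_le_top (le_minScale le_rfl fun i j _ h =>
      absurd (hlt i j) (not_lt.2 h))
  · exact (minScale_le hij le_rfl).trans (le_mul_of_one_le_left (norm_nonneg _) hA1)
  · refine (minScale_le hij le_rfl).trans ((h2 (i, j) (k, l) fun h =>
      absurd (hmono _ _ h) (not_le.2 hlt)).trans ?_)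
    rw [div_mul_eq_mul_div, div_le_iff₀ (by positivity), mul_assoc]
    refine mul_le_mul_of_nonneg_left ?_ hκ.le
    rw [mul_comm]
    exact hcomp k l hkl
  · have := hR n v
    have := le_abs_self R
    have := abs_nonneg R
    linarith

/-- The Taylor operator of negative order is zero, and so are the terms in which it occurs. -/
lemma forestTerm_eq_zero (u : GraphWeight G d) {γ : Finset V} (hγ : u.subDegree γ < 0) :
    ∀ (l : List (Finset V)), γ ∈ l → ∀ S, u.forestTerm l S = 0 := by
  intro l
  induction l with
  | nil => intro h; simp at h
  | cons γ' l ih =>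
    intro h S
    ext x
    rw [GraphWeight.forestTerm]
    rcases List.mem_cons.1 h with rfl | h
    · have : (u.subDegree γ + 1).toNat = 0 := by omega
      simp [taylor, this]
    · rw [ih h]
      simp [taylor]

lemma bphzR_eq_sum (u : GraphWeight G d) (x : Config V d) :
    u.bphzR x = ∑ F ∈ admForests u.Adm, u.forestTerm (innerFirst F) ∅ x := by
  symm
  refine Finset.sum_subset (fun F hF => ?_) fun F hF hF' => ?_
  · rw [mem_admForests] at hF
    rw [forests, Finset.mem_filter]
    exact ⟨Finset.mem_univ _, fun γ hγ => (hF.1 γ hγ).1, hF.2⟩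
  · rw [forests, Finset.mem_filter] at hF
    rw [mem_admForests] at hF'
    obtain ⟨γ, hγ, h⟩ : ∃ γ ∈ F, u.subDegree γ < 0 := by
      by_contra hc
      push Not at hc
      exact hF' ⟨fun γ hγ => ⟨hF.2.1 γ hγ, hc γ hγ⟩, hF.2.2⟩
    rw [forestTerm_eq_zero u h _ (mem_innerFirst.2 hγ)]
    rfl

/-- The bounds of the groups of forests add up to a bound of the `R`-operation. -/
lemma exists_norm_bphzR_le_sum {u : GraphWeight G d} {r : V → V → ℕ} {N : ℕ} {A ε : ℝ}
    (hr : RankData r N) (hA : 1 ≤ A) (hε : 0 < ε) {α : Sym2 V → ℝ}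
    (hα : ∀ e ∈ G.edgeSet, 0 < α e ∧ ScalesAt (u.edge e) (α e)) :
    ∃ C : Finset (Finset V) → ℝ, (∀ B, 0 ≤ C B) ∧ ∀ᶠ κ in 𝓝[>] (0 : ℝ),
      ∀ (sc : ℕ → ℝ) (x : Config V d), Adapted r N A κ sc x → x ∈ u.nonExceptional ε →
      ‖u.bphzR x‖ ≤ ∑ B ∈ bases u.Adm r,
        C B * ((∏ e ∈ allEdges G, sc (edgeRank (forestRank r B) e) ^ (-α e)) *
          ∏ γ ∈ tight u.Adm r B, (sc (diamRank r γ) / sc (outerRank u.Adm r N B γ)) ^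
            (u.subDegree γ + 1).toNat) := by
  have hgroup : ∀ B : Finset (Finset V), ∃ C : ℝ, 0 ≤ C ∧ (B ∈ bases u.Adm r →
      ∀ᶠ κ in 𝓝[>] (0 : ℝ), ∀ (sc : ℕ → ℝ) (x : Config V d),
      Adapted r N A κ sc x → x ∈ u.nonExceptional ε →
      ‖∑ X ∈ (tight u.Adm r B).powerset, u.forestTerm (innerFirst (B ∪ X)) ∅ x‖ ≤
        C * ((∏ e ∈ allEdges G, sc (edgeRank (forestRank r B) e) ^ (-α e)) *
          ∏ γ ∈ tight u.Adm r B, (sc (diamRank r γ) / sc (outerRank u.Adm r N B γ)) ^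
            (u.subDegree γ + 1).toNat)) := by
    intro B
    by_cases hB : B ∈ bases u.Adm r
    · obtain ⟨C, hC, h⟩ := exists_norm_group_le hr hA hε hB hα
      exact ⟨C, hC, fun _ => h⟩
    · exact ⟨0, le_rfl, fun h => absurd h hB⟩
  choose C hC0 hC using hgroup
  have hall : ∀ᶠ κ in 𝓝[>] (0 : ℝ), ∀ B : Finset (Finset V), B ∈ bases u.Adm r → _ :=
    eventually_all.2 fun B => eventually_imp_distrib_left.2 (hC B)
  refine ⟨C, hC0, ?_⟩
  filter_upwards [hall] with κ hκ sc x hx hxN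
  rw [bphzR_eq_sum, sum_admForests hr.rank]
  exact (norm_sum_le _ _).trans (Finset.sum_le_sum fun B hB => hκ B hB sc x hx hxN)

variable [LinearOrder V]

lemma one_le_majorant (β : ℝ) (x : Config V d) : 1 ≤ majorant β x := by
  have h : ∀ i ∈ Finset.univ, (1 : ℝ) ≤ 1 + ∑ j ∈ Finset.univ.filter (fun j => i < j),
      ‖x i - x j‖ ^ (-β) := fun i _ => le_add_of_nonneg_right
    (Finset.sum_nonneg fun j _ => Real.rpow_nonneg (norm_nonneg _) _)
  simpa [majorant] using Finset.prod_le_prod (fun _ _ => zero_le_one) h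

/-- On bounded sets of non-exceptional configurations of distinct points, the `R`-operation is
bounded by the integrable majorant. -/
theorem exists_norm_bphzR_le (u : GraphWeight G d) (hd : 0 < d)
    (hpos : ∀ e ∈ G.edgeSet, 0 < scalingDegree (u.edge e))
    (hfin : ∀ e ∈ G.edgeSet, scalingDegree (u.edge e) < ⊤) {ε : ℝ} (hε : 0 < ε) :
    ∃ β : ℝ, 0 ≤ β ∧ β < d ∧ ∀ R : ℝ, ∃ C : ℝ, ∀ x ∈ u.nonExceptional ε, (∀ v, ‖x v‖ ≤ R) →
      Function.Injective x → ‖u.bphzR x‖ ≤ C * majorant β x := by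
  obtain ⟨β, hβ0, hβd, α, hα, hpc⟩ := exists_exponents u hd hpos hfin
  refine ⟨β, hβ0, hβd, fun R => ?_⟩
  by_contra hcon
  push Not at hcon
  choose xs hxN hxR hxinj hxlt using fun n : ℕ => hcon n
  obtain ⟨r, N, A, hA, hr, had⟩ := exists_adapted xs hxinj hxR (hyperfilter ℕ)
  obtain ⟨C, hC0, hall⟩ := exists_norm_bphzR_le_sum hr hA hε hα
  obtain ⟨κ, hκ, hκ0⟩ := (hall.and self_mem_nhdsWithin).exists
  set D : ℝ := A ^ (-∑ e ∈ allEdges G, α e) * (A ^ (2 * β)) ^ Fintype.card V with hD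
  set Ctot : ℝ := (∑ B ∈ bases u.Adm r, C B) * D with hCtot
  have hlarge : ∀ᶠ n : ℕ in (hyperfilter ℕ : Filter ℕ), Ctot ≤ n :=
    Nat.hyperfilter_le_atTop (tendsto_natCast_atTop_atTop.eventually_ge_atTop Ctot)
  obtain ⟨n, ⟨sc, hsc⟩, hn⟩ := ((had κ hκ0).and hlarge).exists
  have hbound : ‖u.bphzR (xs n)‖ ≤ Ctot * majorant β (xs n) := by
    refine (hκ sc (xs n) hsc (hxN n)).trans ?_
    rw [hCtot, Finset.sum_mul, Finset.sum_mul]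
    refine Finset.sum_le_sum fun B _ => ?_
    rw [mul_assoc, hD, mul_assoc]
    exact mul_le_mul_of_nonneg_left (prod_le_majorant hr hA hsc hβ0 hpc) (hC0 B)
  have h1 := one_le_majorant β (xs n)
  have h2 := hxlt n
  have h3 : Ctot * majorant β (xs n) ≤ n * majorant β (xs n) :=
    mul_le_mul_of_nonneg_right hn (by linarith)
  linarith

end Pointwise

end

end BPHZ

namespace BPHZ

noncomputable section

open scoped Classical

/-! ### Integrability of the majorant -/

section Integrability

variable {V : Type*} [Fintype V] {d : ℕ}

lemma exists_lintegral_rpow_le (hd : 0 < d) {β : ℝ} (hβ0 : 0 ≤ β) (hβ : β < d) (R : ℝ) :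
    ∃ K : ENNReal, K ≠ ⊤ ∧ ∀ z : Pt d,
      ∫⁻ y in Metric.ball (0 : Pt d) R, ENNReal.ofReal (‖y - z‖ ^ (-β)) ≤ K := by
  have hdim : Module.finrank ℝ (Pt d) = d := by simp
  have hmeas : Measurable (fun y : Pt d => ‖y‖ ^ (-β)) := measurable_norm.pow_const _
  have hint : IntegrableOn (fun y : Pt d => ‖y‖ ^ (-β)) (Metric.ball 0 1) volume :=
    integrableOn_ball_of_norm_le_rpow (by rw [hdim]; exact hd) (C := 1) (α := β)
      (by rw [hdim]; exact hβ)
      (ae_of_all _ fun y => by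
        rw [one_mul, Real.norm_eq_abs, abs_of_nonneg (Real.rpow_nonneg (norm_nonneg _) _)])
      hmeas.aestronglyMeasurable
  set f : Pt d → ENNReal := (Metric.ball (0 : Pt d) 1).indicator
    (fun y => ENNReal.ofReal (‖y‖ ^ (-β))) with hf
  have hfin : ∫⁻ y, f y ≠ ⊤ := by
    rw [hf, lintegral_indicator Metric.isOpen_ball.measurableSet]
    have h := hint.2
    rw [hasFiniteIntegral_iff_norm] at h
    simp only [Real.norm_eq_abs, abs_of_nonneg (Real.rpow_nonneg (norm_nonneg _) _)] at h
    exact h.ne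
  refine ⟨volume (Metric.ball (0 : Pt d) R) + ∫⁻ y, f y,
    ENNReal.add_ne_top.2 ⟨measure_ball_lt_top.ne, hfin⟩, fun z => ?_⟩
  have hpt : ∀ y : Pt d, ENNReal.ofReal (‖y - z‖ ^ (-β)) ≤ 1 + f (y - z) := by
    intro y
    by_cases h : y - z ∈ Metric.ball (0 : Pt d) 1
    · rw [hf, Set.indicator_of_mem h]
      exact le_add_self
    · refine le_add_right (ENNReal.ofReal_le_one.2 ?_)
      rw [mem_ball_zero_iff, not_lt] at h
      exact Real.rpow_le_one_of_one_le_of_nonpos h (by linarith)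
  calc _ ≤ ∫⁻ y in Metric.ball (0 : Pt d) R, (1 + f (y - z)) := lintegral_mono hpt
    _ = volume (Metric.ball (0 : Pt d) R) + ∫⁻ y in Metric.ball (0 : Pt d) R, f (y - z) := by
      rw [lintegral_add_left measurable_const, setLIntegral_one]
    _ ≤ volume (Metric.ball (0 : Pt d) R) + ∫⁻ y, f (y - z) := by
      gcongr
      exact Measure.restrict_le_self
    _ = _ := by rw [lintegral_sub_right_eq_self]

variable [LinearOrder V]

/-- The factor of the point `i` in the majorant, with values in `[0, ∞]`. -/
def nearFactor (β : ℝ) (i : V) (x : Config V d) : ENNReal :=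
  ENNReal.ofReal (1 + ∑ j ∈ Finset.univ.filter (fun j => i < j), ‖x i - x j‖ ^ (-β))

lemma measurable_nearFactor (β : ℝ) (i : V) :
    Measurable (nearFactor β i : Config V d → ENNReal) := by
  refine Measurable.ennreal_ofReal (measurable_const.add (Finset.measurable_sum _ fun j _ => ?_))
  exact ((measurable_pi_apply i).sub (measurable_pi_apply j)).norm.pow_const _

lemma nearFactor_update {β : ℝ} {a i : V} (h : a < i) (x : Config V d) (y : Pt d) :
    nearFactor β i (Function.update x a y) = nearFactor β i x := by
  unfold nearFactor
  congr 2
  refine Finset.sum_congr rfl fun j hj => ?_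
  rw [Function.update_of_ne h.ne', Function.update_of_ne (h.trans (Finset.mem_filter.1 hj).2).ne']

lemma exists_lintegral_nearFactor_le (hd : 0 < d) {β : ℝ} (hβ0 : 0 ≤ β) (hβ : β < d) (R : ℝ) :
    ∃ K : ENNReal, K ≠ ⊤ ∧ ∀ (i : V) (x : Config V d),
      ∫⁻ y in Metric.ball (0 : Pt d) R, nearFactor β i (Function.update x i y) ≤ K := by
  obtain ⟨K, hK, h⟩ := exists_lintegral_rpow_le hd hβ0 hβ R
  refine ⟨volume (Metric.ball (0 : Pt d) R) + Fintype.card V * K,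
    ENNReal.add_ne_top.2 ⟨measure_ball_lt_top.ne, ENNReal.mul_ne_top (ENNReal.natCast_ne_top _) hK⟩,
    fun i x => ?_⟩
  have h1 : ∀ y, nearFactor β i (Function.update x i y) =
      1 + ∑ j ∈ Finset.univ.filter (fun j => i < j), ENNReal.ofReal (‖y - x j‖ ^ (-β)) := by
    intro y
    have hnn : ∀ j, 0 ≤ ‖y - x j‖ ^ (-β) := fun j => Real.rpow_nonneg (norm_nonneg _) _
    have h2 : ∑ j ∈ Finset.univ.filter (fun j => i < j),
        ‖Function.update x i y i - Function.update x i y j‖ ^ (-β) =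
        ∑ j ∈ Finset.univ.filter (fun j => i < j), ‖y - x j‖ ^ (-β) :=
      Finset.sum_congr rfl fun j hj => by
        rw [Function.update_self, Function.update_of_ne (Finset.mem_filter.1 hj).2.ne']
    rw [nearFactor, h2, ENNReal.ofReal_add zero_le_one (Finset.sum_nonneg fun j _ => hnn j),
      ENNReal.ofReal_one, ENNReal.ofReal_sum_of_nonneg fun j _ => hnn j]
  simp only [h1]
  rw [lintegral_add_left measurable_const, setLIntegral_one, lintegral_finsetSum]
  · refine add_le_add le_rfl ((Finset.sum_le_sum fun j _ => h (x j)).trans ?_)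
    rw [Finset.sum_const, nsmul_eq_mul]
    gcongr
    exact Finset.card_le_univ _
  · exact fun j _ => ((measurable_id.sub_const _).norm.pow_const _).ennreal_ofReal

/-- The variables are integrated in increasing order. The factor of the variable `i` is integrable
uniformly in the other variables, and no factor but its own contains the smallest variable. -/
lemma lintegral_majorant_ne_top (hd : 0 < d) {β : ℝ} (hβ0 : 0 ≤ β) (hβ : β < d) (R : ℝ) :
    ∫⁻ x in Set.univ.pi (fun _ : V => Metric.ball (0 : Pt d) R),
      ENNReal.ofReal (majorant β x) ≠ ⊤ := by
  obtain ⟨K, hK, h⟩ := exists_lintegral_nearFactor_le (V := V) hd hβ0 hβ R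
  set μ : V → Measure (Pt d) := fun _ => volume.restrict (Metric.ball (0 : Pt d) R) with hμ
  have key : ∀ s : Finset V, ∀ x : Config V d,
      lmarginal μ s (fun x => ∏ i ∈ s, nearFactor β i x) x ≤ K ^ s.card := by
    intro s
    induction s using Finset.induction_on_min with
    | empty => intro x; simp
    | insert a s ha ih =>
      intro x
      have has : a ∉ s := fun h => (ha a h).false
      rw [lmarginal_insert' _ (Finset.measurable_prod _ fun i _ => measurable_nearFactor β i) has,
        Finset.card_insert_of_notMem has, pow_succ']
      have h1 : (fun x : Config V d => ∫⁻ y, ∏ i ∈ insert a s,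
          nearFactor β i (Function.update x a y) ∂μ a) ≤
          fun x => K * ∏ i ∈ s, nearFactor β i x := by
        intro x
        have h2 : ∀ y, ∏ i ∈ insert a s, nearFactor β i (Function.update x a y) =
            nearFactor β a (Function.update x a y) * ∏ i ∈ s, nearFactor β i x := fun y => by
          rw [Finset.prod_insert has]
          congr 1
          exact Finset.prod_congr rfl fun i hi => nearFactor_update (ha i hi) x y
        simp only [h2]
        rw [lintegral_mul_const]
        · exact mul_le_mul_left (h a x) _
        · exact (measurable_nearFactor β a).comp (measurable_update x)
      refine (lmarginal_mono h1 x).trans ?_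
      rw [lmarginal, lintegral_const_mul' _ _ hK]
      exact mul_le_mul_right (ih x) K
  have h1 : ∀ x : Config V d, ENNReal.ofReal (majorant β x) =
      ∏ i, nearFactor β i x := fun x =>
    ENNReal.ofReal_prod_of_nonneg fun i _ => add_nonneg zero_le_one
      (Finset.sum_nonneg fun j _ => Real.rpow_nonneg (norm_nonneg _) _)
  simp only [h1]
  rw [volume_pi, Measure.restrict_pi_pi]
  have h2 := key Finset.univ 0
  rw [← lintegral_eq_lmarginal_univ] at h2
  exact (h2.trans_lt (ENNReal.pow_lt_top hK.lt_top)).ne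

end Integrability

/-! ### Regularity at configurations of distinct points -/

section Regularity

variable {V : Type*} [Fintype V] {G : SimpleGraph V} {d : ℕ}

lemma continuous_contractAll (F : Finset (Finset V)) :
    Continuous (fun x : Config V d => contractAll G F x) := by
  unfold contractAll
  generalize innerFirst F = l
  induction l with
  | nil => exact continuous_id
  | cons γ l ih => exact ih.comp (contDiff_contract G γ).continuous

lemma isClosed_nonExceptional (u : GraphWeight G d) (ε : ℝ) : IsClosed (u.nonExceptional ε) := by
  unfold GraphWeight.nonExceptional
  simp only [Set.ofPred_forall]
  refine isClosed_iInter fun F => isClosed_iInter fun _ => isClosed_iInter fun _ =>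
    isClosed_iInter fun v => isClosed_iInter fun w => isClosed_iInter fun _ =>
    isClosed_iInter fun _ => isClosed_iInter fun γ => isClosed_iInter fun _ =>
    isClosed_iInter fun _ => isClosed_iInter fun i => isClosed_iInter fun _ =>
    isClosed_iInter fun j => isClosed_iInter fun _ => ?_
  have hc := continuous_contractAll (G := G) (d := d) F
  exact isClosed_le (continuous_const.mul ((continuous_apply i).sub (continuous_apply j)).norm)
    (((continuous_apply v).comp hc).sub ((continuous_apply w).comp hc)).norm

lemma foldl_movers_eq {F : Finset (Finset V)} (hF : Laminar F) (e : Sym2 V) (x : Config V d) :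
    (movers G (innerFirst F) e).foldl (fun z γ => contract G γ z) x =
      contractAll G (F.filter (fun γ => e ∉ edgesIn G γ)) x := by
  rw [contractAll, ← flow_eq_foldl_contract G (ρ := fun _ => 1) (r := fun _ => 0) (fun _ _ => rfl),
    ← flow_eq_foldl_contract G (ρ := fun _ => 1) (r := fun _ => 0) (fun _ _ => rfl)]
  refine flow_eq_of_subset ((innerFirst_sorted _).filter _) (innerFirst_sorted _)
    ((innerFirst_nodup _).filter _) (innerFirst_nodup _) (fun a ha b hb => hF a ?_ b ?_)
    (fun _ _ => one_ne_zero) (fun γ hγ => ?_) (fun γ hγ hγ' => absurd ?_ hγ')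
  · exact mem_innerFirst.1 (List.mem_filter.1 ha).1
  · exact mem_innerFirst.1 (List.mem_filter.1 hb).1
  · have h := Finset.mem_filter.1 (mem_innerFirst.1 hγ)
    exact List.mem_filter.2 ⟨mem_innerFirst.2 h.1, by simpa using h.2⟩
  · have h := List.mem_filter.1 hγ
    exact mem_innerFirst.2 (Finset.mem_filter.2 ⟨mem_innerFirst.1 h.1, by simpa using h.2⟩)

lemma contractAll_apply_of_notMem {F : Finset (Finset V)} {x : Config V d} {v : V}
    (h : ∀ γ ∈ F, v ∉ γ) : contractAll G F x v = x v := by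
  rw [contractAll, ← flow_eq_foldl_contract G (ρ := fun _ => 1) (r := fun _ => 0) (fun _ _ => rfl)]
  exact flow_apply_of_notMem G fun γ hγ => h γ (mem_innerFirst.1 hγ)

/-- For a non-exceptional configuration of distinct points no edge is contracted to a point. -/
lemma contractAll_ne {u : GraphWeight G d} {ε : ℝ} (hε : 0 < ε) {x : Config V d}
    (hx : x ∈ u.nonExceptional ε) (hinj : Function.Injective x) {F : Finset (Finset V)}
    (hF : F ∈ admForests u.Adm) {v w : V} (hvw : G.Adj v w)
    (hnot : ∀ γ ∈ F, ¬ (v ∈ γ ∧ w ∈ γ)) : contractAll G F x v ≠ contractAll G F x w := by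
  rw [mem_admForests] at hF
  have hFf : F ∈ forests G := by
    rw [forests, Finset.mem_filter]
    exact ⟨Finset.mem_univ _, fun γ hγ => (hF.1 γ hγ).1, hF.2⟩
  have key : ∀ v w, G.Adj v w → (∀ γ ∈ F, ¬ (v ∈ γ ∧ w ∈ γ)) → (∃ γ ∈ F, v ∈ γ) →
      contractAll G F x v ≠ contractAll G F x w := by
    rintro v w hvw hnot ⟨γ, hγ, hv⟩ heq
    obtain ⟨i, hi, j, hj, hij⟩ := exists_ne_mem_of_edgesIn_nonempty (hF.1 γ hγ).1
    have h := hx F hFf (fun γ hγ => (hF.1 γ hγ).2) v w hvw hnot γ hγ hv i hi j hj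
    rw [heq, sub_self, norm_zero] at h
    exact absurd h (not_le.2 (mul_pos hε (norm_pos_iff.2 (sub_ne_zero.2 fun h => hij (hinj h)))))
  by_cases hv : ∃ γ ∈ F, v ∈ γ
  · exact key v w hvw hnot hv
  by_cases hw : ∃ γ ∈ F, w ∈ γ
  · exact (key w v hvw.symm (fun γ hγ h => hnot γ hγ h.symm) hw).symm
  push Not at hv hw
  rw [contractAll_apply_of_notMem hv, contractAll_apply_of_notMem hw]
  exact fun h => hvw.ne (hinj h)

lemma continuousAt_bphzR {u : GraphWeight G d} {ε : ℝ} (hε : 0 < ε) {x : Config V d}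
    (hx : x ∈ u.nonExceptional ε) (hinj : Function.Injective x) : ContinuousAt u.bphzR x := by
  have h : u.bphzR = fun x => ∑ F ∈ admForests u.Adm, u.forestTerm (innerFirst F) ∅ x :=
    funext fun x => bphzR_eq_sum u x
  rw [h]
  refine tendsto_finsetSum _ fun F hF => ?_
  have hlam := (mem_admForests.1 hF).2
  rw [forestTerm_eq_termOf]
  refine (contDiffAt_termOf u.vertex_smooth
    (edgesGood_of_forall G hlam.nested_innerFirst fun e he => ?_)).continuousAt
  rw [Finset.sdiff_empty, mem_allEdges] at he
  rw [foldl_movers_eq hlam]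
  refine (u.edge_smooth e he).contDiffAt (isOpen_offDiag.mem_nhds ?_)
  exact contractAll_ne hε hx hinj (mem_admForests_mono hF (Finset.filter_subset _ _)) (adj_out he)
    fun γ hγ h => (Finset.mem_filter.1 hγ).2 (mem_edgesIn_iff_out.2 ⟨he, h⟩)

lemma ae_injective (hd : 0 < d) : ∀ᵐ x : Config V d, Function.Injective x := by
  have h : ∀ i j : V, i ≠ j → ∀ᵐ x : Config V d, x i ≠ x j := by
    intro i j hij
    set p : Config V d →ₗ[ℝ] Pt d :=
      LinearMap.proj (R := ℝ) (φ := fun _ : V => Pt d) i -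
        LinearMap.proj (R := ℝ) (φ := fun _ : V => Pt d) j with hp
    have htop : LinearMap.ker p ≠ ⊤ := by
      intro h
      have h1 : Pi.single i (EuclideanSpace.single (⟨0, hd⟩ : Fin d) (1 : ℝ)) ∈ LinearMap.ker p := by
        rw [h]; trivial
      rw [LinearMap.mem_ker, hp, LinearMap.sub_apply, LinearMap.proj_apply, LinearMap.proj_apply,
        Pi.single_eq_same, Pi.single_eq_of_ne hij.symm, sub_zero] at h1
      simpa using congrArg norm h1
    have h0 := Measure.addHaar_submodule (volume : Measure (Config V d)) (LinearMap.ker p) htop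
    rw [ae_iff]
    refine measure_mono_null (fun x hx => ?_) h0
    have hx : ¬ x i ≠ x j := hx
    rw [SetLike.mem_coe, LinearMap.mem_ker, hp, LinearMap.sub_apply, LinearMap.proj_apply,
      LinearMap.proj_apply, sub_eq_zero]
    exact not_not.1 hx
  have h2 : ∀ᵐ x : Config V d, ∀ i j : V, i ≠ j → x i ≠ x j :=
    ae_all_iff.2 fun i => ae_all_iff.2 fun j => by
      by_cases hij : i = j
      · exact Eventually.of_forall fun x h => absurd hij h
      · exact (h i j hij).mono fun x hx _ => hx
  exact h2.mono fun x hx i j hij => by_contra fun hne => hx i j hne hij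

lemma aestronglyMeasurable_indicator_bphzR (u : GraphWeight G d) (hd : 0 < d) {ε : ℝ} (hε : 0 < ε) :
    AEStronglyMeasurable ((u.nonExceptional ε).indicator u.bphzR) volume := by
  have hm := (isClosed_nonExceptional u ε).measurableSet
  rw [aestronglyMeasurable_indicator_iff hm]
  set I : Set (Config V d) := {x | Function.Injective x} with hI
  have hIm : MeasurableSet I := by
    have : I = ⋂ (i : V) (j : V) (_ : i ≠ j), {x | x i ≠ x j} := by
      ext x
      simp only [hI, Set.mem_ofPred_eq, Set.mem_iInter]
      exact ⟨fun h i j hij h' => hij (h h'), fun h i j hij => by_contra fun hne => h i j hne hij⟩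
    rw [this]
    exact MeasurableSet.iInter fun i => MeasurableSet.iInter fun j => MeasurableSet.iInter fun _ =>
      (isOpen_ne_fun (continuous_apply i) (continuous_apply j)).measurableSet
  have hae : (u.nonExceptional ε ∩ I : Set (Config V d)) =ᵐ[volume] u.nonExceptional ε := by
    filter_upwards [ae_injective (V := V) hd] with x hx
    exact propext ⟨fun h => h.1, fun h => ⟨h, hx⟩⟩
  rw [← Measure.restrict_congr_set hae]
  exact ContinuousOn.aestronglyMeasurable
    (fun x hx => (continuousAt_bphzR hε hx.1 hx.2).continuousWithinAt) (hm.inter hIm)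

end Regularity

/-! ### Local integrability -/

section Main

variable {V : Type*} [Fintype V] {G : SimpleGraph V} {d : ℕ}

theorem integrableOn_indicator_bphzR [LinearOrder V] (u : GraphWeight G d) (hd : 0 < d)
    (hpos : ∀ e ∈ G.edgeSet, 0 < scalingDegree (u.edge e))
    (hfin : ∀ e ∈ G.edgeSet, scalingDegree (u.edge e) < ⊤) {ε : ℝ} (hε : 0 < ε) (R : ℝ) :
    IntegrableOn ((u.nonExceptional ε).indicator u.bphzR)
      (Set.univ.pi (fun _ : V => Metric.ball (0 : Pt d) R)) volume := by
  obtain ⟨β, hβ0, hβ, h⟩ := exists_norm_bphzR_le u hd hpos hfin hε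
  obtain ⟨C, hC⟩ := h R
  have hms : MeasurableSet (Set.univ.pi (fun _ : V => Metric.ball (0 : Pt d) R)) :=
    MeasurableSet.univ_pi fun _ => Metric.isOpen_ball.measurableSet
  refine ⟨(aestronglyMeasurable_indicator_bphzR u hd hε).restrict, ?_⟩
  have hbound : ∀ᵐ x ∂(volume.restrict (Set.univ.pi (fun _ : V => Metric.ball (0 : Pt d) R))),
      ‖(u.nonExceptional ε).indicator u.bphzR x‖ₑ ≤
        ENNReal.ofReal |C| * ENNReal.ofReal (majorant β x) := by
    filter_upwards [ae_restrict_of_ae (ae_injective (V := V) hd), ae_restrict_mem hms] with x hx hxR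
    by_cases hxN : x ∈ u.nonExceptional ε
    · rw [Set.indicator_of_mem hxN, ← ofReal_norm, ← ENNReal.ofReal_mul (abs_nonneg C)]
      refine ENNReal.ofReal_le_ofReal ((hC x hxN (fun v => ?_) hx).trans ?_)
      · exact (mem_ball_zero_iff.1 (hxR v (Set.mem_univ v))).le
      · exact mul_le_mul_of_nonneg_right (le_abs_self C) (zero_le_one.trans (one_le_majorant β x))
    · rw [Set.indicator_of_notMem hxN, enorm_zero]
      exact zero_le
  refine (lintegral_mono_ae hbound).trans_lt ?_
  rw [lintegral_const_mul' _ _ ENNReal.ofReal_ne_top]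
  exact ENNReal.mul_lt_top ENNReal.ofReal_lt_top (lintegral_majorant_ne_top hd hβ0 hβ R).lt_top

end Main

end

end BPHZ

theorem mainTheorem1 {V : Type*} [Fintype V] (G : SimpleGraph V) (d : ℕ)
    (u : BPHZ.GraphWeight G d)
    (hpos : ∀ e ∈ G.edgeSet, 0 < BPHZ.scalingDegree (u.edge e))
    (hfin : ∀ e ∈ G.edgeSet, BPHZ.scalingDegree (u.edge e) < ⊤)
    (ε : ℝ) (hε : 0 < ε) :
    MeasureTheory.LocallyIntegrable
      (Set.indicator (u.nonExceptional ε) u.bphzR) MeasureTheory.volume := by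
  rcases Nat.eq_zero_or_pos d with rfl | hd
  · -- `ℝ^0` is a point, so that every function of the configuration is constant.
    exact (continuous_of_const fun x y => congrArg _ (Subsingleton.elim x y)).locallyIntegrable
  · rw [MeasureTheory.locallyIntegrable_iff]
    intro K hK
    obtain ⟨R, hR0, hR⟩ := hK.isBounded.exists_pos_norm_lt
    let _ : LinearOrder V := LinearOrder.lift' (Fintype.equivFin V) (Fintype.equivFin V).injective
    refine (BPHZ.integrableOn_indicator_bphzR u hd hpos hfin hε R).mono_set fun x hx v _ => ?_
    exact mem_ball_zero_iff.2 ((norm_le_pi_norm x v).trans_lt (hR x hx))
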